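/- Let $G$ be a (finite-dimensional, Hausdorff, second countable, real) Lie group with Lie algebra $\mathfrak g$, $N$ a closed normal subgroup with Lie algebra $\mathfrak n$, and $a\in\mathfrak n^*$ such that the coadjoint orbit $U=N(a)\subset\mathfrak n^*$ is invariant under the coadjoint action of $G$ on $\mathfrak n^*$. Write $L=G_a$ and $K=N_a=N\cap L$ for the stabilizers of $a$, $K^{o}$ for the identity component of $K$, and $\mathfrak l,\mathfrak k$ for the Lie algebras of $L,K$. Put $$\tilde U=N/K^{o},\qquad \tilde G=(N\rtimes L)/\{(k^{-1},k):k\in K^{o}\},\qquad \tilde N=\{[n,e]:n\in N\}\subset\tilde G,$$ where $L$ acts on $N$ by conjugation; thus $[n,l]\mapsto nl$ is a covering $\tilde G\to G$, and $\tilde G$ acts on $\tilde U$ by $[n,l](n'K^{o})=n\,l n'l^{-1}K^{o}$. Given $\check a\in\mathfrak g^*$ with $\check a_{|\mathfrak n}=a$, put $\phi_{\tilde U}(nK^{o})=n(\check a)\in\mathfrak g^*$. 1. For every such $\check a$, the map $\phi_{\tilde U}$ is well defined, and $\theta_{\tilde U}(\tilde g)=\phi_{\tilde U}(\tilde g(\tilde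 u))-g(\phi_{\tilde U}(\tilde u))$ (where $\tilde g\in\tilde G$ lies over $g\in G$) does not depend on $\tilde u\in\tilde U$, depends only on the class of $\tilde g$ in $\tilde G/\tilde N$, and takes its values in $\mathrm{ann}_{\mathfrak g^*}(\mathfrak n)=(\mathfrak g/\mathfrak n)^*$. It is a $1$-cocycle of $\tilde G/\tilde N$ with values in $(\mathfrak g/\mathfrak n)^*$ (on which $\tilde G/\tilde N$ acts through the coadjoint action of $G$), and its class $[\theta_{\tilde U}]\in H^1(\tilde G/\tilde N,(\mathfrak g/\mathfrak n)^*)$ does not depend on the choice of $\check a$. 2. The class $[\theta_{\tilde U}]$ is the obstruction to making $U$ a hamiltonian $G$-space: $[\theta_{\tilde U}]=0$ if and only if there are a smooth action of $G$ on $U=N/K$ extending the action of $N$ and preserving the Kirillov–Kostant–Souriau symplectic form of $U$, and a $G$-equivariant moment map $\Phi:U\to\mathfrak g^*$ for it whose composition with the restriction $\mathfrak g^*\to\mathfrak n^*$ is the inclusion $U\hookrightarrow\mathfrak n^*$. 3. If $a_{|\mathfrak k}=0$, then $[\theta_{\tilde U}]=0$. 4. For every cocycle $\theta$ in the class $[\theta_{\tilde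 U}]$, the bilinear form $\langle D\theta(e)(\cdot),\cdot\rangle$ on $\mathfrak g$ comes from a $2$-cocycle of the Lie algebra $\mathfrak g/\mathfrak n$ with values in the trivial module $\mathbf R$, and its class in $H^2(\mathfrak g/\mathfrak n,\mathbf R)$ (the derived class of $[\theta_{\tilde U}]$) does not depend on the choice of $\theta$. Put $\mathfrak j=\ker(a_{|\mathfrak k})$; both $\mathfrak k$ and $\mathfrak j$ are ideals of $\mathfrak l$. If $a_{|\mathfrak k}\neq0$, then the inclusion $\mathfrak l\to\mathfrak g$ induces an isomorphism $\mathfrak l/\mathfrak k\to\mathfrak g/\mathfrak n$, $a$ induces a linear isomorphism $\mathfrak k/\mathfrak j\to\mathbf R$, $$0\longrightarrow\mathfrak k/\mathfrak j\longrightarrow\mathfrak l/\mathfrak j\longrightarrow\mathfrak l/\mathfrak k\longrightarrow0$$ is a central extension of Lie algebras, and, under these identifications, its class in $H^2(\mathfrak g/\mathfrak n,\mathbf R)$ is the derived class of $[\theta_{\tilde U}]$. Here the class of the extension is that of the cocycle $(x,y)\mapsto\langle a,[s(x),s(y)]-s([x,y])\rangle$, for any linear section $s$ of $\mathfrak l/\mathfrak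 j\to\mathfrak l/\mathfrak k$. -/

import Mathlib

open scoped Manifold ContDiff Topology

noncomputable section

namespace Mackey

instance : ENat.LEInfty (minSmoothness ℝ 3) := ⟨by
  rw [minSmoothness_of_isRCLikeNormedField]; exact ENat.LEInfty.out⟩

section LieGroup

variable {E : Type*} [NormedAddCommGroup E] [NormedSpace ℝ E]
  {G : Type*} [TopologicalSpace G] [ChartedSpace E G] [Group G]

/-- `γ` is a smooth curve through the identity with velocity `X`. -/
structure IsCurve (γ : ℝ → G) (X : GroupLieAlgebra 𝓘(ℝ, E) G) : Prop where
  map_zero : γ 0 = 1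
  smooth : ContMDiffAt 𝓘(ℝ, ℝ) 𝓘(ℝ, E) ∞ γ 0
  velocity : mfderiv 𝓘(ℝ, ℝ) 𝓘(ℝ, E) γ 0 (1 : ℝ) = X

/-- The adjoint operator `Ad g`: the derivative at `1` of `x ↦ g x g⁻¹`. -/
def AdLin (g : G) : GroupLieAlgebra 𝓘(ℝ, E) G →L[ℝ] GroupLieAlgebra 𝓘(ℝ, E) G :=
  mfderiv 𝓘(ℝ, E) 𝓘(ℝ, E) (fun x : G => g * x * g⁻¹) 1

variable [LieGroup 𝓘(ℝ, E) ∞ G]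

lemma IsCurve.comp {F : G → G} {γ : ℝ → G} {X : GroupLieAlgebra 𝓘(ℝ, E) G} (h : IsCurve γ X)
    (hF : ContMDiffAt 𝓘(ℝ, E) 𝓘(ℝ, E) ∞ F 1) (h1 : F 1 = 1) :
    IsCurve (F ∘ γ) ((mfderiv 𝓘(ℝ, E) 𝓘(ℝ, E) F 1 : E →L[ℝ] E) X) where
  map_zero := by simp [h.map_zero, h1]
  smooth := ContMDiffAt.comp (0 : ℝ) (by rw [h.map_zero]; exact hF) h.smooth
  velocity := by
    have := mfderiv_comp_apply_of_eq (I := 𝓘(ℝ, ℝ)) (I' := 𝓘(ℝ, E)) (I'' := 𝓘(ℝ, E))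
      (g := F) (f := γ) (x := (0:ℝ)) (hF.mdifferentiableAt (by simp))
      (h.smooth.mdifferentiableAt (by simp)) h.map_zero (1:ℝ)
    rw [this, ← h.velocity]

lemma IsCurve.mul {γ δ : ℝ → G} {X Y : GroupLieAlgebra 𝓘(ℝ, E) G} (h : IsCurve γ X)
    (h' : IsCurve δ Y) : IsCurve (fun t => γ t * δ t) (X + Y) where
  map_zero := by simp [h.map_zero, h'.map_zero]
  smooth := h.smooth.mul h'.smooth
  velocity := by
    have hm : MDifferentiableAt (𝓘(ℝ, E).prod 𝓘(ℝ, E)) 𝓘(ℝ, E) (fun p : G × G => p.1 * p.2)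
        ((1 : G), (1 : G)) := (contMDiff_mul 𝓘(ℝ, E) ∞).mdifferentiable (by simp) _
    have hγ := h.smooth.mdifferentiableAt (by simp)
    have hδ := h'.smooth.mdifferentiableAt (by simp)
    have h0 : ((fun t => (γ t, δ t)) (0:ℝ)) = ((1 : G), (1 : G)) := by
      simp [h.map_zero, h'.map_zero]
    have := mfderiv_comp_apply_of_eq (I := 𝓘(ℝ, ℝ)) (I' := 𝓘(ℝ, E).prod 𝓘(ℝ, E)) (I'' := 𝓘(ℝ, E))
      (g := fun p : G × G => p.1 * p.2) (f := fun t => (γ t, δ t)) (x := (0:ℝ)) hm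
      (hγ.prodMk hδ) h0 (1:ℝ)
    have h2 : (fun t => γ t * δ t) = (fun p : G × G => p.1 * p.2) ∘ (fun t => (γ t, δ t)) := rfl
    rw [h2, this, mfderiv_prodMk hγ hδ]
    have key : ∀ u v : E, (mfderiv (𝓘(ℝ, E).prod 𝓘(ℝ, E)) 𝓘(ℝ, E) (fun p : G × G => p.1 * p.2)
        ((1 : G), (1 : G)) : E × E →L[ℝ] E) (u, v) = u + v := by
      intro u v
      have e := mfderiv_prod_eq_add_apply (v := ((u, v) : E × E)) hm
      refine e.trans ?_
      have e1 : (fun z : G => z * (1 : G)) = id := by ext; simp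
      have e2 : (fun z : G => (1 : G) * z) = id := by ext; simp
      have i1 : mfderiv 𝓘(ℝ, E) 𝓘(ℝ, E) (fun z : G => z * (1 : G)) 1 =
          ContinuousLinearMap.id ℝ E := by rw [e1]; exact mfderiv_id
      have i2 : mfderiv 𝓘(ℝ, E) 𝓘(ℝ, E) (fun z : G => (1 : G) * z) 1 =
          ContinuousLinearMap.id ℝ E := by rw [e2]; exact mfderiv_id
      exact congrArg₂ (· + ·) (congrArg (fun L : E →L[ℝ] E => L u) i1)
        (congrArg (fun L : E →L[ℝ] E => L v) i2)
    refine (key _ _).trans ?_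
    rw [← h.velocity, ← h'.velocity]
    rfl

lemma IsCurve.smul {γ : ℝ → G} {X : GroupLieAlgebra 𝓘(ℝ, E) G} (h : IsCurve γ X) (c : ℝ) :
    IsCurve (fun t => γ (c * t)) (c • X) where
  map_zero := by simp [h.map_zero]
  smooth := by
    have hs : ContMDiffAt 𝓘(ℝ, ℝ) 𝓘(ℝ, ℝ) ∞ (fun t : ℝ => c * t) 0 :=
      (contDiff_const.mul contDiff_id).contDiffAt.contMDiffAt
    exact ContMDiffAt.comp (0 : ℝ) (by rw [mul_zero]; exact h.smooth) hs
  velocity := by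
    have hs : HasDerivAt (fun t : ℝ => c * t) c 0 := by
      simpa using (hasDerivAt_id (0 : ℝ)).const_mul c
    have := mfderiv_comp_apply_of_eq (I := 𝓘(ℝ, ℝ)) (I' := 𝓘(ℝ, ℝ)) (I'' := 𝓘(ℝ, E))
      (g := γ) (f := fun t : ℝ => c * t) (x := (0:ℝ)) (y := (0 : ℝ))
      (h.smooth.mdifferentiableAt (by simp))
      hs.hasFDerivAt.differentiableAt.mdifferentiableAt (by simp) (1:ℝ)
    refine this.trans ?_
    rw [mfderiv_eq_fderiv, hs.hasFDerivAt.fderiv, ← h.velocity]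
    have e := (mfderiv 𝓘(ℝ, ℝ) 𝓘(ℝ, E) γ 0 : ℝ →L[ℝ] E).map_smul c 1
    have t1 : (ContinuousLinearMap.toSpanSingleton ℝ c) (1 : ℝ) = c • (1 : ℝ) := by simp
    exact (congrArg (fun z : ℝ => (mfderiv 𝓘(ℝ, ℝ) 𝓘(ℝ, E) γ 0 : ℝ →L[ℝ] E) z) t1).trans e

lemma isCurve_const : IsCurve (fun _ : ℝ => (1 : G)) (0 : GroupLieAlgebra 𝓘(ℝ, E) G) where
  map_zero := rfl
  smooth := contMDiffAt_const
  velocity := by rw [mfderiv_const]; rfl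

lemma exists_isCurve (X : GroupLieAlgebra 𝓘(ℝ, E) G) : ∃ γ : ℝ → G, IsCurve γ X := by
  let φ := extChartAt 𝓘(ℝ, E) (1 : G)
  let W : E := (mfderiv 𝓘(ℝ, E) 𝓘(ℝ, E) φ (1 : G) : E →L[ℝ] E) X
  have hφ : ContMDiffAt 𝓘(ℝ, E) 𝓘(ℝ, E) ∞ φ.symm (φ 1) := by
    have := contMDiffOn_extChartAt_symm (I := 𝓘(ℝ, E)) (n := ∞) (1 : G)
    exact (this _ (mem_extChartAt_target _)).contMDiffAt (extChartAt_target_mem_nhds _)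
  have hl : ContMDiffAt 𝓘(ℝ, ℝ) 𝓘(ℝ, E) ∞ (fun t : ℝ => φ 1 + t • W) 0 :=
    (contDiff_const.add (contDiff_id.smul contDiff_const)).contDiffAt.contMDiffAt
  have h0 : φ 1 + (0 : ℝ) • W = φ 1 := by rw [zero_smul, add_zero]
  refine ⟨fun t => φ.symm (φ 1 + t • W), by
    rw [h0]; exact φ.left_inv (mem_extChartAt_source _),
    ContMDiffAt.comp (0 : ℝ) (by rw [h0]; exact hφ) hl, ?_⟩
  have := mfderiv_comp_apply_of_eq (I := 𝓘(ℝ, ℝ)) (I' := 𝓘(ℝ, E)) (I'' := 𝓘(ℝ, E))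
      (g := φ.symm) (f := fun t : ℝ => φ 1 + t • W) (x := (0:ℝ)) (y := φ 1)
      (hφ.mdifferentiableAt (by simp)) (hl.mdifferentiableAt (by simp)) h0 (1:ℝ)
  refine this.trans ?_
  have hd : HasDerivAt (fun t : ℝ => φ 1 + t • W) W 0 := by
    simpa using ((hasDerivAt_id (0 : ℝ)).smul_const W).const_add (φ 1)
  rw [mfderiv_eq_fderiv, hd.hasFDerivAt.fderiv]
  have e := mfderivWithin_extChartAt_symm_comp_mfderiv_extChartAt' (I := 𝓘(ℝ, E))
    (mem_extChartAt_source (I := 𝓘(ℝ, E)) (1 : G))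
  have e2 := congrArg (fun L : E →L[ℝ] E => L X) e
  rw [ModelWithCorners.range_eq_univ, mfderivWithin_univ] at e2
  have t1 : (ContinuousLinearMap.toSpanSingleton ℝ W) (1 : ℝ) = W := by simp
  exact (congrArg (fun z : E => (mfderiv 𝓘(ℝ, E) 𝓘(ℝ, E) φ.symm (φ 1) : E →L[ℝ] E) z) t1).trans e2

lemma IsCurve.unique {γ : ℝ → G} {X Y : GroupLieAlgebra 𝓘(ℝ, E) G} (h : IsCurve γ X)
    (h' : IsCurve γ Y) : X = Y := h.velocity.symm.trans h'.velocity

lemma IsCurve.inv {γ : ℝ → G} {X : GroupLieAlgebra 𝓘(ℝ, E) G} (h : IsCurve γ X) :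
    IsCurve (fun t => (γ t)⁻¹) (-X) := by
  have h1 : IsCurve (fun t => (γ t)⁻¹) _ :=
    h.comp (F := fun g => g⁻¹) (contMDiff_inv 𝓘(ℝ, E) ∞).contMDiffAt inv_one
  have h2 := h.mul h1
  simp only [mul_inv_cancel] at h2
  have h3 := h2.unique isCurve_const
  rw [← eq_neg_of_add_eq_zero_right h3]
  exact h1

lemma contMDiff_conj (g : G) :
    ContMDiff 𝓘(ℝ, E) 𝓘(ℝ, E) ∞ (fun x : G => g * x * g⁻¹) :=
  (contMDiff_const.mul contMDiff_id).mul contMDiff_const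

lemma IsCurve.conj {γ : ℝ → G} {X : GroupLieAlgebra 𝓘(ℝ, E) G} (h : IsCurve γ X) (g : G) :
    IsCurve (fun t => g * γ t * g⁻¹) (AdLin g X) :=
  h.comp (contMDiff_conj g).contMDiffAt (by simp)

/-- The adjoint representation `Ad` of `G` on its Lie algebra. -/
def Ad : Representation ℝ G (GroupLieAlgebra 𝓘(ℝ, E) G) where
  toFun g := (AdLin g).toLinearMap
  map_one' := by
    ext X
    obtain ⟨γ, hγ⟩ := exists_isCurve X
    have := hγ.conj 1
    simp only [one_mul, inv_one, mul_one] at this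
    exact this.unique hγ
  map_mul' g h := by
    ext X
    obtain ⟨γ, hγ⟩ := exists_isCurve X
    refine (hγ.conj (g * h)).unique ?_
    have := (hγ.conj h).conj g
    simpa [mul_assoc] using! this

/-- The Lie algebra of a subgroup `H`, as a subspace of the Lie algebra of `G`: the velocities at
the identity of the smooth curves of `G` that stay in `H`. -/
def lieSub (H : Subgroup G) : Submodule ℝ (GroupLieAlgebra 𝓘(ℝ, E) G) where
  carrier := {X | ∃ γ : ℝ → G, IsCurve γ X ∧ ∀ t, γ t ∈ H}
  add_mem' := by
    rintro X Y ⟨γ, hγ, h⟩ ⟨δ, hδ, h'⟩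
    exact ⟨_, hγ.mul hδ, fun t => H.mul_mem (h t) (h' t)⟩
  zero_mem' := ⟨_, isCurve_const, fun _ => H.one_mem⟩
  smul_mem' := by
    rintro c X ⟨γ, hγ, h⟩
    exact ⟨_, hγ.smul c, fun t => h _⟩

lemma lieSub_mono {H H' : Subgroup G} (h : H ≤ H') : lieSub (E := E) H ≤ lieSub H' := by
  rintro X ⟨γ, hγ, h1⟩
  exact ⟨γ, hγ, fun t => h (h1 t)⟩

variable (N : Subgroup G) [N.Normal]

lemma Ad_mem_lieSub (g : G) : lieSub (E := E) N ≤ (lieSub N).comap (Ad g) := by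
  rintro X ⟨γ, hγ, h⟩
  exact ⟨_, hγ.conj g, fun t => ‹N.Normal›.conj_mem _ (h t) g⟩

lemma Ad_sub_self_mem_lieSub {n : G} (hn : n ∈ N) (X : GroupLieAlgebra 𝓘(ℝ, E) G) :
    Ad n X - X ∈ lieSub N := by
  obtain ⟨γ, hγ⟩ := exists_isCurve X
  rw [sub_eq_add_neg]
  refine ⟨_, (hγ.conj n).mul hγ.inv, fun t => ?_⟩
  have := N.mul_mem hn (‹N.Normal›.conj_mem _ (N.inv_mem hn) (γ t))
  simpa [mul_assoc] using this

/-- The coadjoint representation of `G` on `𝔤*`. -/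
def coadG : Representation ℝ G (Module.Dual ℝ (GroupLieAlgebra 𝓘(ℝ, E) G)) := Ad.dual

/-- The coadjoint representation of `G` on `𝔫*`. -/
def coadN : Representation ℝ G (Module.Dual ℝ (lieSub (E := E) N)) :=
  (Ad.subrepresentation (lieSub N) (Ad_mem_lieSub N)).dual

/-- The representation of `G` on `(𝔤/𝔫)*` dual to the adjoint representation on `𝔤/𝔫`. -/
def coadQuot : Representation ℝ G (Module.Dual ℝ (GroupLieAlgebra 𝓘(ℝ, E) G ⧸ lieSub N)) :=
  (Ad.quotient (lieSub N) (Ad_mem_lieSub N)).dual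

lemma coadQuot_of_mem {n : G} (hn : n ∈ N) : coadQuot (E := E) N n = 1 := by
  refine LinearMap.ext fun f => LinearMap.ext fun X => ?_
  obtain ⟨X, rfl⟩ := Submodule.mkQ_surjective _ X
  change f (Submodule.Quotient.mk (Ad n⁻¹ X)) = f (Submodule.Quotient.mk X)
  exact congrArg f ((Submodule.Quotient.eq _).2 (Ad_sub_self_mem_lieSub N (N.inv_mem hn) X))

variable {N}
variable (a : Module.Dual ℝ (lieSub (E := E) N))

/-- The stabilizer `L = G_a` of `a ∈ 𝔫*` in `G`. -/
def stabG : Subgroup G where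
  carrier := {g | coadN N g a = a}
  one_mem' := by simp
  mul_mem' := by
    intro g h hg hh
    simp only [Set.mem_ofPred_eq, map_mul, Module.End.mul_apply] at *
    rw [hh, hg]
  inv_mem' := by
    intro g hg
    simp only [Set.mem_ofPred_eq] at *
    conv_lhs => rw [← hg]
    exact (coadN N).inv_self_apply g a

/-- The stabilizer `K = N_a` of `a` in `N`, as a subgroup of `G`. -/
def stabN : Subgroup G := N ⊓ stabG a

lemma conj_mem_stabN {l k : G} (hl : l ∈ stabG a) (hk : k ∈ stabN a) :
    l * k * l⁻¹ ∈ stabN a :=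
  ⟨‹N.Normal›.conj_mem _ hk.1 _,
    (stabG a).mul_mem ((stabG a).mul_mem hl hk.2) ((stabG a).inv_mem hl)⟩

/-- The identity component `K°` of `K`, as a subgroup of `G`. -/
def stabNo : Subgroup G :=
  letI : IsTopologicalGroup G := topologicalGroup_of_lieGroup 𝓘(ℝ, E) ∞
  (Subgroup.connectedComponentOfOne (stabN a)).map (stabN a).subtype

lemma stabNo_le : stabNo a ≤ stabN a := by
  rintro _ ⟨k, _, rfl⟩
  exact k.2

lemma conj_mem_stabNo {l k : G} (hl : l ∈ stabG a) (hk : k ∈ stabNo a) :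
    l * k * l⁻¹ ∈ stabNo a := by
  let _ : IsTopologicalGroup G := topologicalGroup_of_lieGroup 𝓘(ℝ, E) ∞
  obtain ⟨k, hk, rfl⟩ := hk
  let c : stabN a → stabN a := fun x => ⟨l * x * l⁻¹, conj_mem_stabN a hl x.2⟩
  have hc : Continuous c := by
    refine Continuous.subtype_mk ?_ _
    exact (continuous_const.mul continuous_subtype_val).mul continuous_const
  refine ⟨c k, ?_, rfl⟩
  have h1 : c 1 = 1 := Subtype.ext (by simp [c])
  have := hc.image_connectedComponent_subset 1 ⟨k, hk, rfl⟩
  rwa [h1] at this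

/-- The semidirect product `N ⋊ L`, where `L` acts on `N` by conjugation. -/
abbrev SemiNL : Type _ := N ⋊[(MulAut.conjNormal (H := N)).comp (stabG a).subtype] (stabG a)

/-- `N ⋊ L` carries the product topology of `N × L`. -/
instance : TopologicalSpace (SemiNL a) :=
  TopologicalSpace.induced (fun x => (x.left, x.right)) inferInstance

/-- The subgroup `{(k⁻¹, k) : k ∈ K°}` of `N ⋊ L`. -/
def antidiag : Subgroup (SemiNL a) where
  carrier := {x | (x.left : G) = (x.right : G)⁻¹ ∧ (x.right : G) ∈ stabNo a}
  one_mem' := by simp [(stabNo a).one_mem]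
  mul_mem' := by
    rintro x y ⟨hx, hx'⟩ ⟨hy, hy'⟩
    refine ⟨?_, (stabNo a).mul_mem hx' hy'⟩
    simp [hx, hy, mul_assoc]
  inv_mem' := by
    rintro x ⟨hx, hx'⟩
    refine ⟨?_, (stabNo a).inv_mem hx'⟩
    simp [hx, mul_assoc]

instance : (antidiag a).Normal where
  conj_mem := by
    rintro x ⟨hx, hx'⟩ y
    refine ⟨?_, conj_mem_stabNo a y.right.2 hx'⟩
    simp [hx, mul_assoc]

/-- The covering extension `G̃ = (N ⋊ L) / {(k⁻¹, k) : k ∈ K°}` of `G`. -/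
abbrev Cov : Type _ := SemiNL a ⧸ antidiag a

/-- The homomorphism `N ⋊ L → G`, `(n, l) ↦ n l`. -/
def semiProj : SemiNL a →* G where
  toFun x := x.left * x.right
  map_one' := by simp
  map_mul' x y := by simp [mul_assoc]

/-- The covering homomorphism `G̃ → G`, `[n, l] ↦ n l`. -/
def covProj : Cov a →* G :=
  QuotientGroup.lift (antidiag a) (semiProj a) (by
    rintro x ⟨hx, _⟩
    simp [semiProj, hx])

/-- The normal subgroup `Ñ = {[n, 1] : n ∈ N}` of `G̃`. -/
def covN : Subgroup (Cov a) :=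
  (SemidirectProduct.inl.range : Subgroup (SemiNL a)).map (QuotientGroup.mk' (antidiag a))

instance : (covN a).Normal := by
  have : (SemidirectProduct.inl.range : Subgroup (SemiNL a)).Normal := by
    rw [SemidirectProduct.range_inl_eq_ker_rightHom]; infer_instance
  exact Subgroup.Normal.map this _ (QuotientGroup.mk'_surjective _)

/-- The group `G̃ / Ñ`. -/
abbrev CovQuot : Type _ := Cov a ⧸ covN a

/-- The class in `G̃ / Ñ` of `[n, l] ∈ G̃`. -/
def CovQuot.mk (n : N) (l : stabG a) : CovQuot a :=
  QuotientGroup.mk (QuotientGroup.mk (⟨n, l⟩ : SemiNL a) : Cov a)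

/-- The representation of `G̃ / Ñ` on `(𝔤/𝔫)*`, through `G̃ → G` and the coadjoint action. -/
def covRep : Representation ℝ (CovQuot a) (Module.Dual ℝ (GroupLieAlgebra 𝓘(ℝ, E) G ⧸ lieSub N)) :=
  QuotientGroup.lift (covN a) ((coadQuot N).comp (covProj a)) (by
    rintro _ ⟨_, ⟨n, rfl⟩, rfl⟩
    refine coadQuot_of_mem N ?_
    change ((n : G) * ((1 : stabG a) : G)) ∈ N
    simp)

end LieGroup

section LieCohomology

variable (q : Type*) [LieRing q] [LieAlgebra ℝ q]

/-- The `2`-cocycles of the Lie algebra `𝔮` with values in the trivial module `ℝ`. -/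
def Z2 : Submodule ℝ (q →ₗ[ℝ] q →ₗ[ℝ] ℝ) where
  carrier := {f | (∀ x, f x x = 0) ∧ ∀ x y z, f ⁅x, y⁆ z + f ⁅y, z⁆ x + f ⁅z, x⁆ y = 0}
  add_mem' := by
    rintro f g ⟨hf, hf'⟩ ⟨hg, hg'⟩
    refine ⟨fun x => by simp [hf x, hg x], fun x y z => ?_⟩
    simp only [LinearMap.add_apply]
    linear_combination hf' x y z + hg' x y z
  zero_mem' := by simp
  smul_mem' := by
    rintro c f ⟨hf, hf'⟩
    refine ⟨fun x => by simp [hf x], fun x y z => ?_⟩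
    simp only [LinearMap.smul_apply, smul_eq_mul]
    linear_combination c * hf' x y z

/-- The `2`-coboundaries of the Lie algebra `𝔮` with values in the trivial module `ℝ`. -/
def B2 : Submodule ℝ (q →ₗ[ℝ] q →ₗ[ℝ] ℝ) where
  carrier := {f | ∃ h : Module.Dual ℝ q, ∀ x y, f x y = h ⁅x, y⁆}
  add_mem' := by
    rintro f g ⟨h, hf⟩ ⟨h', hg⟩
    exact ⟨h + h', fun x y => by simp [hf, hg]⟩
  zero_mem' := ⟨0, by simp⟩
  smul_mem' := by
    rintro c f ⟨h, hf⟩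
    exact ⟨c • h, fun x y => by simp [hf]⟩

instance : AddCommGroup (Z2 q) :=
  @Submodule.addCommGroup ℝ (q →ₗ[ℝ] q →ₗ[ℝ] ℝ) _ _ _ (Z2 q)

/-- The Lie algebra cohomology group `H²(𝔮, ℝ)` with trivial coefficients. -/
abbrev H2 : Type _ := Z2 q ⧸ (B2 q).comap (Z2 q).subtype

variable {q}

/-- The class in `H²(𝔮, ℝ)` of a cocycle. -/
def H2.mk (f : Z2 q) : H2 q := Submodule.Quotient.mk f

variable {c e : Type*} [LieRing c] [LieAlgebra ℝ c] [LieRing e] [LieAlgebra ℝ e]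

/-- For a central extension `0 → 𝔠 → 𝔢 → 𝔮 → 0` with one-dimensional kernel, identified with `ℝ` by
`ψ`: the class `η ∈ H²(𝔮, ℝ)` is the class of the extension, i.e. the class of the cocycle
`(x, y) ↦ ψ ([s x, s y] - s [x, y])` where `s` is a linear section of `𝔢 → 𝔮`. -/
def IsExtensionClass (i : c →ₗ⁅ℝ⁆ e) (p : e →ₗ⁅ℝ⁆ q) (ψ : c ≃ₗ[ℝ] ℝ) (η : H2 q) : Prop :=
  ∃ s : q →ₗ[ℝ] e, (∀ x, p (s x) = x) ∧
    ∃ f : Z2 q, (∀ x y, i (ψ.symm (f.1 x y)) = ⁅s x, s y⁆ - s ⁅x, y⁆) ∧ H2.mk f = η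

end LieCohomology

section Cocycle

variable {E : Type*} [NormedAddCommGroup E] [NormedSpace ℝ E]
  {G : Type*} [TopologicalSpace G] [ChartedSpace E G] [Group G] [LieGroup 𝓘(ℝ, E) ∞ G]
  {N : Subgroup G} [N.Normal] (a : Module.Dual ℝ (lieSub (E := E) N))

/-- The covering `Ũ = N/K°` of the orbit `U = N(a) = N/K`. -/
abbrev OrbitCov : Type _ := N ⧸ (stabNo a).subgroupOf N

/-- Let `â ∈ 𝔤*`, with restriction `a` to `𝔫`. The function `θ` on `G̃/Ñ`, with values in `(𝔤/𝔫)*`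
(the annihilator of `𝔫` in `𝔤*`), is the non-equivariance cocycle of the map
`φ : Ũ → 𝔤*, n K° ↦ n(â)`, that is `θ(g̃) = φ(g̃(ũ)) - g(φ(ũ))` for all `ũ ∈ Ũ` and all `g̃ ∈ G̃` over
`g ∈ G`, where `G̃` acts on `Ũ` by `[n, l](n' K°) = n l n' l⁻¹ K°`. -/
def IsNonequivarianceCocycle (â : Module.Dual ℝ (GroupLieAlgebra 𝓘(ℝ, E) G))
    (θ : CovQuot a → Module.Dual ℝ (GroupLieAlgebra 𝓘(ℝ, E) G ⧸ lieSub N)) : Prop :=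
  ∃ φ : OrbitCov a → Module.Dual ℝ (GroupLieAlgebra 𝓘(ℝ, E) G),
    (∀ n : N, φ (QuotientGroup.mk n) = coadG (n : G) â) ∧
    ∀ (n : N) (l : stabG a) (n' : N) (X : GroupLieAlgebra 𝓘(ℝ, E) G),
      θ (CovQuot.mk a n l) (Submodule.Quotient.mk X) =
        (φ (QuotientGroup.mk (n * MulAut.conjNormal (l : G) n')) -
          coadG ((n : G) * (l : G)) (φ (QuotientGroup.mk n'))) X

/-- `D` is the derivative at the identity of the function `θ` on `G̃/Ñ`, paired with `𝔤`:
`D X Y = ⟨Dθ(e)(X), Y⟩` for `X, Y` in the Lie algebra `𝔤` of `G̃`. As `G̃` carries the differentiable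
structure for which the covering `G̃ → G` is a local diffeomorphism, the derivative of
`g̃ ↦ ⟨θ(g̃), Y⟩` is computed with the help of a continuous local section `σ` of this covering. -/
def HasDerivAtIdentity
    (θ : CovQuot a → Module.Dual ℝ (GroupLieAlgebra 𝓘(ℝ, E) G ⧸ lieSub N))
    (D : GroupLieAlgebra 𝓘(ℝ, E) G → GroupLieAlgebra 𝓘(ℝ, E) G → ℝ) : Prop :=
  ∃ σ : G → Cov a, σ 1 = 1 ∧ (∀ᶠ g in 𝓝 (1 : G), ContinuousAt σ g ∧ covProj a (σ g) = g) ∧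
    ∀ Y : GroupLieAlgebra 𝓘(ℝ, E) G,
      MDifferentiableAt 𝓘(ℝ, E) 𝓘(ℝ, ℝ)
        (fun g => θ (QuotientGroup.mk (σ g)) (Submodule.Quotient.mk Y)) (1 : G) ∧
      ∀ X : GroupLieAlgebra 𝓘(ℝ, E) G,
        mfderiv 𝓘(ℝ, E) 𝓘(ℝ, ℝ)
          (fun g => θ (QuotientGroup.mk (σ g)) (Submodule.Quotient.mk Y)) (1 : G) X = D X Y

end Cocycle

section Hamiltonian

variable {E : Type*} [NormedAddCommGroup E] [NormedSpace ℝ E]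
  {G : Type*} [TopologicalSpace G] [ChartedSpace E G] [Group G] [LieGroup 𝓘(ℝ, E) ∞ G]

section General

variable {B : Type*} [NormedAddCommGroup B] [NormedSpace ℝ B]
  {X : Type*} [TopologicalSpace X] [ChartedSpace B X]

/-- The value at `x` of the vector field on `X` by which `Z ∈ 𝔤` acts, for an action `ρ` of `G`:
the derivative at `1` of `g ↦ g(x)`, applied to `Z`. -/
def infAction (ρ : G →* Equiv.Perm X) (Z : GroupLieAlgebra 𝓘(ℝ, E) G) (x : X) :
    TangentSpace 𝓘(ℝ, B) x :=
  mfderiv 𝓘(ℝ, E) 𝓘(ℝ, B) (fun g : G => ρ g x) 1 Z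

/-- The manifold `X` with `2`-form `w`, the action `ρ` of `G` on `X` and the map `Φ : X → 𝔤*` form a
hamiltonian `G`-space, given that `w` is symplectic: the action is smooth and preserves `w`,
and `Φ` is an equivariant moment map, i.e. it is smooth, satisfies `d⟨Φ, Z⟩ = -ι_Z w` for all
`Z ∈ 𝔤`, and intertwines `ρ` with the coadjoint action. -/
structure IsHamiltonian
    (w : ∀ x : X, TangentSpace 𝓘(ℝ, B) x →L[ℝ] TangentSpace 𝓘(ℝ, B) x →L[ℝ] ℝ)
    (ρ : G →* Equiv.Perm X) (Φ : X → Module.Dual ℝ (GroupLieAlgebra 𝓘(ℝ, E) G)) : Prop where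
  smooth_action : ContMDiff (𝓘(ℝ, E).prod 𝓘(ℝ, B)) 𝓘(ℝ, B) ∞ (fun p : G × X => ρ p.1 p.2)
  preserves : ∀ (g : G) (x : X) (u v : TangentSpace 𝓘(ℝ, B) x),
    w (ρ g x) (mfderiv 𝓘(ℝ, B) 𝓘(ℝ, B) (ρ g) x u) (mfderiv 𝓘(ℝ, B) 𝓘(ℝ, B) (ρ g) x v) = w x u v
  smooth_moment : ∀ Z, ContMDiff 𝓘(ℝ, B) 𝓘(ℝ, ℝ) ∞ (fun x => Φ x Z)
  moment : ∀ (Z : GroupLieAlgebra 𝓘(ℝ, E) G) (x : X) (v : TangentSpace 𝓘(ℝ, B) x),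
    mfderiv 𝓘(ℝ, B) 𝓘(ℝ, ℝ) (fun y => Φ y Z) x v = -w x (infAction ρ Z x) v
  equivariant : ∀ (g : G) (x : X), Φ (ρ g x) = coadG g (Φ x)

end General

variable {F : Type*} [NormedAddCommGroup F] [NormedSpace ℝ F]
  {N : Subgroup G} [N.Normal] [ChartedSpace F N] [LieGroup 𝓘(ℝ, F) ∞ N]
  (a : Module.Dual ℝ (lieSub (E := E) N))

/-- The orbit `U = N(a)`, as the homogeneous space `N/K`. -/
abbrev Orbit : Type _ := N ⧸ (stabN a).subgroupOf N

/-- The derivative at `1` of the inclusion `N → G`. -/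
def inclLie (Y : GroupLieAlgebra 𝓘(ℝ, F) N) : GroupLieAlgebra 𝓘(ℝ, E) G :=
  mfderiv 𝓘(ℝ, F) 𝓘(ℝ, E) ((↑) : N → G) 1 Y

variable {B : Type*} [NormedAddCommGroup B] [NormedSpace ℝ B] [ChartedSpace B (Orbit a)]

/-- `w` is the Kirillov-Kostant-Souriau form of the orbit `U = N(a)`:
`w(X(x), Y(x)) = ⟨x, [Y, X]⟩` for all `x = n(a)` in `U` and all `X, Y` in the Lie algebra of `N`,
where `X(x)` is the tangent vector by which `X` acts at `x`. As `N` is transitive on `U`, this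
determines `w`, which is the standard symplectic form of the coadjoint orbit. -/
def IsKKS (w : ∀ x : Orbit a, TangentSpace 𝓘(ℝ, B) x →L[ℝ] TangentSpace 𝓘(ℝ, B) x →L[ℝ] ℝ) : Prop :=
  ∀ (n : N) (X Y : GroupLieAlgebra 𝓘(ℝ, F) N) (W : lieSub (E := E) N),
    (W : GroupLieAlgebra 𝓘(ℝ, E) G) = inclLie ⁅Y, X⁆ →
    w (QuotientGroup.mk n) (infAction (MulAction.toPermHom N (Orbit a)) X (QuotientGroup.mk n))
      (infAction (MulAction.toPermHom N (Orbit a)) Y (QuotientGroup.mk n)) = coadN N (n : G) a W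

/-- The orbit `U = N(a)`, with its Kirillov-Kostant-Souriau form and its action of `N`, can be made
a hamiltonian `G`-space: there are an action `ρ` of `G` on `U` extending that of `N` and a
map `Φ : U → 𝔤*` making `U` a hamiltonian `G`-space, such that `Φ` followed by the
restriction `𝔤* → 𝔫*` is the moment map of `U` as an `N`-space, i.e. the inclusion `U → 𝔫*`. -/
def OrbitIsHamiltonian : Prop :=
  ∃ (w : ∀ x : Orbit a, TangentSpace 𝓘(ℝ, B) x →L[ℝ] TangentSpace 𝓘(ℝ, B) x →L[ℝ] ℝ)
    (ρ : G →* Equiv.Perm (Orbit a))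
    (Φ : Orbit a → Module.Dual ℝ (GroupLieAlgebra 𝓘(ℝ, E) G)),
    IsKKS (F := F) a w ∧ IsHamiltonian w ρ Φ ∧
    (∀ (n : N) (x : Orbit a), ρ (n : G) x = n • x) ∧
    ∀ (n : N) (X : lieSub (E := E) N), Φ (QuotientGroup.mk n) X = coadN N (n : G) a X

end Hamiltonian

end Mackey

end

/-!
Everything reduces to extensions `b` of `a` to a linear form on `𝔤` (`Extends`). Such a `b` gives
the cocycle `θ_b : [n, l] ↦ b - l(b)` on `G̃/Ñ = L/K°`. Two facts about the Lie groups make this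
work.

* `𝔤 = 𝔫 + 𝔩` (`lieSub_sup_stabG`). The orbit maps `g ↦ g(a)` of `G` and of `N` have the same image.
  Its Hausdorff dimension is at least `dim 𝔤/𝔩`, because a projection of it has interior points, and
  at most `dim 𝔫/𝔨`, because it is a countable union of linear images of a smooth patch of this
  dimension (this uses the second countability of `G`); and `𝔨 = 𝔫 ∩ 𝔩`. It follows that `G = N L`
  with a factor in `N` which is smooth near `1` (`exists_splitting`).
* `K°` fixes `b` (`Extends.coadG_of_mem_stabNo`). By the first fact `b` vanishes on `[𝔨, 𝔤]`, so
  that the stabilizer of `b` in `N`, which is contained in `K`, has the same Lie algebra as `K`, and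
  is open in `K`.

The stabilizers are handled without the theorem on closed subgroups: integral curves of left
invariant vector fields (`exists_isLeftCurve`) stay in a stabilizer as soon as they are
infinitesimally tangent to it, and products of such curves are smooth patches (`exists_isPatch`),
to which the inverse function theorem applies.

The difference of two extensions of `a` is a linear form on `𝔤/𝔫`, so the cocycles in the class of
`θ_b` are the `θ_{b'}` for the extensions `b'` of `a` (`Extends.H1π_eq_theta_iff`), and the class
vanishes if and only if some extension is fixed by `L` (`Extends.H1π_theta_eq_zero_iff`). If `a`
vanishes on `𝔨`, then the form which is `a` on `𝔫` and `0` on `𝔩` is such an extension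
(`exists_extends_fixed`). The value at the base point of an equivariant moment map is one, too;
conversely, if `b` is fixed by `L`, then `n(a) ↦ n(b)` identifies the orbit `N(a)` with a coadjoint
orbit of `G`, and is the required moment map (`Extends.orbitIsHamiltonian`, which rests on
`exists_isHamiltonian`).

The derivative of `θ_b` at the identity is `(X, Y) ↦ b([X, Y])` for `X ∈ 𝔩`
(`Extends.hasDerivAtIdentity`), a cocycle on `𝔩/𝔨 = 𝔤/𝔫` (`exists_derivedCocycle`). For a linear
section `s` with values in `𝔩`, it differs from the cocycle of the extension `𝔩/𝔧` by the coboundary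
of `b ∘ s` (`exists_centralExtension`).
-/

set_option linter.unusedSectionVars false

noncomputable section

namespace Mackey

/-! ### Calculus in the chart at the identity -/

section Chart

open Set Filter Function

variable {E : Type*} [NormedAddCommGroup E] [NormedSpace ℝ E]
  {G : Type*} [TopologicalSpace G] [ChartedSpace E G] [Group G]

variable (E G) in
/-- The preferred chart at the identity. -/
abbrev chartOne : PartialEquiv G E := extChartAt 𝓘(ℝ, E) (1 : G)

variable (E G) in
/-- The coordinates of the identity. -/
abbrev coordOne : E := chartOne E G 1

lemma chartOne_symm_coordOne : (chartOne E G).symm (coordOne E G) = 1 :=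
  (chartOne E G).left_inv (mem_extChartAt_source _)

lemma chartOne_target_mem_nhds : (chartOne E G).target ∈ 𝓝 (coordOne E G) :=
  extChartAt_target_mem_nhds _

lemma mfderiv_eq_fderiv_chartOne {γ : ℝ → G} (h1 : γ 0 = 1)
    (h : MDifferentiableAt 𝓘(ℝ, ℝ) 𝓘(ℝ, E) γ 0) :
    (mfderiv 𝓘(ℝ, ℝ) 𝓘(ℝ, E) γ 0 : ℝ →L[ℝ] E) = fderiv ℝ (chartOne E G ∘ γ) 0 := by
  have h2 := h.hasMFDerivAt.2
  simp only [extChartAt_model_space_eq_id, PartialEquiv.refl_coe,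
    modelWithCornersSelf_coe, range_id, id_eq] at h2
  have h3 : writtenInExtChartAt 𝓘(ℝ, ℝ) 𝓘(ℝ, E) 0 γ = chartOne E G ∘ γ := by
    simp only [writtenInExtChartAt, extChartAt_model_space_eq_id, PartialEquiv.refl_symm,
      PartialEquiv.refl_coe, h1]
    rfl
  rw [h3] at h2
  obtain ⟨L, hL⟩ : ∃ L : ℝ →L[ℝ] E, L = mfderiv 𝓘(ℝ, ℝ) 𝓘(ℝ, E) γ 0 := ⟨_, rfl⟩
  have h4 : HasFDerivWithinAt (chartOne E G ∘ γ) L univ 0 := by rw [hL]; exact h2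
  exact hL.symm.trans (hasFDerivWithinAt_univ.1 h4).fderiv.symm

lemma IsCurve.continuousAt {γ : ℝ → G} {X : GroupLieAlgebra 𝓘(ℝ, E) G} (h : IsCurve γ X) :
    ContinuousAt γ 0 := h.smooth.continuousAt

variable [LieGroup 𝓘(ℝ, E) ∞ G]

lemma contMDiffAt_chartOne : ContMDiffAt 𝓘(ℝ, E) 𝓘(ℝ, E) ∞ (chartOne E G) 1 :=
  contMDiffAt_extChartAt

lemma contMDiffAt_chartOne_symm :
    ContMDiffAt 𝓘(ℝ, E) 𝓘(ℝ, E) ∞ (chartOne E G).symm (coordOne E G) :=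
  (contMDiffOn_extChartAt_symm (I := 𝓘(ℝ, E)) (n := ∞) (1 : G) _
    (mem_extChartAt_target _)).contMDiffAt (extChartAt_target_mem_nhds _)

lemma IsCurve.contDiffAt {γ : ℝ → G} {X : GroupLieAlgebra 𝓘(ℝ, E) G} (h : IsCurve γ X) :
    ContDiffAt ℝ ∞ (chartOne E G ∘ γ) 0 := by
  rw [← contMDiffAt_iff_contDiffAt]
  exact ContMDiffAt.comp (0 : ℝ) (by rw [h.map_zero]; exact contMDiffAt_chartOne) h.smooth

lemma IsCurve.hasDerivAt {γ : ℝ → G} {X : GroupLieAlgebra 𝓘(ℝ, E) G} (h : IsCurve γ X) :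
    HasDerivAt (chartOne E G ∘ γ) (X : E) 0 := by
  have h1 := (h.contDiffAt.differentiableAt (by simp)).hasDerivAt
  have h2 := mfderiv_eq_fderiv_chartOne h.map_zero (h.smooth.mdifferentiableAt (by simp))
  have h3 : deriv (chartOne E G ∘ γ) 0 = (X : E) := by
    rw [← fderiv_apply_one_eq_deriv, ← h2]
    exact h.velocity
  rwa [h3] at h1

/-- A curve through the identity is smooth with velocity `X` if it is so in the chart. -/
lemma isCurve_of_chart {γ : ℝ → G} {X : GroupLieAlgebra 𝓘(ℝ, E) G} (h1 : γ 0 = 1)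
    (hc : ContMDiffAt 𝓘(ℝ, ℝ) 𝓘(ℝ, E) ∞ γ 0)
    (hd : HasDerivAt (chartOne E G ∘ γ) (X : E) 0) : IsCurve γ X where
  map_zero := h1
  smooth := hc
  velocity := by
    have := mfderiv_eq_fderiv_chartOne h1 (hc.mdifferentiableAt (by simp))
    exact (congrArg (fun L : ℝ →L[ℝ] E => L 1) this).trans
      (by rw [fderiv_apply_one_eq_deriv, hd.deriv])

variable (E G) in
/-- The multiplication of `G` in the chart at the identity. -/
def chartMul (x : E × E) : E :=
  chartOne E G ((chartOne E G).symm x.1 * (chartOne E G).symm x.2)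

variable (E G) in
/-- The conjugation `(x, y) ↦ x y x⁻¹` of `G` in the chart at the identity. -/
def chartConj (x : E × E) : E :=
  chartOne E G ((chartOne E G).symm x.1 * (chartOne E G).symm x.2 * ((chartOne E G).symm x.1)⁻¹)

lemma contMDiffAt_chartOne_symm_fst {u : E} :
    ContMDiffAt 𝓘(ℝ, E × E) 𝓘(ℝ, E) ∞ (fun x : E × E => (chartOne E G).symm x.1)
      (coordOne E G, u) :=
  ContMDiffAt.comp (I' := 𝓘(ℝ, E)) (coordOne E G, u) (g := (chartOne E G).symm) (f := Prod.fst)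
    contMDiffAt_chartOne_symm (contDiff_fst.contDiffAt.contMDiffAt)

lemma contMDiffAt_chartOne_symm_snd {u : E} :
    ContMDiffAt 𝓘(ℝ, E × E) 𝓘(ℝ, E) ∞ (fun x : E × E => (chartOne E G).symm x.2)
      (u, coordOne E G) :=
  ContMDiffAt.comp (I' := 𝓘(ℝ, E)) (u, coordOne E G) (g := (chartOne E G).symm) (f := Prod.snd)
    contMDiffAt_chartOne_symm (contDiff_snd.contDiffAt.contMDiffAt)

lemma contDiffAt_chartMul : ContDiffAt ℝ ∞ (chartMul E G) (coordOne E G, coordOne E G) := by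
  rw [← contMDiffAt_iff_contDiffAt]
  refine ContMDiffAt.comp (I' := 𝓘(ℝ, E)) _ (g := chartOne E G)
    (f := fun x : E × E => (chartOne E G).symm x.1 * (chartOne E G).symm x.2) ?_
    (contMDiffAt_chartOne_symm_fst.mul contMDiffAt_chartOne_symm_snd)
  simp only [chartOne_symm_coordOne, mul_one]
  exact contMDiffAt_chartOne

lemma contDiffAt_chartConj : ContDiffAt ℝ ∞ (chartConj E G) (coordOne E G, coordOne E G) := by
  rw [← contMDiffAt_iff_contDiffAt]
  refine ContMDiffAt.comp (I' := 𝓘(ℝ, E)) _ (g := chartOne E G)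
    (f := fun x : E × E => (chartOne E G).symm x.1 * (chartOne E G).symm x.2 *
      ((chartOne E G).symm x.1)⁻¹) ?_
    ((contMDiffAt_chartOne_symm_fst.mul contMDiffAt_chartOne_symm_snd).mul
      contMDiffAt_chartOne_symm_fst.inv)
  simp only [chartOne_symm_coordOne, mul_one, inv_one]
  exact contMDiffAt_chartOne

lemma chartMul_coordOne_right {u : E} (hu : u ∈ (chartOne E G).target) :
    chartMul E G (u, coordOne E G) = u := by
  simp only [chartMul, chartOne_symm_coordOne, mul_one]
  exact (chartOne E G).right_inv hu

lemma chartMul_coordOne_left {u : E} (hu : u ∈ (chartOne E G).target) :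
    chartMul E G (coordOne E G, u) = u := by
  simp only [chartMul, chartOne_symm_coordOne, one_mul]
  exact (chartOne E G).right_inv hu

lemma chartConj_coordOne_right (u : E) : chartConj E G (u, coordOne E G) = coordOne E G := by
  simp only [chartConj, chartOne_symm_coordOne, mul_one, mul_inv_cancel]

/-- In the chart, `(x y x⁻¹) x = x y`. -/
lemma eventually_chartMul_chartConj :
    ∀ᶠ x in 𝓝 (coordOne E G, coordOne E G),
      chartMul E G (chartConj E G x, x.1) = chartMul E G x := by
  have hcont : ContinuousAt (fun x : E × E => (chartOne E G).symm x.1 * (chartOne E G).symm x.2 *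
      ((chartOne E G).symm x.1)⁻¹) (coordOne E G, coordOne E G) :=
    ((contMDiffAt_chartOne_symm_fst.mul contMDiffAt_chartOne_symm_snd).mul
      contMDiffAt_chartOne_symm_fst.inv).continuousAt
  have : ∀ᶠ x in 𝓝 (coordOne E G, coordOne E G), (chartOne E G).symm x.1 *
      (chartOne E G).symm x.2 * ((chartOne E G).symm x.1)⁻¹ ∈ (chartOne E G).source := by
    refine hcont.eventually_mem ?_
    simp only [chartOne_symm_coordOne, mul_one, inv_one]
    exact extChartAt_source_mem_nhds _
  filter_upwards [this] with x hx
  simp only [chartMul, chartConj, (chartOne E G).left_inv hx, inv_mul_cancel_right]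

variable (E G) in
/-- The left invariant vector fields in the chart: `leftField u Y` is the value at `u` of the field
whose value at the identity is `Y`. -/
def leftField (u : E) : E →L[ℝ] E := fderiv ℝ (fun v => chartMul E G (u, v)) (coordOne E G)

variable (E G) in
/-- The right invariant vector fields in the chart. -/
def rightField (u : E) : E →L[ℝ] E := fderiv ℝ (fun v => chartMul E G (v, u)) (coordOne E G)

variable (E G) in
/-- The adjoint representation in the chart. -/
def chartAd (u : E) : E →L[ℝ] E := fderiv ℝ (fun v => chartConj E G (u, v)) (coordOne E G)

lemma contDiffAt_leftField : ContDiffAt ℝ ∞ (leftField E G) (coordOne E G) :=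
  ContDiffAt.fderiv (n := ∞) (f := fun u v => chartMul E G (u, v)) (g := fun _ => coordOne E G)
    contDiffAt_chartMul contDiffAt_const (by simp)

lemma contDiffAt_rightField : ContDiffAt ℝ ∞ (rightField E G) (coordOne E G) :=
  ContDiffAt.fderiv (n := ∞) (f := fun u v => chartMul E G (v, u)) (g := fun _ => coordOne E G)
    (contDiffAt_chartMul.comp (coordOne E G, coordOne E G) (f := fun x : E × E => (x.2, x.1))
      (contDiff_snd.prodMk contDiff_fst).contDiffAt) contDiffAt_const (by simp)

lemma contDiffAt_chartAd : ContDiffAt ℝ ∞ (chartAd E G) (coordOne E G) :=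
  ContDiffAt.fderiv (n := ∞) (f := fun u v => chartConj E G (u, v)) (g := fun _ => coordOne E G)
    contDiffAt_chartConj contDiffAt_const (by simp)

lemma leftField_coordOne : leftField E G (coordOne E G) = ContinuousLinearMap.id ℝ E := by
  have : (fun v => chartMul E G (coordOne E G, v)) =ᶠ[𝓝 (coordOne E G)] id := by
    filter_upwards [chartOne_target_mem_nhds (E := E) (G := G)] with v hv
    exact chartMul_coordOne_left hv
  rw [leftField, this.fderiv_eq, fderiv_id]

lemma rightField_coordOne : rightField E G (coordOne E G) = ContinuousLinearMap.id ℝ E := by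
  have : (fun v => chartMul E G (v, coordOne E G)) =ᶠ[𝓝 (coordOne E G)] id := by
    filter_upwards [chartOne_target_mem_nhds (E := E) (G := G)] with v hv
    exact chartMul_coordOne_right hv
  rw [rightField, this.fderiv_eq, fderiv_id]

lemma eventually_differentiableAt_chartMul :
    ∀ᶠ x in 𝓝 (coordOne E G, coordOne E G), DifferentiableAt ℝ (chartMul E G) x :=
  ((contDiffAt_chartMul.of_le (m := 1) (by simp)).eventually (by simp)).mono
    fun _ h => h.differentiableAt (by simp)

lemma eventually_leftField_eq : ∀ᶠ u in 𝓝 (coordOne E G), ∀ Y,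
    leftField E G u Y = fderiv ℝ (chartMul E G) (u, coordOne E G) (0, Y) := by
  have hc : ContinuousAt (fun u : E => (u, coordOne E G)) (coordOne E G) := by fun_prop
  filter_upwards [hc.eventually eventually_differentiableAt_chartMul] with u hu Y
  have h1 : HasFDerivAt (fun v : E => (u, v)) (ContinuousLinearMap.inr ℝ E E) (coordOne E G) :=
    hasFDerivAt_prodMk_right _ _
  have h2 : HasFDerivAt (fun v => chartMul E G (u, v)) _ (coordOne E G) :=
    HasFDerivAt.comp (coordOne E G) (f := fun v => (u, v)) hu.hasFDerivAt h1
  rw [leftField, h2.fderiv]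
  simp

lemma eventually_rightField_eq : ∀ᶠ u in 𝓝 (coordOne E G), ∀ Y,
    rightField E G u Y = fderiv ℝ (chartMul E G) (coordOne E G, u) (Y, 0) := by
  have hc : ContinuousAt (fun u : E => (coordOne E G, u)) (coordOne E G) := by fun_prop
  filter_upwards [hc.eventually eventually_differentiableAt_chartMul] with u hu Y
  have h1 : HasFDerivAt (fun v : E => (v, u)) (ContinuousLinearMap.inl ℝ E E) (coordOne E G) :=
    hasFDerivAt_prodMk_left _ _
  have h2 : HasFDerivAt (fun v => chartMul E G (v, u)) _ (coordOne E G) :=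
    HasFDerivAt.comp (coordOne E G) (f := fun v => (v, u)) hu.hasFDerivAt h1
  rw [rightField, h2.fderiv]
  simp

/-- The derivatives of the left and of the right invariant fields are transposes of each other:
both are the mixed second derivative of the multiplication. -/
lemma fderiv_rightField (X Y : E) :
    fderiv ℝ (rightField E G) (coordOne E G) X Y = fderiv ℝ (leftField E G) (coordOne E G) Y X := by
  set p := coordOne E G
  have hsymm := contDiffAt_chartMul (E := E) (G := G).isSymmSndFDerivAt
    (by rw [minSmoothness_of_isRCLikeNormedField]; exact ENat.LEInfty.out)
  have hd : DifferentiableAt ℝ (fderiv ℝ (chartMul E G)) (p, p) :=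
    (contDiffAt_chartMul.fderiv_right (m := ∞) (by simp)).differentiableAt (by simp)
  have hl : HasFDerivAt (fun u => fderiv ℝ (chartMul E G) (u, p)) _ p :=
    HasFDerivAt.comp p (f := fun u => (u, p)) (g := fderiv ℝ (chartMul E G)) hd.hasFDerivAt
      (hasFDerivAt_prodMk_left _ _)
  have hr : HasFDerivAt (fun u => fderiv ℝ (chartMul E G) (p, u)) _ p :=
    HasFDerivAt.comp p (f := fun u => (p, u)) (g := fderiv ℝ (chartMul E G)) hd.hasFDerivAt
      (hasFDerivAt_prodMk_right _ _)
  have e1 : fderiv ℝ (rightField E G) p X Y =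
      fderiv ℝ (fderiv ℝ (chartMul E G)) (p, p) (0, X) (Y, 0) := by
    have h1 := ((contDiffAt_rightField (E := E) (G := G)).differentiableAt
      (by simp)).hasFDerivAt.clm_apply (hasFDerivAt_const Y p)
    have h2 := hr.clm_apply (hasFDerivAt_const ((Y, 0) : E × E) p)
    have h3 : (fun u => rightField E G u Y) =ᶠ[𝓝 p]
        fun u => fderiv ℝ (chartMul E G) (p, u) (Y, 0) :=
      eventually_rightField_eq.mono fun u hu => hu Y
    have := congrArg (fun L => L X) (h1.unique (h2.congr_of_eventuallyEq h3))
    simpa using this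
  have e2 : fderiv ℝ (leftField E G) p Y X =
      fderiv ℝ (fderiv ℝ (chartMul E G)) (p, p) (Y, 0) (0, X) := by
    have h1 := ((contDiffAt_leftField (E := E) (G := G)).differentiableAt
      (by simp)).hasFDerivAt.clm_apply (hasFDerivAt_const X p)
    have h2 := hl.clm_apply (hasFDerivAt_const ((0, X) : E × E) p)
    have h3 : (fun u => leftField E G u X) =ᶠ[𝓝 p]
        fun u => fderiv ℝ (chartMul E G) (u, p) (0, X) :=
      eventually_leftField_eq.mono fun u hu => hu X
    have := congrArg (fun L => L Y) (h1.unique (h2.congr_of_eventuallyEq h3))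
    simpa using this
  rw [e1, e2]
  exact hsymm _ _

/-- The left invariant field of `Y` takes at `x` the same value as the right invariant field of
`Ad x Y`: this is the derivative in `y` of `x y = (x y x⁻¹) x`. -/
lemma eventually_rightField_chartAd : ∀ᶠ u in 𝓝 (coordOne E G), ∀ Y,
    rightField E G u (chartAd E G u Y) = leftField E G u Y := by
  set p := coordOne E G
  have hdc : ∀ᶠ x in 𝓝 (p, p), DifferentiableAt ℝ (chartConj E G) x :=
    ((contDiffAt_chartConj.of_le (m := 1) (by simp)).eventually (by simp)).mono
      fun _ h => h.differentiableAt (by simp)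
  have hc : ContinuousAt (fun u : E => (u, p)) p := by fun_prop
  have hc' : ContinuousAt (fun u : E => (p, u)) p := by fun_prop
  filter_upwards [hc.eventually hdc, hc'.eventually eventually_differentiableAt_chartMul,
    hc.eventually eventually_chartMul_chartConj.eventually_nhds] with u h1 h2 h3 Y
  have hconj : HasFDerivAt (fun v => chartConj E G (u, v)) (chartAd E G u) p :=
    (h1.comp p (f := fun v => (u, v)) (hasFDerivAt_prodMk_right _ _).differentiableAt).hasFDerivAt
  have hmul : HasFDerivAt (fun v => chartMul E G (v, u)) (rightField E G u)
      (chartConj E G (u, p)) := by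
    rw [chartConj_coordOne_right]
    exact (h2.comp p (f := fun v => (v, u))
      (hasFDerivAt_prodMk_left _ _).differentiableAt).hasFDerivAt
  have hcomp := hmul.comp p hconj
  have heq : (fun v => chartMul E G (u, v)) =ᶠ[𝓝 p]
      (fun v => chartMul E G (v, u)) ∘ fun v => chartConj E G (u, v) := by
    have hcu : ContinuousAt (fun v : E => (u, v)) p := by fun_prop
    filter_upwards [hcu.eventually h3] with v hv
    exact hv.symm
  rw [leftField, heq.fderiv_eq, hcomp.fderiv]
  rfl

lemma chartAd_coordOne : chartAd E G (coordOne E G) = ContinuousLinearMap.id ℝ E := by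
  have h := eventually_rightField_chartAd (E := E) (G := G).self_of_nhds
  ext Y
  have := h Y
  rw [rightField_coordOne, leftField_coordOne] at this
  simpa using this

/-- The derivative at the identity of `leftField u Y = rightField u (chartAd u Y)`. -/
lemma fderiv_chartAd (X Y : E) :
    fderiv ℝ (chartAd E G) (coordOne E G) X Y =
      fderiv ℝ (leftField E G) (coordOne E G) X Y -
        fderiv ℝ (leftField E G) (coordOne E G) Y X := by
  set p := coordOne E G
  have hA := ((contDiffAt_leftField (E := E) (G := G)).differentiableAt (by simp)).hasFDerivAt
  have hB := ((contDiffAt_rightField (E := E) (G := G)).differentiableAt (by simp)).hasFDerivAt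
  have hc := ((contDiffAt_chartAd (E := E) (G := G)).differentiableAt (by simp)).hasFDerivAt
  have h1 := hB.clm_apply (hc.clm_apply (hasFDerivAt_const Y p))
  have h2 := hA.clm_apply (hasFDerivAt_const Y p)
  have h3 : (fun u => leftField E G u Y) =ᶠ[𝓝 p]
      fun u => rightField E G u (chartAd E G u Y) :=
    eventually_rightField_chartAd.mono fun u hu => (hu Y).symm
  have h4 := congrArg (fun L => L X) (h2.unique (h1.congr_of_eventuallyEq h3))
  simp [chartAd_coordOne, rightField_coordOne, fderiv_rightField] at h4
  rw [h4]
  abel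

end Chart

/-! ### The bracket in the chart -/

section Bracket

open Set Filter Function VectorField

variable {E : Type*} [NormedAddCommGroup E] [NormedSpace ℝ E]
  {G : Type*} [TopologicalSpace G] [ChartedSpace E G] [Group G] [LieGroup 𝓘(ℝ, E) ∞ G]

lemma hasFDerivAt_of_mfderiv_eq {F : G → G} {x : G} {L : E →L[ℝ] E}
    (h1 : F 1 = x) (h : MDifferentiableAt 𝓘(ℝ, E) 𝓘(ℝ, E) F 1)
    (hL : L = mfderiv 𝓘(ℝ, E) 𝓘(ℝ, E) F 1) :
    HasFDerivAt (extChartAt 𝓘(ℝ, E) x ∘ F ∘ (chartOne E G).symm) L (coordOne E G) := by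
  subst h1
  have h2 := h.hasMFDerivAt.2
  simp only [modelWithCornersSelf_coe, range_id] at h2
  have h4 : HasFDerivWithinAt (extChartAt 𝓘(ℝ, E) (F 1) ∘ F ∘ (chartOne E G).symm) L univ
      (coordOne E G) := by rw [hL]; exact h2
  exact hasFDerivWithinAt_univ.1 h4

/-- In the chart, `Ad` is `chartAd`. -/
lemma Ad_chartOne_symm (u : E) (Y : GroupLieAlgebra 𝓘(ℝ, E) G) :
    (Ad ((chartOne E G).symm u) Y : E) = chartAd E G u Y := by
  set g := (chartOne E G).symm u with hg
  obtain ⟨L, hL⟩ : ∃ L : E →L[ℝ] E, L = mfderiv 𝓘(ℝ, E) 𝓘(ℝ, E) (fun x : G => g * x * g⁻¹) 1 :=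
    ⟨_, rfl⟩
  have h := hasFDerivAt_of_mfderiv_eq (F := fun x : G => g * x * g⁻¹) (x := 1) (by simp)
    ((contMDiff_conj g).mdifferentiable (by simp) 1) hL
  have h2 : chartAd E G u = L := h.fderiv
  rw [h2, hL]
  rfl

/-- The left invariant vector fields of `G`, read in the chart. -/
lemma eventually_mpullback_mulInvariantVectorField (Y : GroupLieAlgebra 𝓘(ℝ, E) G) :
    (mpullbackWithin 𝓘(ℝ, E) 𝓘(ℝ, E) (chartOne E G).symm (mulInvariantVectorField Y)
      (range 𝓘(ℝ, E)) : E → E) =ᶠ[𝓝 (coordOne E G)] fun u => leftField E G u Y := by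
  filter_upwards [chartOne_target_mem_nhds (E := E) (G := G)] with u hu
  rw [mpullbackWithin_apply]
  set x := (chartOne E G).symm u with hx'
  have hx : x ∈ (chartOne E G).source := (chartOne E G).map_target hu
  have hφ : MDifferentiableAt 𝓘(ℝ, E) 𝓘(ℝ, E) (chartOne E G) x :=
    mdifferentiableAt_extChartAt (by simpa using hx)
  -- the derivative of the chart is the inverse of that of its inverse
  have h1 : (mfderivWithin 𝓘(ℝ, E) 𝓘(ℝ, E) (chartOne E G).symm (range 𝓘(ℝ, E)) u).inverse =
      mfderiv 𝓘(ℝ, E) 𝓘(ℝ, E) (chartOne E G) x :=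
    ContinuousLinearMap.inverse_eq (mfderivWithin_extChartAt_symm_comp_mfderiv_extChartAt hu)
      (mfderiv_extChartAt_comp_mfderivWithin_extChartAt_symm hu)
  rw [h1]
  have hL : MDifferentiableAt 𝓘(ℝ, E) 𝓘(ℝ, E) (fun y : G => x * y) 1 :=
    (contMDiff_mul_left (I := 𝓘(ℝ, E)) (n := ∞)).mdifferentiable (by simp) 1
  have h2 := mfderiv_comp_apply_of_eq (I := 𝓘(ℝ, E)) (I' := 𝓘(ℝ, E)) (I'' := 𝓘(ℝ, E))
    (g := chartOne E G) (f := fun y : G => x * y) (x := (1:G)) hφ hL (mul_one x) Y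
  refine h2.symm.trans ?_
  have hcomp : MDifferentiableAt 𝓘(ℝ, E) 𝓘(ℝ, E) (chartOne E G ∘ fun y : G => x * y) 1 :=
    MDifferentiableAt.comp (I' := 𝓘(ℝ, E)) (1 : G) (by rw [mul_one]; exact hφ) hL
  have h3 := hcomp.hasMFDerivAt.2
  simp only [modelWithCornersSelf_coe, range_id] at h3
  obtain ⟨L, hL'⟩ : ∃ L : E →L[ℝ] E,
    L = mfderiv 𝓘(ℝ, E) 𝓘(ℝ, E) (chartOne E G ∘ fun y : G => x * y) 1 := ⟨_, rfl⟩
  have h4 : HasFDerivWithinAt (fun v => chartMul E G (u, v)) L univ (coordOne E G) := by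
    rw [hL']
    exact h3
  rw [leftField, (hasFDerivWithinAt_univ.1 h4).fderiv, hL']
  rfl

/-- The bracket is that of the left invariant vector fields, computed in the chart. -/
lemma bracket_eq (X Y : GroupLieAlgebra 𝓘(ℝ, E) G) : ((⁅X, Y⁆ : GroupLieAlgebra 𝓘(ℝ, E) G) : E) =
    fderiv ℝ (leftField E G) (coordOne E G) X Y -
      fderiv ℝ (leftField E G) (coordOne E G) Y X := by
  rw [GroupLieAlgebra.bracket_def, ← mlieBracketWithin_univ, mlieBracketWithin_apply]
  rw [mfderiv_extChartAt_self]
  refine (congrArg (fun L : E →L[ℝ] E => L _) ContinuousLinearMap.inverse_id).trans ?_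
  rw [ContinuousLinearMap.id_apply, preimage_univ, univ_inter, modelWithCornersSelf_coe, range_id]
  let V (Z : GroupLieAlgebra 𝓘(ℝ, E) G) : E → E :=
    mpullbackWithin 𝓘(ℝ, E) 𝓘(ℝ, E) (chartOne E G).symm (mulInvariantVectorField Z) univ
  refine (congrFun (lieBracketWithin_univ (𝕜 := ℝ) (V := V X) (W := V Y)) _).trans ?_
  have hX := eventually_mpullback_mulInvariantVectorField X
  have hY := eventually_mpullback_mulInvariantVectorField Y
  rw [modelWithCornersSelf_coe, range_id] at hX hY
  change V X =ᶠ[_] _ at hX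
  change V Y =ᶠ[_] _ at hY
  have hd (Z : E) : HasFDerivAt (fun u => leftField E G u Z)
      ((fderiv ℝ (leftField E G) (coordOne E G)).flip Z) (coordOne E G) := by
    have := ((contDiffAt_leftField (E := E) (G := G)).differentiableAt
      (by simp)).hasFDerivAt.clm_apply (hasFDerivAt_const Z (coordOne E G))
    simpa using this
  have key (X Y : E) : lieBracket ℝ (fun u => leftField E G u X) (fun u => leftField E G u Y)
      (coordOne E G) = fderiv ℝ (leftField E G) (coordOne E G) X Y -
      fderiv ℝ (leftField E G) (coordOne E G) Y X := by
    rw [lieBracket, (hd _).fderiv, (hd _).fderiv, leftField_coordOne]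
    rfl
  exact (Filter.EventuallyEq.lieBracket_vectorField_eq hX hY).trans (key X Y)

/-- `D(Ad)(1) = ad`, in the chart. -/
lemma fderiv_chartAd_eq_lie (X Y : GroupLieAlgebra 𝓘(ℝ, E) G) :
    fderiv ℝ (chartAd E G) (coordOne E G) X Y = (⁅X, Y⁆ : GroupLieAlgebra 𝓘(ℝ, E) G) :=
  (fderiv_chartAd (E := E) (G := G) X Y).trans (bracket_eq X Y).symm

end Bracket

/-! ### The adjoint representation and its derivative -/

section Adjoint

open Set Filter Function

variable {E : Type*} [NormedAddCommGroup E] [NormedSpace ℝ E] [FiniteDimensional ℝ E]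
  {G : Type*} [TopologicalSpace G] [ChartedSpace E G] [Group G] [LieGroup 𝓘(ℝ, E) ∞ G]

instance : FiniteDimensional ℝ (GroupLieAlgebra 𝓘(ℝ, E) G) :=
  inferInstanceAs (FiniteDimensional ℝ E)

/-- A linear form on the Lie algebra, as a continuous linear form on the model space. -/
def dualCLM (b : Module.Dual ℝ (GroupLieAlgebra 𝓘(ℝ, E) G)) : E →L[ℝ] ℝ :=
  LinearMap.toContinuousLinearMap (show E →ₗ[ℝ] ℝ from b)

/-- The coefficient `g ↦ ⟨b, Ad g Y⟩` of the adjoint representation. -/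
def adCoeff (b : Module.Dual ℝ (GroupLieAlgebra 𝓘(ℝ, E) G)) (Y : GroupLieAlgebra 𝓘(ℝ, E) G)
    (g : G) : ℝ := b (Ad g Y)

lemma adCoeff_mul (b : Module.Dual ℝ (GroupLieAlgebra 𝓘(ℝ, E) G))
    (Y : GroupLieAlgebra 𝓘(ℝ, E) G) (g h : G) :
    adCoeff b Y (g * h) = adCoeff (b ∘ₗ Ad g) Y h := by
  simp [adCoeff]

lemma adCoeff_eq_chart (b : Module.Dual ℝ (GroupLieAlgebra 𝓘(ℝ, E) G))
    (Y : GroupLieAlgebra 𝓘(ℝ, E) G) :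
    adCoeff b Y =ᶠ[𝓝 1] (fun u => dualCLM b (chartAd E G u Y)) ∘
      chartOne E G := by
  filter_upwards [extChartAt_source_mem_nhds (I := 𝓘(ℝ, E)) (1 : G)] with g hg
  have := Ad_chartOne_symm (chartOne E G g) Y
  rw [(chartOne E G).left_inv hg] at this
  exact congrArg b this

lemma contMDiff_adCoeff (b : Module.Dual ℝ (GroupLieAlgebra 𝓘(ℝ, E) G))
    (Y : GroupLieAlgebra 𝓘(ℝ, E) G) : ContMDiff 𝓘(ℝ, E) 𝓘(ℝ, ℝ) ∞ (adCoeff b Y) := by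
  intro g
  have h1 (b : Module.Dual ℝ (GroupLieAlgebra 𝓘(ℝ, E) G)) :
      ContMDiffAt 𝓘(ℝ, E) 𝓘(ℝ, ℝ) ∞ (adCoeff b Y) 1 := by
    refine ContMDiffAt.congr_of_eventuallyEq ?_ (adCoeff_eq_chart b Y)
    refine ContMDiffAt.comp (I' := 𝓘(ℝ, E)) _ ?_ contMDiffAt_chartOne
    refine ContDiffAt.contMDiffAt ?_
    exact (dualCLM b).contDiff.contDiffAt.comp (coordOne E G)
      (contDiffAt_chartAd.clm_apply (contDiffAt_const (F := E) (c := Y)))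
  have h2 : adCoeff b Y = adCoeff (b ∘ₗ Ad g) Y ∘ fun x => g⁻¹ * x := by
    ext x
    rw [comp_apply, ← adCoeff_mul, mul_inv_cancel_left]
  rw [h2]
  refine ContMDiffAt.comp (I' := 𝓘(ℝ, E)) g ?_ contMDiff_mul_left.contMDiffAt
  rw [inv_mul_cancel]
  exact h1 _

/-- The derivative of `Ad` along a curve is `ad`. -/
lemma IsCurve.hasDerivAt_adCoeff {γ : ℝ → G} {X : GroupLieAlgebra 𝓘(ℝ, E) G} (h : IsCurve γ X)
    (b : Module.Dual ℝ (GroupLieAlgebra 𝓘(ℝ, E) G)) (Y : GroupLieAlgebra 𝓘(ℝ, E) G) :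
    HasDerivAt (fun t => b (Ad (γ t) Y)) (b ⁅X, Y⁆) 0 := by
  have h1 : HasFDerivAt (chartAd E G) (fderiv ℝ (chartAd E G) (coordOne E G))
      ((chartOne E G ∘ γ) 0) := by
    rw [comp_apply, h.map_zero]
    exact (contDiffAt_chartAd.differentiableAt (by simp)).hasFDerivAt
  have h2 : HasDerivAt (fun t => chartAd E G ((chartOne E G ∘ γ) t) Y) _ 0 :=
    (h1.comp_hasDerivAt (0 : ℝ) h.hasDerivAt).clm_apply
      (hasDerivAt_const (F := E) (0 : ℝ) Y)
  have h3 := (dualCLM b).hasFDerivAt.comp_hasDerivAt (0 : ℝ) h2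
  have h4 := h.continuousAt.eventually (by rw [h.map_zero]; exact adCoeff_eq_chart b Y)
  have h5 : HasDerivAt (fun t => b (Ad (γ t) Y)) _ 0 := h3.congr_of_eventuallyEq h4
  refine h5.congr_deriv ((congrArg (dualCLM b) ?_).trans
    (congrArg b (fderiv_chartAd_eq_lie X Y)))
  exact (congrArg _ (_root_.map_zero _)).trans (add_zero _)

lemma IsCurve.hasDerivAt_adCoeff_inv {γ : ℝ → G} {X : GroupLieAlgebra 𝓘(ℝ, E) G} (h : IsCurve γ X)
    (b : Module.Dual ℝ (GroupLieAlgebra 𝓘(ℝ, E) G)) (Y : GroupLieAlgebra 𝓘(ℝ, E) G) :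
    HasDerivAt (fun t => b (Ad (γ t)⁻¹ Y)) (-b ⁅X, Y⁆) 0 := by
  refine (h.inv.hasDerivAt_adCoeff b Y).congr_deriv ?_
  rw [neg_lie, map_neg]

/-- Linear forms separate points. Identities between tangent vectors are checked on linear
forms, so that only real functions have to be differentiated. -/
lemma eq_of_forall_dual {X Y : GroupLieAlgebra 𝓘(ℝ, E) G}
    (h : ∀ b : Module.Dual ℝ (GroupLieAlgebra 𝓘(ℝ, E) G), b X = b Y) : X = Y :=
  sub_eq_zero.1 ((Module.forall_dual_apply_eq_zero_iff ℝ _).1 fun b => by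
    rw [map_sub, h b, sub_self])

/-- `Ad g` is an automorphism of the Lie algebra: this is the derivative at `t = 0` of
`Ad g (Ad (γ t) Y) = Ad (g γ(t) g⁻¹) (Ad g Y)`. -/
lemma Ad_lie (g : G) (X Y : GroupLieAlgebra 𝓘(ℝ, E) G) : Ad g ⁅X, Y⁆ = ⁅Ad g X, Ad g Y⁆ := by
  obtain ⟨γ, hγ⟩ := exists_isCurve X
  refine eq_of_forall_dual fun b => ?_
  have h1 : HasDerivAt _ _ _ := (hγ.conj g).hasDerivAt_adCoeff b (Ad g Y)
  have h2 := hγ.hasDerivAt_adCoeff (b ∘ₗ Ad g) Y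
  refine h2.unique (h1.congr_of_eventuallyEq (.of_forall fun t => ?_))
  simp

/-- If `Ad h` preserves the subspace `V` for all `h` in the subgroup `H`, then so does `ad X` for
all `X` in the Lie algebra of `H`. -/
lemma lie_mem_of_Ad_mem {H : Subgroup G} {V : Submodule ℝ (GroupLieAlgebra 𝓘(ℝ, E) G)}
    (hV : ∀ h ∈ H, ∀ Y ∈ V, Ad h Y ∈ V) {X Y : GroupLieAlgebra 𝓘(ℝ, E) G}
    (hX : X ∈ lieSub H) (hY : Y ∈ V) : ⁅X, Y⁆ ∈ V := by
  obtain ⟨γ, hγ, hH⟩ := hX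
  by_contra hn
  obtain ⟨b, hb, hVb⟩ := Submodule.exists_le_ker_of_notMem hn
  refine hb ((hγ.hasDerivAt_adCoeff b Y).unique ?_)
  have : (fun t => b (Ad (γ t) Y)) = fun _ => 0 := by
    ext t
    exact hVb (hV _ (hH t) Y hY)
  rw [this]
  exact hasDerivAt_const _ _

end Adjoint

/-! ### Integral curves of left invariant vector fields -/

section LeftCurve

open Set Filter Function

variable {E : Type*} [NormedAddCommGroup E] [NormedSpace ℝ E] [FiniteDimensional ℝ E]
  {G : Type*} [TopologicalSpace G] [ChartedSpace E G] [Group G] [LieGroup 𝓘(ℝ, E) ∞ G]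

/-- `γ` is a germ at `0` of an integral curve through `1` of the left invariant vector field with
value `X` at `1`: the velocity of `s ↦ γ(t)⁻¹ γ(t + s)` at `s = 0` is `X` for all small `t`. -/
structure IsLeftCurve (γ : ℝ → G) (X : GroupLieAlgebra 𝓘(ℝ, E) G) : Prop where
  isCurve : IsCurve γ X
  eventually_isCurve : ∀ᶠ t in 𝓝 0, IsCurve (fun s => (γ t)⁻¹ * γ (t + s)) X

lemma IsCurve.congr {γ δ : ℝ → G} {X : GroupLieAlgebra 𝓘(ℝ, E) G} (h : IsCurve γ X)
    (h' : δ =ᶠ[𝓝 0] γ) : IsCurve δ X where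
  map_zero := h'.self_of_nhds.trans h.map_zero
  smooth := h.smooth.congr_of_eventuallyEq h'
  velocity := by
    rw [← h.velocity]
    exact congrArg (fun L : ℝ →L[ℝ] E => L 1) h'.mfderiv_eq

lemma contMDiffAt_chartOne_symm_of_mem {u : E} (hu : u ∈ (chartOne E G).target) :
    ContMDiffAt 𝓘(ℝ, E) 𝓘(ℝ, E) ∞ (chartOne E G).symm u :=
  (contMDiffOn_extChartAt_symm (I := 𝓘(ℝ, E)) (n := ∞) (1 : G) _ hu).contMDiffAt
    ((isOpen_extChartAt_target (I := 𝓘(ℝ, E)) (1 : G)).mem_nhds hu)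

lemma contDiffAt_chartMul_of_mem {u v : E} (hu : u ∈ (chartOne E G).target)
    (hv : v ∈ (chartOne E G).target)
    (huv : (chartOne E G).symm u * (chartOne E G).symm v ∈ (chartOne E G).source) :
    ContDiffAt ℝ ∞ (chartMul E G) (u, v) := by
  rw [← contMDiffAt_iff_contDiffAt]
  have h1 : ContMDiffAt 𝓘(ℝ, E × E) 𝓘(ℝ, E) ∞ (fun x : E × E => (chartOne E G).symm x.1) (u, v) :=
    ContMDiffAt.comp (I' := 𝓘(ℝ, E)) (u, v) (g := (chartOne E G).symm) (f := Prod.fst)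
      (contMDiffAt_chartOne_symm_of_mem hu) contDiff_fst.contDiffAt.contMDiffAt
  have h2 : ContMDiffAt 𝓘(ℝ, E × E) 𝓘(ℝ, E) ∞ (fun x : E × E => (chartOne E G).symm x.2) (u, v) :=
    ContMDiffAt.comp (I' := 𝓘(ℝ, E)) (u, v) (g := (chartOne E G).symm) (f := Prod.snd)
      (contMDiffAt_chartOne_symm_of_mem hv) contDiff_snd.contDiffAt.contMDiffAt
  exact ContMDiffAt.comp (I' := 𝓘(ℝ, E)) _ (g := chartOne E G)
    (f := fun x : E × E => (chartOne E G).symm x.1 * (chartOne E G).symm x.2)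
    (contMDiffAt_extChartAt' (by simpa using huv)) (h1.mul h2)

lemma contDiffAt_leftField_of_mem {u : E} (hu : u ∈ (chartOne E G).target) :
    ContDiffAt ℝ ∞ (leftField E G) u :=
  ContDiffAt.fderiv (n := ∞) (f := fun u v => chartMul E G (u, v)) (g := fun _ => coordOne E G)
    (contDiffAt_chartMul_of_mem hu (mem_extChartAt_target _) (by
      rw [chartOne_symm_coordOne, mul_one]
      exact (chartOne E G).map_target hu)) contDiffAt_const (by simp)

lemma eventually_injective_leftField :
    ∀ᶠ u in 𝓝 (coordOne E G), Injective (leftField E G u) := by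
  have h1 : ∀ᶠ u in 𝓝 (coordOne E G), IsUnit (leftField E G u) := by
    refine contDiffAt_leftField.continuousAt.eventually_mem (Units.isOpen.mem_nhds ?_)
    rw [leftField_coordOne]
    exact isUnit_one
  filter_upwards [h1] with u ⟨L, hL⟩
  refine LeftInverse.injective (g := (L⁻¹ : (E →L[ℝ] E)ˣ)) fun v => ?_
  rw [← hL]
  exact congrArg (fun T : E →L[ℝ] E => T v) L.inv_mul

/-- Integral curves of left invariant vector fields exist: in the chart they solve the
differential equation `u' = leftField u X`. -/
theorem exists_isLeftCurve (X : GroupLieAlgebra 𝓘(ℝ, E) G) : ∃ γ : ℝ → G, IsLeftCurve γ X := by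
  obtain ⟨x, hx⟩ : ∃ x : E, x = X := ⟨_, rfl⟩
  set p := coordOne E G
  have hf : ∀ u ∈ (chartOne E G).target, ContDiffAt ℝ ∞ (fun u => leftField E G u x) u :=
    fun u hu => (contDiffAt_leftField_of_mem hu).clm_apply contDiffAt_const
  obtain ⟨r, hr, ε, hε, h⟩ :=
    ContDiffAt.exists_forall_mem_closedBall_exists_eq_forall_mem_Ioo_hasDerivAt
    ((hf p (mem_extChartAt_target _)).of_le (by simp)) 0
  obtain ⟨α, hα0, hα⟩ := h p (Metric.mem_closedBall_self hr.le)
  simp only [zero_sub, zero_add] at hα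
  have hαc : ContinuousAt α 0 := (hα 0 ⟨by linarith, hε⟩).continuousAt
  -- the solution stays near the origin of the chart for small times
  have hev : ∀ᶠ t in 𝓝 (0 : ℝ), t ∈ Ioo (-ε) ε ∧ α t ∈ (chartOne E G).target ∧
      Injective (leftField E G (α t)) := by
    have hI : ∀ᶠ t in 𝓝 (0 : ℝ), t ∈ Ioo (-ε) ε := Ioo_mem_nhds (by linarith) hε
    refine hI.and ?_
    rw [ContinuousAt, hα0] at hαc
    exact (hαc.eventually_mem chartOne_target_mem_nhds).and
      (hαc.eventually eventually_injective_leftField)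
  obtain ⟨δ, hδ, hball⟩ := Metric.eventually_nhds_iff_ball.1 hev
  have hsmooth : ∀ t ∈ Metric.ball (0 : ℝ) δ, ContDiffAt ℝ ∞ α t := by
    intro t ht
    obtain ⟨η, hη, hη'⟩ := Metric.isOpen_iff.1 Metric.isOpen_ball t ht
    have hsub : Icc (t - η / 2) (t + η / 2) ⊆ Metric.ball (0 : ℝ) δ := by
      refine Subset.trans ?_ hη'
      rw [← Real.closedBall_eq_Icc]
      exact Metric.closedBall_subset_ball (by linarith)
    refine (ODE.contDiffOn_enat_Icc_of_hasDerivWithinAt (n := ⊤)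
      (f := fun _ u => leftField E G u x) (u := (chartOne E G).target) (tmin := t - η / 2)
      (tmax := t + η / 2) ?_ ?_ ?_).contDiffAt (Icc_mem_nhds (by linarith) (by linarith))
    · intro q hq
      exact ((hf q.2 hq.2).comp q contDiff_snd.contDiffAt).contDiffWithinAt
    · intro s hs
      exact (hα s (hball s (hsub hs)).1).hasDerivWithinAt
    · intro s hs
      exact (hball s (hsub hs)).2.1
  have hγs : ∀ t ∈ Metric.ball (0 : ℝ) δ,
      ContMDiffAt 𝓘(ℝ, ℝ) 𝓘(ℝ, E) ∞ (fun t => (chartOne E G).symm (α t)) t := fun t ht =>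
    ContMDiffAt.comp (I' := 𝓘(ℝ, E)) t (contMDiffAt_chartOne_symm_of_mem (hball t ht).2.1)
      (hsmooth t ht).contMDiffAt
  have key : ∀ t ∈ Metric.ball (0 : ℝ) δ, IsCurve
      (fun s => ((chartOne E G).symm (α t))⁻¹ * (chartOne E G).symm (α (t + s))) X := by
    intro t ht
    set d : ℝ → G := fun s => ((chartOne E G).symm (α t))⁻¹ * (chartOne E G).symm (α (t + s))
      with hd
    have hd0 : d 0 = 1 := by simp [hd]
    have hshift : ContMDiffAt 𝓘(ℝ, ℝ) 𝓘(ℝ, ℝ) ∞ (fun s : ℝ => t + s) 0 :=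
      (contDiff_const.add contDiff_id).contDiffAt.contMDiffAt
    have hds : ContMDiffAt 𝓘(ℝ, ℝ) 𝓘(ℝ, E) ∞ d 0 :=
      contMDiffAt_const.mul (ContMDiffAt.comp (I' := 𝓘(ℝ, ℝ)) (0 : ℝ)
        (g := fun t => (chartOne E G).symm (α t)) (f := fun s => t + s)
        (by rw [add_zero]; exact hγs t ht) hshift)
    have hdd : ContDiffAt ℝ ∞ (chartOne E G ∘ d) 0 := by
      rw [← contMDiffAt_iff_contDiffAt]
      exact ContMDiffAt.comp (0 : ℝ) (by rw [hd0]; exact contMDiffAt_chartOne) hds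
    have hZ := (hdd.differentiableAt (by simp)).hasDerivAt
    set Z := deriv (chartOne E G ∘ d) 0
    have hm : HasFDerivAt (fun v => chartMul E G (α t, v)) (leftField E G (α t))
        ((chartOne E G ∘ d) 0) := by
      rw [comp_apply, hd0]
      refine DifferentiableAt.hasFDerivAt ?_
      refine DifferentiableAt.comp p (g := chartMul E G) (f := fun v => (α t, v)) ?_
        (hasFDerivAt_prodMk_right (α t) p).differentiableAt
      refine (contDiffAt_chartMul_of_mem (hball t ht).2.1 (mem_extChartAt_target _) ?_
        ).differentiableAt (by simp)
      rw [chartOne_symm_coordOne, mul_one]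
      exact (chartOne E G).map_target (hball t ht).2.1
    have h1 := hm.comp_hasDerivAt (0 : ℝ) hZ
    have h2 : HasDerivAt (fun s => α (t + s)) (leftField E G (α t) x) 0 := by
      have h3 := hα t (hball t ht).1
      rw [show t = t + 0 by simp] at h3
      have := h3.comp_const_add t 0
      simpa using this
    have hmem : ∀ᶠ s in 𝓝 (0 : ℝ), t + s ∈ Metric.ball (0 : ℝ) δ := by
      refine hshift.continuousAt.eventually_mem (Metric.isOpen_ball.mem_nhds ?_)
      rwa [add_zero]
    have hsrc : ∀ᶠ s in 𝓝 (0 : ℝ), d s ∈ (chartOne E G).source := by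
      refine hds.continuousAt.eventually_mem ?_
      rw [hd0]
      exact extChartAt_source_mem_nhds _
    have h4 : (fun s => α (t + s)) =ᶠ[𝓝 0]
        (fun v => chartMul E G (α t, v)) ∘ (chartOne E G ∘ d) := by
      filter_upwards [hmem, hsrc] with s hs hs'
      have h6 : (chartOne E G).symm (chartOne E G (d s)) = d s := (chartOne E G).left_inv hs'
      simp only [comp_apply, chartMul, h6]
      simp only [hd, mul_inv_cancel_left]
      exact ((chartOne E G).right_inv (hball _ hs).2.1).symm
    have h5 : leftField E G (α t) x = leftField E G (α t) Z :=
      h2.unique (h1.congr_of_eventuallyEq h4)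
    refine isCurve_of_chart hd0 hds ?_
    rw [← (hball t ht).2.2 h5, hx] at hZ
    exact hZ
  refine ⟨fun t => (chartOne E G).symm (α t), ?_, ?_⟩
  · have h0 := key 0 (Metric.mem_ball_self hδ)
    rw [hα0, chartOne_symm_coordOne] at h0
    simpa using h0
  · exact Filter.mem_of_superset (Metric.ball_mem_nhds 0 hδ) key

/-- If `b` vanishes on `[X, V]` for an `Ad`-invariant subspace `V`, then the integral curves of
the left invariant vector field of `X` stay in the stabilizer of the restriction of `b` to `V`. -/
lemma IsLeftCurve.eventually_stab {γ : ℝ → G} {X : GroupLieAlgebra 𝓘(ℝ, E) G}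
    (h : IsLeftCurve γ X) {V : Submodule ℝ (GroupLieAlgebra 𝓘(ℝ, E) G)}
    (hV : ∀ g : G, ∀ Y ∈ V, Ad g Y ∈ V) {b : Module.Dual ℝ (GroupLieAlgebra 𝓘(ℝ, E) G)}
    (hb : ∀ Y ∈ V, b ⁅X, Y⁆ = 0) : ∀ᶠ t in 𝓝 0, ∀ Y ∈ V, b (Ad (γ t)⁻¹ Y) = b Y := by
  obtain ⟨δ, hδ, hball⟩ := Metric.eventually_nhds_iff_ball.1 h.eventually_isCurve
  refine Filter.mem_of_superset (Metric.ball_mem_nhds 0 hδ) fun t ht Y hY => ?_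
  have hd : ∀ s ∈ Metric.ball (0 : ℝ) δ, HasDerivAt (fun t => b (Ad (γ t)⁻¹ Y)) 0 s := by
    intro s hs
    have h1 := (hball s hs).hasDerivAt_adCoeff_inv b (Ad (γ s)⁻¹ Y)
    rw [hb _ (hV _ _ hY), neg_zero] at h1
    have h2 : (fun r => b (Ad ((γ s)⁻¹ * γ (s + r))⁻¹ (Ad (γ s)⁻¹ Y))) =
        fun r => b (Ad (γ (s + r))⁻¹ Y) := by
      ext r
      rw [← Module.End.mul_apply, ← _root_.map_mul]
      congr 3
      group
    rw [h2] at h1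
    have h3 : HasDerivAt (fun r => b (Ad (γ r)⁻¹ Y)) 0 (s + 0) := by
      have := HasDerivAt.comp_const_add (f := fun r => b (Ad (γ (s + r))⁻¹ Y)) (-s) s (f' := 0)
        (by rwa [neg_add_cancel])
      simpa using this
    rwa [add_zero] at h3
  have := Metric.isOpen_ball.is_const_of_deriv_eq_zero
    (convex_ball (0 : ℝ) δ).isPreconnected
    (fun s hs => (hd s hs).differentiableAt.differentiableWithinAt)
    (fun s hs => (hd s hs).deriv) ht (Metric.mem_ball_self hδ)
  simpa [h.isCurve.map_zero] using this

end LeftCurve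

/-! ### Smooth patches in subgroups -/

section Patch

open Set Filter Function

variable {E : Type*} [NormedAddCommGroup E] [NormedSpace ℝ E] [FiniteDimensional ℝ E]
  {G : Type*} [TopologicalSpace G] [ChartedSpace E G] [Group G] [LieGroup 𝓘(ℝ, E) ∞ G]
  {U : Type*} [NormedAddCommGroup U] [NormedSpace ℝ U]
  {W : Type*} [NormedAddCommGroup W] [NormedSpace ℝ W]

/-- `c` is a smooth map from a neighbourhood of `0` in `U` to `G`, with `c 0 = 1` and derivative `T`
at `0`. The derivative is specified through the curves `t ↦ c (t u)`. -/
structure IsPatch (c : U → G) (T : U →ₗ[ℝ] GroupLieAlgebra 𝓘(ℝ, E) G) : Prop where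
  smooth : ContMDiffAt 𝓘(ℝ, U) 𝓘(ℝ, E) ∞ c 0
  isCurve : ∀ u, IsCurve (fun t : ℝ => c (t • u)) (T u)

namespace IsPatch

variable {c : U → G} {T : U →ₗ[ℝ] GroupLieAlgebra 𝓘(ℝ, E) G}

lemma map_zero (h : IsPatch c T) : c 0 = 1 := by simpa using (h.isCurve 0).map_zero

lemma contDiffAt (h : IsPatch c T) : ContDiffAt ℝ ∞ (chartOne E G ∘ c) 0 := by
  rw [← contMDiffAt_iff_contDiffAt]
  exact ContMDiffAt.comp (0 : U) (by rw [h.map_zero]; exact contMDiffAt_chartOne) h.smooth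

lemma fderiv_apply (h : IsPatch c T) (u : U) : fderiv ℝ (chartOne E G ∘ c) 0 u = T u := by
  have h1 : HasFDerivAt (chartOne E G ∘ c) (fderiv ℝ (chartOne E G ∘ c) 0) ((0 : ℝ) • u) := by
    rw [zero_smul]
    exact (h.contDiffAt.differentiableAt (by simp)).hasFDerivAt
  have h2 : HasDerivAt (fun t : ℝ => t • u) u 0 := by
    simpa using (hasDerivAt_id (0 : ℝ)).smul_const u
  exact (h1.comp_hasDerivAt (0 : ℝ) h2).unique (h.isCurve u).hasDerivAt

lemma mul {d : W → G} {R : W →ₗ[ℝ] GroupLieAlgebra 𝓘(ℝ, E) G} (h : IsPatch c T)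
    (h' : IsPatch d R) : IsPatch (fun x : U × W => c x.1 * d x.2) (T.coprod R) where
  smooth := by
    refine ContMDiffAt.mul ?_ ?_
    · exact ContMDiffAt.comp (I' := 𝓘(ℝ, U)) (0 : U × W) (g := c) (f := Prod.fst) h.smooth
        contDiff_fst.contDiffAt.contMDiffAt
    · exact ContMDiffAt.comp (I' := 𝓘(ℝ, W)) (0 : U × W) (g := d) (f := Prod.snd) h'.smooth
        contDiff_snd.contDiffAt.contMDiffAt
  isCurve x := (h.isCurve x.1).mul (h'.isCurve x.2)

/-- The inverse function theorem, at the identity of a Lie group. -/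
lemma exists_rightInverse [CompleteSpace U] (h : IsPatch c T) (hT : Bijective T) :
    ∃ ψ : G → U, ContMDiffAt 𝓘(ℝ, E) 𝓘(ℝ, U) ∞ ψ 1 ∧ ψ 1 = 0 ∧ ∀ᶠ g in 𝓝 1, c (ψ g) = g := by
  let T' : U ≃ₗ[ℝ] E := LinearEquiv.ofBijective (show U →ₗ[ℝ] E from T) hT
  have : FiniteDimensional ℝ U := T'.symm.finiteDimensional
  let T'' : U ≃L[ℝ] E := T'.toContinuousLinearEquiv
  have h1 : HasFDerivAt (chartOne E G ∘ c) (T'' : U →L[ℝ] E) 0 := by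
    have := (h.contDiffAt.differentiableAt (by simp)).hasFDerivAt
    convert this using 1
    ext u
    exact (h.fderiv_apply u).symm
  have hp : (chartOne E G ∘ c) 0 = coordOne E G := by
    rw [comp_apply, h.map_zero]
  have hinv := h.contDiffAt.to_localInverse h1 (by simp)
  have h0 := (h.contDiffAt.hasStrictFDerivAt' h1 (by simp)).localInverse_apply_image
  have hr := (h.contDiffAt.hasStrictFDerivAt' h1 (by simp)).eventually_right_inverse
  set inv := h.contDiffAt.localInverse h1 (by simp) with hi
  change inv _ = 0 at h0
  change ∀ᶠ y in 𝓝 _, (chartOne E G ∘ c) (inv y) = y at hr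
  rw [hp] at hinv h0 hr
  have hψ : ContMDiffAt 𝓘(ℝ, E) 𝓘(ℝ, U) ∞ (inv ∘ chartOne E G) 1 :=
    ContMDiffAt.comp (I' := 𝓘(ℝ, E)) (1 : G) hinv.contMDiffAt contMDiffAt_chartOne
  have hψ0 : (inv ∘ chartOne E G) 1 = 0 := h0
  refine ⟨inv ∘ chartOne E G, hψ, hψ0, ?_⟩
  have hcψ : ContinuousAt (c ∘ inv ∘ chartOne E G) 1 :=
    ContinuousAt.comp (by rw [hψ0]; exact h.smooth.continuousAt) hψ.continuousAt
  have hsrc : (chartOne E G).source ∈ 𝓝 ((c ∘ inv ∘ chartOne E G) 1) := by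
    rw [comp_apply, hψ0, h.map_zero]
    exact extChartAt_source_mem_nhds _
  filter_upwards [extChartAt_source_mem_nhds (I := 𝓘(ℝ, E)) (1 : G), hcψ.eventually_mem hsrc,
    (contMDiffAt_chartOne (E := E) (G := G)).continuousAt.eventually hr] with g hg hg' hg''
  exact (chartOne E G).injOn hg' hg hg''

end IsPatch

/-- Products of curves in a subgroup `H` give a smooth patch in `H` tangent to any given subspace
`V` of the Lie algebra of `H`. -/
lemma exists_isPatch {H : Subgroup G} {V : Submodule ℝ (GroupLieAlgebra 𝓘(ℝ, E) G)}
    (hV : V ≤ lieSub H) :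
    ∃ (c : (Fin (Module.finrank ℝ V) → ℝ) → G)
      (T : (Fin (Module.finrank ℝ V) → ℝ) →ₗ[ℝ] GroupLieAlgebra 𝓘(ℝ, E) G),
      IsPatch c T ∧ T.range = V ∧ Injective T ∧ ∀ u, c u ∈ H := by
  set d := Module.finrank ℝ V
  let b := Module.finBasis ℝ V
  have hb (i : Fin d) : ∃ γ : ℝ → G, IsCurve γ (b i : GroupLieAlgebra 𝓘(ℝ, E) G) ∧ ∀ t, γ t ∈ H :=
    hV (b i).2
  choose γ hγ hγH using hb
  let c (l : List (Fin d)) (u : Fin d → ℝ) : G := (l.map fun i => γ i (u i)).prod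
  have hc (l : List (Fin d)) : ContMDiffAt 𝓘(ℝ, Fin d → ℝ) 𝓘(ℝ, E) ∞ (c l) 0 ∧
      (∀ u, IsCurve (fun t : ℝ => c l (t • u))
        (l.map fun i => u i • (b i : GroupLieAlgebra 𝓘(ℝ, E) G)).sum) ∧ ∀ u, c l u ∈ H := by
    induction l with
    | nil =>
      exact ⟨contMDiffAt_const, fun u => isCurve_const, fun u => H.one_mem⟩
    | cons i l ih =>
      obtain ⟨h1, h2, h3⟩ := ih
      have e : c (i :: l) = fun u => γ i (u i) * c l u := by
        ext u
        simp [c]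
      rw [e]
      refine ⟨ContMDiffAt.mul ?_ h1, fun u => ?_, fun u => H.mul_mem (hγH _ _) (h3 _)⟩
      · exact ContMDiffAt.comp (I' := 𝓘(ℝ, ℝ)) (0 : Fin d → ℝ) (g := γ i) (f := fun u => u i)
          (hγ i).smooth (contDiff_apply ℝ ℝ i).contDiffAt.contMDiffAt
      · have h4 := ((hγ i).smul (u i)).mul (h2 u)
        simp only [Pi.smul_apply, smul_eq_mul, List.map_cons, List.sum_cons]
        simpa only [mul_comm] using h4
  obtain ⟨h1, h2, h3⟩ := hc (List.finRange d)
  let T : (Fin d → ℝ) →ₗ[ℝ] GroupLieAlgebra 𝓘(ℝ, E) G := V.subtype ∘ₗ b.equivFun.symm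
  have hT (u : Fin d → ℝ) : T u = ((List.finRange d).map fun i =>
      u i • (b i : GroupLieAlgebra 𝓘(ℝ, E) G)).sum := by
    rw [← Fin.sum_univ_def]
    simp only [T, LinearMap.comp_apply, LinearEquiv.coe_coe, Module.Basis.equivFun_symm_apply,
      _root_.map_sum, _root_.map_smul, Submodule.subtype_apply]
    rfl
  refine ⟨c (List.finRange d), T, ⟨h1, fun u => by rw [hT]; exact h2 u⟩, ?_, ?_, h3⟩
  · rw [LinearMap.range_comp, LinearEquiv.range, Submodule.map_top, Submodule.range_subtype]
  · exact V.subtype_injective.comp b.equivFun.symm.injective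

end Patch

/-! ### Local inverses of immersions and submersions -/

section NormalForm

open Set Filter Function

variable {E : Type*} [NormedAddCommGroup E] [NormedSpace ℝ E]
  {M : Type*} [TopologicalSpace M] [ChartedSpace E M] [IsManifold 𝓘(ℝ, E) ∞ M]
  {E' : Type*} [NormedAddCommGroup E'] [NormedSpace ℝ E']
  {M' : Type*} [TopologicalSpace M'] [ChartedSpace E' M'] [IsManifold 𝓘(ℝ, E') ∞ M']

/-- An immersion has local smooth left inverses. -/
lemma exists_leftInverse_of_isImmersionAt {f : M → M'} {x : M}
    (h : Manifold.IsImmersionAt 𝓘(ℝ, E) 𝓘(ℝ, E') ∞ f x) :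
    ∃ r : M' → M, ContMDiffAt 𝓘(ℝ, E') 𝓘(ℝ, E) ∞ r (f x) ∧ ∀ᶠ y in 𝓝 x, r (f y) = y := by
  have hw := h.writtenInCharts
  have hx := h.mem_domChart_source
  have hfx := h.mem_codChart_source
  have hd := h.domChart_mem_maximalAtlas
  have hc := h.codChart_mem_maximalAtlas
  set φ := h.domChart
  set ψ := h.codChart
  set e := h.equiv
  have key : ∀ y ∈ φ.source, (e.symm (ψ (f y))).1 = φ y := by
    intro y hy
    have := hw (show φ y ∈ (φ.extend 𝓘(ℝ, E)).target by simpa using φ.map_source hy)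
    simp [φ.left_inv hy] at this
    rw [this]
    simp
  refine ⟨fun z => φ.symm (e.symm (ψ z)).1, ?_, ?_⟩
  · refine ContMDiffAt.comp (I' := 𝓘(ℝ, E)) (f x) (g := φ.symm)
      (f := fun z => (e.symm (ψ z)).1) ?_ ?_
    · rw [key x hx]
      exact contMDiffAt_symm_of_mem_maximalAtlas hd (φ.map_source hx)
    · refine ContMDiffAt.comp (I' := 𝓘(ℝ, E')) (f x) (g := fun z => (e.symm z).1) (f := ψ) ?_
        (contMDiffAt_of_mem_maximalAtlas hc hfx)
      exact (contDiff_fst.comp e.symm.contDiff).contDiffAt.contMDiffAt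
  · filter_upwards [φ.open_source.mem_nhds hx] with y hy
    rw [key y hy, φ.left_inv hy]

/-- A submersion has local smooth sections. -/
lemma exists_section_of_isSubmersionAt {f : M → M'} {x : M}
    (h : Manifold.IsSubmersionAt 𝓘(ℝ, E) 𝓘(ℝ, E') ∞ f x) :
    ∃ s : M' → M, ContMDiffAt 𝓘(ℝ, E') 𝓘(ℝ, E) ∞ s (f x) ∧ s (f x) = x ∧
      ∀ᶠ y in 𝓝 (f x), f (s y) = y := by
  have hw := h.writtenInCharts
  have hx := h.mem_domChart_source
  have hfx := h.mem_codChart_source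
  have hd := h.domChart_mem_maximalAtlas
  have hc := h.codChart_mem_maximalAtlas
  have hss := h.source_subset_preimage_source
  set φ := h.domChart
  set ψ := h.codChart
  set e := h.equiv
  have key : ∀ y ∈ φ.source, ψ (f y) = (e (φ y)).1 := by
    intro y hy
    have := hw (show φ y ∈ (φ.extend 𝓘(ℝ, E)).target by simpa using φ.map_source hy)
    simpa [φ.left_inv hy] using this
  let q : M' → E := fun z => e.symm (ψ z, (e (φ x)).2)
  have hqx : q (f x) = φ x := by
    simp [q, key x hx]
  have hq : ContMDiffAt 𝓘(ℝ, E') 𝓘(ℝ, E) ∞ q (f x) := by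
    refine ContMDiffAt.comp (I' := 𝓘(ℝ, E')) (f x) (g := fun z => e.symm (z, (e (φ x)).2))
      (f := ψ) ?_ (contMDiffAt_of_mem_maximalAtlas hc hfx)
    exact (e.symm.contDiff.comp (contDiff_id.prodMk contDiff_const)).contDiffAt.contMDiffAt
  refine ⟨φ.symm ∘ q, ?_, ?_, ?_⟩
  · refine ContMDiffAt.comp (I' := 𝓘(ℝ, E)) (f x) ?_ hq
    rw [hqx]
    exact contMDiffAt_symm_of_mem_maximalAtlas hd (φ.map_source hx)
  · rw [comp_apply, hqx, φ.left_inv hx]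
  · have h1 : ∀ᶠ y in 𝓝 (f x), q y ∈ φ.target :=
      hq.continuousAt.eventually_mem (φ.open_target.mem_nhds (by
        rw [hqx]; exact φ.map_source hx))
    filter_upwards [h1, ψ.open_source.mem_nhds hfx] with y hy hy'
    have h2 := φ.map_target hy
    have h3 := key _ h2
    refine ψ.injOn (hss h2) hy' ?_
    rw [h3, φ.right_inv hy]
    simp [q]

end NormalForm

/-! ### The Lie algebra of an embedded subgroup -/

section Inclusion

open Set Filter Function

variable {E : Type*} [NormedAddCommGroup E] [NormedSpace ℝ E] [FiniteDimensional ℝ E]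
  {G : Type*} [TopologicalSpace G] [ChartedSpace E G] [Group G] [LieGroup 𝓘(ℝ, E) ∞ G]
  {F : Type*} [NormedAddCommGroup F] [NormedSpace ℝ F] [FiniteDimensional ℝ F]
  {N : Subgroup G} [ChartedSpace F N] [LieGroup 𝓘(ℝ, F) ∞ N]

/-- The derivative at `1` of a function on `G` is its derivative along curves. -/
lemma mfderiv_apply_of_isCurve {B : Type*} [NormedAddCommGroup B] [NormedSpace ℝ B] {f : G → B}
    (hf : MDifferentiableAt 𝓘(ℝ, E) 𝓘(ℝ, B) f 1) {γ : ℝ → G} {X : GroupLieAlgebra 𝓘(ℝ, E) G}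
    (h : IsCurve γ X) {d : B} (hd : HasDerivAt (fun t => f (γ t)) d 0) :
    mfderiv 𝓘(ℝ, E) 𝓘(ℝ, B) f 1 X = d := by
  have h1 := mfderiv_comp_apply_of_eq (I := 𝓘(ℝ, ℝ)) (I' := 𝓘(ℝ, E)) (I'' := 𝓘(ℝ, B))
    (g := f) (f := γ) (x := (0:ℝ)) hf (h.smooth.mdifferentiableAt (by simp)) h.map_zero (1:ℝ)
  rw [h.velocity] at h1
  refine h1.symm.trans ?_
  rw [mfderiv_eq_fderiv]
  have h2 : fderiv ℝ (f ∘ γ) 0 1 = d := by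
    rw [fderiv_apply_one_eq_deriv]
    exact hd.deriv
  exact h2

variable (E F N) in
/-- `inclLie` as a linear map. -/
def inclLin : GroupLieAlgebra 𝓘(ℝ, F) N →ₗ[ℝ] GroupLieAlgebra 𝓘(ℝ, E) G :=
  show F →ₗ[ℝ] E from (mfderiv 𝓘(ℝ, F) 𝓘(ℝ, E) ((↑) : N → G) 1 : F →L[ℝ] E).toLinearMap

variable (hemb : Manifold.IsSmoothEmbedding 𝓘(ℝ, F) 𝓘(ℝ, E) ∞ ((↑) : N → G))

include hemb

lemma IsCurve.incl {γ : ℝ → N} {Y : GroupLieAlgebra 𝓘(ℝ, F) N} (h : IsCurve γ Y) :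
    IsCurve (fun t => (γ t : G)) (inclLie Y : GroupLieAlgebra 𝓘(ℝ, E) G) where
  map_zero := by rw [h.map_zero]; rfl
  smooth := hemb.contMDiff.contMDiffAt.comp (0 : ℝ) h.smooth
  velocity := by
    have := mfderiv_comp_apply_of_eq (I := 𝓘(ℝ, ℝ)) (I' := 𝓘(ℝ, F)) (I'' := 𝓘(ℝ, E))
      (g := ((↑) : N → G)) (f := γ) (x := (0:ℝ)) (hemb.contMDiff.mdifferentiable (by simp) _)
      (h.smooth.mdifferentiableAt (by simp)) h.map_zero (1:ℝ)
    rw [h.velocity] at this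
    exact this

lemma IsLeftCurve.incl {γ : ℝ → N} {Y : GroupLieAlgebra 𝓘(ℝ, F) N} (h : IsLeftCurve γ Y) :
    IsLeftCurve (fun t => (γ t : G)) (inclLie Y : GroupLieAlgebra 𝓘(ℝ, E) G) where
  isCurve := h.isCurve.incl hemb
  eventually_isCurve := h.eventually_isCurve.mono fun _ ht => ht.incl hemb

/-- A map into the embedded submanifold `N` of `G` is smooth if it is so as a map into `G`. -/
lemma contMDiffAt_of_incl {B : Type*} [NormedAddCommGroup B] [NormedSpace ℝ B]
    {M : Type*} [TopologicalSpace M] [ChartedSpace B M] [IsManifold 𝓘(ℝ, B) ∞ M] {f : M → N} {x : M}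
    (h : ContMDiffAt 𝓘(ℝ, B) 𝓘(ℝ, E) ∞ (fun y => (f y : G)) x) :
    ContMDiffAt 𝓘(ℝ, B) 𝓘(ℝ, F) ∞ f x := by
  have hc : ContinuousAt f x := by
    rw [Topology.IsInducing.subtypeVal.continuousAt_iff]
    exact h.continuousAt
  obtain ⟨r, hr, hr'⟩ := exists_leftInverse_of_isImmersionAt (hemb.isImmersion.isImmersionAt (f x))
  refine (ContMDiffAt.comp (I' := 𝓘(ℝ, E)) x (g := r) (f := fun y => (f y : G)) hr h
    ).congr_of_eventuallyEq ?_
  filter_upwards [hc.eventually hr'] with y hy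
  exact hy.symm

lemma inclLie_injective : Injective (inclLin E F N) := by
  intro X Y hXY
  obtain ⟨r, hr, hr'⟩ := exists_leftInverse_of_isImmersionAt (hemb.isImmersion.isImmersionAt 1)
  have h (Z : GroupLieAlgebra 𝓘(ℝ, F) N) :
      (mfderiv 𝓘(ℝ, E) 𝓘(ℝ, F) r ((1 : N) : G) : E →L[ℝ] F) (inclLin E F N Z) = Z := by
    have h1 := mfderiv_comp_apply_of_eq (I := 𝓘(ℝ, F)) (I' := 𝓘(ℝ, E)) (I'' := 𝓘(ℝ, F))
      (g := r) (f := ((↑) : N → G)) (x := (1:N)) (hr.mdifferentiableAt (by simp))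
      (hemb.contMDiff.mdifferentiable (by simp) _) rfl Z
    refine h1.symm.trans ?_
    have h2 : r ∘ ((↑) : N → G) =ᶠ[𝓝 1] id := hr'
    exact (congrArg (fun L : F →L[ℝ] F => L Z) (h2.mfderiv_eq (I := 𝓘(ℝ, F)) (I' := 𝓘(ℝ, F)))
      ).trans (congrArg (fun L : F →L[ℝ] F => L Z) mfderiv_id)
  exact (h X).symm.trans ((congrArg _ hXY).trans (h Y))

lemma inclLie_mem (Y : GroupLieAlgebra 𝓘(ℝ, F) N) :
    (inclLie Y : GroupLieAlgebra 𝓘(ℝ, E) G) ∈ lieSub N := by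
  obtain ⟨γ, hγ⟩ := exists_isCurve Y
  exact ⟨_, hγ.incl hemb, fun t => (γ t).2⟩

/-- A smooth curve of `G` which stays in `N` is a smooth curve of `N`. -/
lemma IsCurve.exists_codRestrict {γ : ℝ → G} {X : GroupLieAlgebra 𝓘(ℝ, E) G} (h : IsCurve γ X)
    (hN : ∀ t, γ t ∈ N) :
    ∃ Y : GroupLieAlgebra 𝓘(ℝ, F) N, IsCurve (fun t => (⟨γ t, hN t⟩ : N)) Y ∧ inclLie Y = X := by
  obtain ⟨Y, hY⟩ : ∃ Y : GroupLieAlgebra 𝓘(ℝ, F) N, IsCurve (fun t => (⟨γ t, hN t⟩ : N)) Y :=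
    ⟨_, Subtype.ext h.map_zero, contMDiffAt_of_incl hemb h.smooth, rfl⟩
  exact ⟨Y, hY, (hY.incl hemb).unique h⟩

lemma range_inclLin : (inclLin E F N).range = lieSub N := by
  ext X
  constructor
  · rintro ⟨Y, rfl⟩
    exact inclLie_mem hemb Y
  · rintro ⟨γ, hγ, hN⟩
    obtain ⟨Y, -, hY⟩ := hγ.exists_codRestrict hemb hN
    exact ⟨Y, hY⟩

lemma inclLie_Ad (n : N) (Y : GroupLieAlgebra 𝓘(ℝ, F) N) :
    (inclLie (Ad n Y) : GroupLieAlgebra 𝓘(ℝ, E) G) =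
      Ad (n : G) (inclLie Y : GroupLieAlgebra 𝓘(ℝ, E) G) := by
  obtain ⟨γ, hγ⟩ := exists_isCurve Y
  exact ((hγ.conj n).incl hemb).unique ((hγ.incl hemb).conj (n : G))

lemma inclLie_lie (X Y : GroupLieAlgebra 𝓘(ℝ, F) N) :
    (inclLie ⁅X, Y⁆ : GroupLieAlgebra 𝓘(ℝ, E) G) =
      ⁅(inclLie X : GroupLieAlgebra 𝓘(ℝ, E) G), inclLie Y⁆ := by
  obtain ⟨γ, hγ⟩ := exists_isCurve X
  refine eq_of_forall_dual fun b => ?_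
  have h1 := hγ.hasDerivAt_adCoeff (b ∘ₗ inclLin E F N) Y
  have h2 := (hγ.incl hemb).hasDerivAt_adCoeff b (inclLie Y)
  refine h1.unique (h2.congr_of_eventuallyEq (.of_forall fun t => ?_))
  exact congrArg b (inclLie_Ad hemb (γ t) Y)

end Inclusion

/-! ### The Lie algebras of the stabilizers -/

section Stabilizer

open Set Filter Function

variable {E : Type*} [NormedAddCommGroup E] [NormedSpace ℝ E] [FiniteDimensional ℝ E]
  {G : Type*} [TopologicalSpace G] [ChartedSpace E G] [Group G] [LieGroup 𝓘(ℝ, E) ∞ G]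
  {N : Subgroup G} [N.Normal] {a : Module.Dual ℝ (lieSub (E := E) N)}

lemma coadG_apply (g : G) (b : Module.Dual ℝ (GroupLieAlgebra 𝓘(ℝ, E) G))
    (Y : GroupLieAlgebra 𝓘(ℝ, E) G) : coadG g b Y = b (Ad g⁻¹ Y) := rfl

lemma Ad_mem (g : G) {Y : GroupLieAlgebra 𝓘(ℝ, E) G} (hY : Y ∈ lieSub N) : Ad g Y ∈ lieSub N :=
  Ad_mem_lieSub N g hY

variable (N) in
lemma lie_mem_lieSub_right (X : GroupLieAlgebra 𝓘(ℝ, E) G) {Y : GroupLieAlgebra 𝓘(ℝ, E) G}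
    (hY : Y ∈ lieSub N) : ⁅X, Y⁆ ∈ lieSub N := by
  obtain ⟨γ, hγ⟩ := exists_isCurve X
  exact lie_mem_of_Ad_mem (H := ⊤) (fun g _ Y hY => Ad_mem g hY) ⟨γ, hγ, fun _ => trivial⟩ hY

variable {b : Module.Dual ℝ (GroupLieAlgebra 𝓘(ℝ, E) G)}

/-- The linear form `b` on `𝔤` extends the linear form `a` on `𝔫`. -/
def Extends (b : Module.Dual ℝ (GroupLieAlgebra 𝓘(ℝ, E) G))
    (a : Module.Dual ℝ (lieSub (E := E) N)) : Prop :=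
  ∀ Y : lieSub (E := E) N, b Y = a Y

lemma exists_extends (a : Module.Dual ℝ (lieSub (E := E) N)) : ∃ b, Extends b a := by
  obtain ⟨b, hb⟩ := LinearMap.exists_extend a
  exact ⟨b, fun Y => congrArg (fun f => f Y) hb⟩

lemma Extends.coadN_apply (h : Extends b a) (g : G) (Y : lieSub (E := E) N) :
    coadN N g a Y = b (Ad g⁻¹ Y) := (h _).symm

lemma Extends.mem_stabG (h : Extends b a) {g : G} :
    g ∈ stabG a ↔ ∀ Y ∈ lieSub (E := E) N, b (Ad g⁻¹ Y) = b Y := by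
  constructor
  · intro hg Y hY
    rw [← h.coadN_apply g ⟨Y, hY⟩, show coadN N g a = a from hg]
    exact (h ⟨Y, hY⟩).symm
  · intro hg
    refine LinearMap.ext fun Y => ?_
    rw [h.coadN_apply, hg _ Y.2, h Y]

/-- The Lie algebra of the stabilizer of `a` in `G` consists of the `X` with `X · a = 0`. -/
lemma Extends.mem_lieSub_stabG (h : Extends b a) {X : GroupLieAlgebra 𝓘(ℝ, E) G} :
    X ∈ lieSub (stabG a) ↔ ∀ Y ∈ lieSub (E := E) N, b ⁅X, Y⁆ = 0 := by
  constructor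
  · rintro ⟨γ, hγ, hs⟩ Y hY
    have h1 := hγ.hasDerivAt_adCoeff_inv b Y
    have h2 : (fun t => b (Ad (γ t)⁻¹ Y)) = fun _ => b Y :=
      funext fun t => h.mem_stabG.1 (hs t) Y hY
    rw [h2] at h1
    exact neg_eq_zero.1 (h1.unique (hasDerivAt_const _ _))
  · intro hX
    obtain ⟨γ, hγ⟩ := exists_isLeftCurve X
    have h1 := hγ.eventually_stab (V := lieSub N) (fun g Y hY => Ad_mem g hY) hX
    -- off a neighbourhood of `0`, the curve is replaced by the constant curve
    classical
    refine ⟨fun t => if ∀ Y ∈ lieSub (E := E) N, b (Ad (γ t)⁻¹ Y) = b Y then γ t else 1,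
      hγ.isCurve.congr (h1.mono fun t ht => if_pos ht), fun t => ?_⟩
    dsimp only
    split_ifs with ht
    · exact h.mem_stabG.2 ht
    · exact (stabG a).one_mem

variable {F : Type*} [NormedAddCommGroup F] [NormedSpace ℝ F] [FiniteDimensional ℝ F]
  [ChartedSpace F N] [LieGroup 𝓘(ℝ, F) ∞ N]

/-- The stabilizer in `N` of the linear form `b` on `𝔤`. -/
def stabDual (N : Subgroup G) (b : Module.Dual ℝ (GroupLieAlgebra 𝓘(ℝ, E) G)) : Subgroup N where
  carrier := {n | coadG (n : G) b = b}
  one_mem' := by simp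
  mul_mem' := by
    intro g h hg hh
    simp only [Set.mem_ofPred_eq, Subgroup.coe_mul, map_mul, Module.End.mul_apply] at *
    rw [hh, hg]
  inv_mem' := by
    intro g hg
    simp only [Set.mem_ofPred_eq, Subgroup.coe_inv] at *
    conv_lhs => rw [← hg]
    exact coadG.inv_self_apply (g : G) b

lemma mem_stabDual {n : N} : n ∈ stabDual N b ↔ coadG (n : G) b = b := Iff.rfl

lemma Extends.mem_stabN_of_mem_stabDual (h : Extends b a) {n : N} (hn : n ∈ stabDual N b) :
    (n : G) ∈ stabN a :=
  ⟨n.2, h.mem_stabG.2 fun Y _ => congrArg (fun f => f Y) (mem_stabDual.1 hn)⟩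

variable (hemb : Manifold.IsSmoothEmbedding 𝓘(ℝ, F) 𝓘(ℝ, E) ∞ ((↑) : N → G))

include hemb

/-- If `b` vanishes on `[Y, 𝔤]`, then `Y` is in the Lie algebra of the stabilizer of `b`. -/
lemma mem_lieSub_stabDual {Y : GroupLieAlgebra 𝓘(ℝ, F) N}
    (hY : ∀ Z : GroupLieAlgebra 𝓘(ℝ, E) G, b ⁅(inclLie Y : GroupLieAlgebra 𝓘(ℝ, E) G), Z⁆ = 0) :
    Y ∈ lieSub (stabDual N b) := by
  obtain ⟨γ, hγ⟩ := exists_isLeftCurve Y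
  have h1 := (hγ.incl hemb).eventually_stab (V := ⊤) (fun _ _ _ => trivial) fun Y _ => hY Y
  classical
  refine ⟨fun t => if γ t ∈ stabDual N b then γ t else 1,
    hγ.isCurve.congr (h1.mono fun t ht => if_pos ?_), fun t => ?_⟩
  · exact LinearMap.ext fun Z => ht Z trivial
  · dsimp only
    split_ifs with ht
    · exact ht
    · exact one_mem _

/-- If `X` is in `𝔫` and `b` vanishes on `[X, 𝔫]`, then `X` is the velocity of a curve in `K` which
is smooth for the differentiable structure of `N`. -/
lemma Extends.mem_lieSub_stabN_of (h : Extends b a) {X : GroupLieAlgebra 𝓘(ℝ, E) G}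
    (hX : X ∈ lieSub N) (hb : ∀ Y ∈ lieSub (E := E) N, b ⁅X, Y⁆ = 0) :
    ∃ γ : ℝ → N, ∃ Y : GroupLieAlgebra 𝓘(ℝ, F) N, IsCurve γ Y ∧ inclLie Y = X ∧
      ∀ t, (γ t : G) ∈ stabN a := by
  rw [← range_inclLin hemb] at hX
  obtain ⟨Y, rfl⟩ := hX
  obtain ⟨γ, hγ⟩ := exists_isLeftCurve Y
  have h1 := (hγ.incl hemb).eventually_stab (V := lieSub N) (fun g Y hY => Ad_mem g hY) hb
  classical
  refine ⟨fun t => if (γ t : G) ∈ stabN a then γ t else 1, Y,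
    hγ.isCurve.congr (h1.mono fun t ht => if_pos ?_), rfl, fun t => ?_⟩
  · exact ⟨(γ t).2, h.mem_stabG.2 ht⟩
  · dsimp only
    split_ifs with ht
    · exact ht
    · exact one_mem _

/-- The Lie algebra of `K = N ∩ L` is `𝔨 = 𝔫 ∩ 𝔩`. -/
lemma lieSub_stabN (a : Module.Dual ℝ (lieSub (E := E) N)) :
    lieSub (E := E) (stabN a) = lieSub N ⊓ lieSub (stabG a) := by
  obtain ⟨b, h⟩ := exists_extends a
  refine le_antisymm (le_inf (lieSub_mono inf_le_left) (lieSub_mono inf_le_right)) ?_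
  rintro X ⟨hX, hX'⟩
  obtain ⟨γ, Y, hγ, rfl, hs⟩ := h.mem_lieSub_stabN_of hemb hX (h.mem_lieSub_stabG.1 hX')
  exact ⟨_, hγ.incl hemb, hs⟩

end Stabilizer

/-! ### Local factorizations of a Lie group -/

section Factorization

open Set Filter Function

variable {E : Type*} [NormedAddCommGroup E] [NormedSpace ℝ E] [FiniteDimensional ℝ E]
  {G : Type*} [TopologicalSpace G] [ChartedSpace E G] [Group G] [LieGroup 𝓘(ℝ, E) ∞ G]

/-- If the Lie algebra of `G` is the direct sum of subspaces of the Lie algebras of two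
subgroups, then the elements of `G` near `1` factor smoothly into elements of these subgroups. -/
lemma exists_factorization {H₁ H₂ : Subgroup G}
    {V₁ V₂ : Submodule ℝ (GroupLieAlgebra 𝓘(ℝ, E) G)} (hV : IsCompl V₁ V₂)
    (h₁ : V₁ ≤ lieSub H₁) (h₂ : V₂ ≤ lieSub H₂) :
    ∃ (c : (Fin (Module.finrank ℝ V₁) → ℝ) → G)
      (T : (Fin (Module.finrank ℝ V₁) → ℝ) →ₗ[ℝ] GroupLieAlgebra 𝓘(ℝ, E) G)
      (ψ : G → Fin (Module.finrank ℝ V₁) → ℝ) (χ : G → G),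
      IsPatch c T ∧ T.range = V₁ ∧ Injective T ∧ (∀ u, c u ∈ H₁) ∧
      ContMDiffAt 𝓘(ℝ, E) 𝓘(ℝ, Fin (Module.finrank ℝ V₁) → ℝ) ∞ ψ 1 ∧ ψ 1 = 0 ∧
      ContMDiffAt 𝓘(ℝ, E) 𝓘(ℝ, E) ∞ χ 1 ∧ χ 1 = 1 ∧ (∀ g, χ g ∈ H₂) ∧
      ∀ᶠ g in 𝓝 1, c (ψ g) * χ g = g := by
  obtain ⟨c, T, hc, hT, hTi, hcH⟩ := exists_isPatch h₁
  obtain ⟨d, R, hd, hR, hRi, hdH⟩ := exists_isPatch h₂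
  have hbij : Bijective (T.coprod R) := by
    constructor
    · rw [← LinearMap.ker_eq_bot, LinearMap.ker_coprod_of_disjoint_range _ _
        (by rw [hT, hR]; exact hV.disjoint), LinearMap.ker_eq_bot.2 hTi, LinearMap.ker_eq_bot.2 hRi]
      exact Submodule.prod_bot
    · rw [← LinearMap.range_eq_top, LinearMap.range_coprod, hT, hR, hV.sup_eq_top]
  obtain ⟨ψ, hψ, hψ0, h⟩ := (hc.mul hd).exists_rightInverse hbij
  have h1 : ContMDiffAt 𝓘(ℝ, E) 𝓘(ℝ, Fin (Module.finrank ℝ V₁) → ℝ) ∞ (fun g => (ψ g).1) 1 :=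
    ContMDiffAt.comp (1 : G) (g := Prod.fst) contDiff_fst.contDiffAt.contMDiffAt hψ
  have h2 : ContMDiffAt 𝓘(ℝ, E) 𝓘(ℝ, Fin (Module.finrank ℝ V₂) → ℝ) ∞ (fun g => (ψ g).2) 1 :=
    ContMDiffAt.comp (1 : G) (g := Prod.snd) contDiff_snd.contDiffAt.contMDiffAt hψ
  refine ⟨c, T, fun g => (ψ g).1, fun g => d (ψ g).2, hc, hT, hTi, hcH, h1, congrArg Prod.fst hψ0,
    ?_, ?_, fun g => hdH _, h⟩
  · exact ContMDiffAt.comp (I' := 𝓘(ℝ, Fin (Module.finrank ℝ V₂) → ℝ)) (1 : G) (g := d)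
      (f := fun g => (ψ g).2) (by rw [hψ0]; exact hd.smooth) h2
  · simp only [hψ0]
    exact hd.map_zero

/-- The derivative at the origin of the chart is the derivative along curves. -/
lemma fderiv_chartOne_symm_apply {B : Type*} [NormedAddCommGroup B] [NormedSpace ℝ B] {f : G → B}
    (hf : DifferentiableAt ℝ (f ∘ (chartOne E G).symm) (coordOne E G)) {γ : ℝ → G}
    {X : GroupLieAlgebra 𝓘(ℝ, E) G} (h : IsCurve γ X) {d : B}
    (hd : HasDerivAt (fun t => f (γ t)) d 0) :
    fderiv ℝ (f ∘ (chartOne E G).symm) (coordOne E G) X = d := by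
  have h1 : HasFDerivAt (f ∘ (chartOne E G).symm)
      (fderiv ℝ (f ∘ (chartOne E G).symm) (coordOne E G)) ((chartOne E G ∘ γ) 0) := by
    rw [comp_apply, h.map_zero]
    exact hf.hasFDerivAt
  refine (h1.comp_hasDerivAt (0 : ℝ) h.hasDerivAt).unique (hd.congr_of_eventuallyEq ?_)
  have h2 : ∀ᶠ t in 𝓝 (0 : ℝ), γ t ∈ (chartOne E G).source :=
    h.continuousAt.eventually_mem (by rw [h.map_zero]; exact extChartAt_source_mem_nhds _)
  filter_upwards [h2] with t ht
  exact congrArg f ((chartOne E G).left_inv ht)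

end Factorization

/-! ### The Lie algebra of `G` is the sum of those of `N` and `L` -/

section Transitivity

open Set Filter Function Module

variable {E : Type*} [NormedAddCommGroup E] [NormedSpace ℝ E] [FiniteDimensional ℝ E]
  {G : Type*} [TopologicalSpace G] [ChartedSpace E G] [Group G] [LieGroup 𝓘(ℝ, E) ∞ G]
  {N : Subgroup G} [N.Normal] (a : Module.Dual ℝ (lieSub (E := E) N))

/-- The orbit map `g ↦ g(a)`, in linear coordinates on `𝔫*`. -/
def orbitMap (g : G) : Fin (finrank ℝ (lieSub (E := E) N)) → ℝ :=
  (finBasis ℝ (lieSub (E := E) N)).dualBasis.equivFun (coadN N g a)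

variable {a}

lemma orbitMap_apply (g : G) (i) :
    orbitMap a g i = coadN N g a (finBasis ℝ (lieSub (E := E) N) i) := by
  rw [orbitMap, Basis.dualBasis_equivFun]

lemma orbitMap_eq_iff {g h : G} : orbitMap a g = orbitMap a h ↔ coadN N g a = coadN N h a :=
  (LinearEquiv.injective _).eq_iff

/-- Left translations act on the image of the orbit map by linear maps, which are Lipschitz and so
do not increase Hausdorff dimensions. -/
lemma exists_orbitMap_mul (g : G) : ∃ M : (Fin (finrank ℝ (lieSub (E := E) N)) → ℝ) →L[ℝ]
    (Fin (finrank ℝ (lieSub (E := E) N)) → ℝ), ∀ h, orbitMap a (g * h) = M (orbitMap a h) := by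
  let κ := (finBasis ℝ (lieSub (E := E) N)).dualBasis.equivFun
  refine ⟨(κ.toLinearMap ∘ₗ coadN N g ∘ₗ κ.symm.toLinearMap).toContinuousLinearMap, fun h => ?_⟩
  simp [orbitMap, κ]

variable {b : Module.Dual ℝ (GroupLieAlgebra 𝓘(ℝ, E) G)}

lemma Extends.contMDiff_orbitMap (h : Extends b a) :
    ContMDiff 𝓘(ℝ, E) 𝓘(ℝ, Fin (finrank ℝ (lieSub (E := E) N)) → ℝ) ∞ (orbitMap a) := by
  rw [contMDiff_pi_space]
  intro i
  have : (fun g => orbitMap a g i) =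
      adCoeff b (finBasis ℝ (lieSub (E := E) N) i) ∘ fun g => g⁻¹ := by
    ext g
    rw [orbitMap_apply, h.coadN_apply]
    rfl
  rw [this]
  exact (contMDiff_adCoeff _ _).comp (contMDiff_inv 𝓘(ℝ, E) ∞)

lemma Extends.hasDerivAt_orbitMap (h : Extends b a) {γ : ℝ → G}
    {X : GroupLieAlgebra 𝓘(ℝ, E) G} (hγ : IsCurve γ X) :
    HasDerivAt (fun t => orbitMap a (γ t))
      (fun i => -b ⁅X, (finBasis ℝ (lieSub (E := E) N) i : GroupLieAlgebra 𝓘(ℝ, E) G)⁆) 0 := by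
  rw [hasDerivAt_pi]
  intro i
  have := hγ.hasDerivAt_adCoeff_inv b (finBasis ℝ (lieSub (E := E) N) i)
  refine this.congr_of_eventuallyEq (.of_forall fun t => ?_)
  exact (orbitMap_apply _ _).trans (h.coadN_apply _ _)

lemma Extends.contDiffAt_orbitMap (h : Extends b a) :
    ContDiffAt ℝ ∞ (orbitMap a ∘ (chartOne E G).symm) (coordOne E G) := by
  rw [← contMDiffAt_iff_contDiffAt]
  exact h.contMDiff_orbitMap.contMDiffAt.comp _ contMDiffAt_chartOne_symm

/-- The kernel of the derivative of the orbit map at `1` is `𝔩`. -/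
lemma Extends.fderiv_orbitMap_eq_zero_iff (h : Extends b a) (X : GroupLieAlgebra 𝓘(ℝ, E) G) :
    fderiv ℝ (orbitMap a ∘ (chartOne E G).symm) (coordOne E G) X = 0 ↔ X ∈ lieSub (stabG a) := by
  obtain ⟨γ, hγ⟩ := exists_isCurve X
  rw [fderiv_chartOne_symm_apply (h.contDiffAt_orbitMap.differentiableAt (by simp)) hγ
    (h.hasDerivAt_orbitMap hγ), h.mem_lieSub_stabG]
  constructor
  · intro h0
    let B := finBasis ℝ (lieSub (E := E) N)
    let L : lieSub (E := E) N →ₗ[ℝ] ℝ :=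
      b ∘ₗ (LieAlgebra.ad ℝ _ X : _ →ₗ[ℝ] _) ∘ₗ (lieSub (E := E) N).subtype
    have hL : L = 0 := B.ext fun i => neg_eq_zero.1 (congrFun h0 i)
    exact fun Y hY => congrArg (fun f => f ⟨Y, hY⟩) hL
  · exact fun h0 => funext fun i => neg_eq_zero.2 (h0 _ (Subtype.prop _))

/-- The image of the orbit map has Hausdorff dimension at least `dim 𝔤/𝔩`: its projection to the
image of the derivative of the orbit map has interior points. -/
lemma Extends.le_dimH_range_orbitMap (h : Extends b a) :
    ((finrank ℝ E - finrank ℝ (lieSub (E := E) (stabG a)) : ℕ) : ENNReal) ≤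
      dimH (range (orbitMap a)) := by
  set D := fderiv ℝ (orbitMap a ∘ (chartOne E G).symm) (coordOne E G)
  have hker : finrank ℝ D.ker = finrank ℝ (lieSub (E := E) (stabG a)) := by
    have : (D.ker : Submodule ℝ E) = (show Submodule ℝ E from lieSub (E := E) (stabG a)) := by
      ext X
      exact h.fderiv_orbitMap_eq_zero_iff X
    rw [this]
    rfl
  have hrank : finrank ℝ E - finrank ℝ (lieSub (E := E) (stabG a)) = finrank ℝ D.range := by
    rw [← hker, ← LinearMap.finrank_range_add_finrank_ker D.toLinearMap, Nat.add_sub_cancel]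
  rw [hrank]
  obtain ⟨P, hP⟩ := LinearMap.exists_leftInverse_of_injective (D.range).subtype
    (Submodule.ker_subtype _)
  let P' : (Fin (finrank ℝ (lieSub (E := E) N)) → ℝ) →L[ℝ] D.range := P.toContinuousLinearMap
  have hstrict : HasStrictFDerivAt (orbitMap a ∘ (chartOne E G).symm) D (coordOne E G) :=
    h.contDiffAt_orbitMap.hasStrictFDerivAt (by simp)
  have hstrict' := P'.hasStrictFDerivAt.comp (coordOne E G) hstrict
  have hsurj : (P' ∘L D).range = ⊤ := by
    rw [LinearMap.range_eq_top]
    rintro ⟨_, X, rfl⟩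
    exact ⟨X, congrArg (fun f => f (⟨D X, X, rfl⟩ : D.range)) hP⟩
  have hnhds := hstrict'.map_nhds_eq_of_surj hsurj
  have hmem : P' '' range (orbitMap a) ∈
      𝓝 ((P' ∘ orbitMap a ∘ (chartOne E G).symm) (coordOne E G)) := by
    change _ ∈ 𝓝 (P' ((orbitMap a ∘ (chartOne E G).symm) (coordOne E G)))
    rw [← hnhds]
    refine mem_map.2 (univ_mem' fun x => ?_)
    exact ⟨_, ⟨(chartOne E G).symm x, rfl⟩, rfl⟩
  rw [← Real.dimH_of_mem_nhds hmem]
  exact P'.lipschitz.dimH_image_le _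

variable {F : Type*} [NormedAddCommGroup F] [NormedSpace ℝ F] [FiniteDimensional ℝ F]
  [ChartedSpace F N] [LieGroup 𝓘(ℝ, F) ∞ N]
  (hemb : Manifold.IsSmoothEmbedding 𝓘(ℝ, F) 𝓘(ℝ, E) ∞ ((↑) : N → G))

include hemb

variable (a F) in
/-- The Lie algebra of `K`, as a subspace of the Lie algebra of `N`. -/
def stabLieN : Submodule ℝ (GroupLieAlgebra 𝓘(ℝ, F) N) :=
  (lieSub (stabN a)).comap (inclLin E F N)

omit hemb in
lemma mem_stabLieN {Y : GroupLieAlgebra 𝓘(ℝ, F) N} :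
    Y ∈ stabLieN a F ↔ (inclLie Y : GroupLieAlgebra 𝓘(ℝ, E) G) ∈ lieSub (stabN a) := Iff.rfl

lemma stabLieN_le : stabLieN a F ≤ lieSub ((stabN a).subgroupOf N) := by
  rintro Y ⟨γ, hγ, hs⟩
  obtain ⟨Z, hZ, h⟩ := hγ.exists_codRestrict (F := F) hemb fun t => (hs t).1
  have : Z = Y := inclLie_injective hemb h
  rw [← this]
  exact ⟨_, hZ, hs⟩

lemma finrank_lieSub : finrank ℝ (lieSub (E := E) N) = finrank ℝ F := by
  rw [← range_inclLin hemb, LinearMap.finrank_range_of_inj (inclLie_injective hemb)]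
  rfl

lemma finrank_stabLieN :
    finrank ℝ (stabLieN a F) = finrank ℝ (lieSub (E := E) (stabN a)) := by
  have h1 : (stabLieN a F).map (inclLin E F N) = lieSub (stabN a) := by
    rw [stabLieN, Submodule.map_comap_eq, range_inclLin hemb]
    exact inf_eq_right.2 (lieSub_mono inf_le_left)
  rw [← h1]
  exact (Submodule.equivMapOfInjective _ (inclLie_injective hemb) _).finrank_eq

/-- The orbit `N(a)` has Hausdorff dimension at most `dim 𝔫/𝔨`: it is a countable union of
linear images of a smooth patch of this dimension. -/
lemma dimH_orbitMap_le [SecondCountableTopology G] :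
    dimH (range fun n : N => orbitMap a (n : G)) ≤
      ((finrank ℝ F - finrank ℝ (lieSub (E := E) (stabN a)) : ℕ) : ENNReal) := by
  obtain ⟨b, hb⟩ := exists_extends a
  have : IsTopologicalGroup N := topologicalGroup_of_lieGroup 𝓘(ℝ, F) ∞
  have : SecondCountableTopology N := TopologicalSpace.Subtype.secondCountableTopology _
  obtain ⟨S, hS⟩ := (stabLieN a F).exists_isCompl
  obtain ⟨c, T, ψ, χ, hc, -, -, -, hψ, hψ0, -, -, hχ, hfac⟩ := exists_factorization hS.symm
    (H₁ := ⊤) (fun X _ => (exists_isCurve X).imp fun γ h => ⟨h, fun _ => trivial⟩)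
    (stabLieN_le hemb)
  have hr : finrank ℝ F - finrank ℝ (lieSub (E := E) (stabN a)) = finrank ℝ S := by
    rw [← finrank_stabLieN hemb]
    have : finrank ℝ (stabLieN a F) + finrank ℝ S = finrank ℝ (GroupLieAlgebra 𝓘(ℝ, F) N) :=
      Submodule.finrank_add_eq_of_isCompl hS
    change _ = finrank ℝ F at this
    omega
  rw [hr]
  set f : (Fin (finrank ℝ S) → ℝ) → _ := fun u => orbitMap a (c u : G) with hf
  have hfs : ContDiffAt ℝ 1 f 0 := by
    have h1 : ContMDiffAt 𝓘(ℝ, Fin (finrank ℝ S) → ℝ) 𝓘(ℝ, E) ∞ (fun u => (c u : G)) 0 :=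
      hemb.contMDiff.contMDiffAt.comp _ hc.smooth
    exact ((hb.contMDiff_orbitMap.contMDiffAt.comp _ h1).contDiffAt).of_le (by simp)
  obtain ⟨ε, hε, hball⟩ := Metric.eventually_nhds_iff_ball.1 (hfs.eventually (by simp))
  have hdim : dimH (f '' Metric.ball 0 ε) ≤ finrank ℝ S := by
    refine ((ContDiffOn.dimH_image_le (s := Metric.ball 0 ε)
      (fun u hu => (hball u hu).contDiffWithinAt) (convex_ball 0 ε) Subset.rfl).trans
      (dimH_mono (subset_univ _))).trans ?_
    rw [Real.dimH_univ_eq_finrank]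
    simp
  -- near `1`, the orbit map of `N` takes its values in the image of the patch
  have hV : ∀ᶠ n : N in 𝓝 1, orbitMap a (n : G) ∈ f '' Metric.ball 0 ε := by
    have h1 : ∀ᶠ n in 𝓝 (1 : N), ψ n ∈ Metric.ball 0 ε :=
      hψ.continuousAt.eventually_mem (by rw [hψ0]; exact Metric.ball_mem_nhds 0 hε)
    filter_upwards [h1, hfac] with n hn hn'
    refine ⟨ψ n, hn, ?_⟩
    rw [hf, orbitMap_eq_iff]
    have h2 : coadN N ((χ n : N) : G) a = a := (hχ n).2
    conv_rhs => rw [← hn', Subgroup.coe_mul, _root_.map_mul, Module.End.mul_apply, h2]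
  have hcov (m : N) : {n : N | orbitMap a ((m⁻¹ * n : N) : G) ∈ f '' Metric.ball 0 ε} ∈ 𝓝 m := by
    have h1 : ContinuousAt (fun n : N => m⁻¹ * n) m := by fun_prop
    rw [ContinuousAt, inv_mul_cancel] at h1
    exact h1.eventually hV
  obtain ⟨s, hs, hs'⟩ := TopologicalSpace.countable_cover_nhds hcov
  choose M hM using fun m : N => exists_orbitMap_mul (a := a) (m : G)
  have hsub : (range fun n : N => orbitMap a (n : G)) ⊆
      ⋃ m ∈ s, M m '' (f '' Metric.ball 0 ε) := by
    rintro _ ⟨n, rfl⟩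
    obtain ⟨m, hm, hn⟩ : ∃ m ∈ s, orbitMap a ((m⁻¹ * n : N) : G) ∈ f '' Metric.ball 0 ε := by
      have := hs' ▸ mem_univ n
      simpa using this
    refine mem_iUnion₂.2 ⟨m, hm, _, hn, ?_⟩
    rw [← hM]
    simp
  refine (dimH_mono hsub).trans ?_
  rw [dimH_bUnion hs]
  exact iSup₂_le fun m _ => ((M m).lipschitz.dimH_image_le _).trans hdim

/-- If the orbit `N(a)` is `G`-invariant, then `𝔤 = 𝔫 + 𝔩`: the orbit maps of `G` and `N` have the
same image, whose Hausdorff dimension is at least `dim 𝔤/𝔩` and at most `dim 𝔫/𝔨`. -/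
theorem lieSub_sup_stabG [SecondCountableTopology G]
    (hU : ∀ g : G, ∃ n : N, coadN N g a = coadN N (n : G) a) :
    lieSub (E := E) N ⊔ lieSub (stabG a) = ⊤ := by
  obtain ⟨b, hb⟩ := exists_extends a
  have h1 := hb.le_dimH_range_orbitMap
  have h2 : range (orbitMap a) = range fun n : N => orbitMap a (n : G) := by
    refine Subset.antisymm ?_ ?_
    · rintro _ ⟨g, rfl⟩
      obtain ⟨n, hn⟩ := hU g
      exact ⟨n, (orbitMap_eq_iff.2 hn).symm⟩
    · rintro _ ⟨n, rfl⟩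
      exact ⟨_, rfl⟩
  rw [h2] at h1
  have h3 := Nat.cast_le.1 (h1.trans (dimH_orbitMap_le hemb))
  have h4 := Submodule.finrank_sup_add_finrank_inf_eq (lieSub (E := E) N) (lieSub (stabG a))
  rw [← lieSub_stabN hemb, finrank_lieSub hemb] at h4
  have h5 : finrank ℝ (lieSub (E := E) (stabN a)) ≤ finrank ℝ F := by
    rw [← finrank_lieSub hemb]
    exact Submodule.finrank_mono (lieSub_mono inf_le_left)
  have h6 : finrank ℝ (lieSub (E := E) (stabG a)) ≤ finrank ℝ E :=
    Submodule.finrank_le (lieSub (E := E) (stabG a))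
  refine Submodule.eq_top_of_finrank_eq (le_antisymm (Submodule.finrank_le _) ?_)
  change finrank ℝ E ≤ _
  omega

end Transitivity

/-! ### Splitting `G = N L`, and the identity component of `K` -/

section Splitting

open Set Filter Function Module

variable {E : Type*} [NormedAddCommGroup E] [NormedSpace ℝ E] [FiniteDimensional ℝ E]
  {G : Type*} [TopologicalSpace G] [ChartedSpace E G] [Group G] [LieGroup 𝓘(ℝ, E) ∞ G]
  {N : Subgroup G} [N.Normal] {a : Module.Dual ℝ (lieSub (E := E) N)}
  {F : Type*} [NormedAddCommGroup F] [NormedSpace ℝ F] [FiniteDimensional ℝ F]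
  [ChartedSpace F N] [LieGroup 𝓘(ℝ, F) ∞ N]

lemma mem_stabG {g : G} : g ∈ stabG a ↔ coadN N g a = a := Iff.rfl

lemma inv_mul_mem_stabG {g h : G} (hgh : coadN N h a = coadN N g a) : g⁻¹ * h ∈ stabG a := by
  rw [mem_stabG, _root_.map_mul, Module.End.mul_apply, hgh]
  exact (coadN N).inv_self_apply g a

variable (hemb : Manifold.IsSmoothEmbedding 𝓘(ℝ, F) 𝓘(ℝ, E) ∞ ((↑) : N → G))

include hemb

/-- If the orbit `N(a)` is `G`-invariant, then `G = N L`, and the factor in `N` can be chosen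
to be smooth near `1`. -/
theorem exists_splitting [SecondCountableTopology G]
    (hU : ∀ g : G, ∃ n : N, coadN N g a = coadN N (n : G) a) :
    ∃ ν : G → N, ContMDiffAt 𝓘(ℝ, E) 𝓘(ℝ, F) ∞ ν 1 ∧ ν 1 = 1 ∧
      ∀ g, (ν g : G)⁻¹ * g ∈ stabG a := by
  obtain ⟨S, hS⟩ := (stabLieN a F).exists_isCompl
  have hV : IsCompl (S.map (inclLin E F N)) (lieSub (stabG a)) := by
    constructor
    · rw [Submodule.disjoint_def]
      rintro _ ⟨s, hs, rfl⟩ h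
      have h1 : s ∈ stabLieN a F := by
        rw [mem_stabLieN, lieSub_stabN hemb]
        exact ⟨inclLie_mem hemb s, h⟩
      have h2 : s = 0 := Submodule.disjoint_def.1 hS.disjoint s h1 hs
      rw [h2, _root_.map_zero]
    · rw [codisjoint_iff, eq_top_iff, ← lieSub_sup_stabG hemb hU]
      refine sup_le ?_ le_sup_right
      rw [← range_inclLin hemb, LinearMap.range_eq_map, ← hS.sup_eq_top, Submodule.map_sup]
      refine sup_le (le_sup_of_le_right ?_) le_sup_left
      rintro _ ⟨Y, hY, rfl⟩
      exact lieSub_mono inf_le_right hY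
  have hS' : S.map (inclLin E F N) ≤ lieSub N := by
    rw [← range_inclLin hemb]
    exact LinearMap.map_le_range
  obtain ⟨c, T, ψ, χ, hc, -, -, hcN, hψ, hψ0, -, -, hχ, hfac⟩ :=
    exists_factorization hV hS' le_rfl
  choose n hn using hU
  classical
  let ν : G → N := fun g => if (c (ψ g))⁻¹ * g ∈ stabG a then ⟨c (ψ g), hcN _⟩ else n g
  have hν : ∀ᶠ g in 𝓝 1, ν g = ⟨c (ψ g), hcN _⟩ := by
    filter_upwards [hfac] with g hg
    have h1 : (c (ψ g))⁻¹ * g = χ g := inv_mul_eq_iff_eq_mul.2 hg.symm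
    exact if_pos (h1 ▸ hχ g)
  refine ⟨ν, ?_, ?_, fun g => ?_⟩
  · refine ContMDiffAt.congr_of_eventuallyEq (contMDiffAt_of_incl hemb ?_) hν
    exact ContMDiffAt.comp (1 : G) (g := c) (f := ψ) (by rw [hψ0]; exact hc.smooth) hψ
  · rw [hν.self_of_nhds]
    refine Subtype.ext ?_
    change c (ψ 1) = 1
    rw [hψ0, hc.map_zero]
  · dsimp only [ν]
    split_ifs with hg
    · exact hg
    · exact inv_mul_mem_stabG (hn g)

variable {b : Module.Dual ℝ (GroupLieAlgebra 𝓘(ℝ, E) G)}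

omit hemb in
lemma Extends.mem_lieSub_stabG_of_hasDerivAt (h : Extends b a) {γ : ℝ → G}
    {X : GroupLieAlgebra 𝓘(ℝ, E) G} (hγ : IsCurve γ X)
    (hd : HasDerivAt (fun t => orbitMap a (γ t)) 0 0) : X ∈ lieSub (stabG a) := by
  rw [← h.fderiv_orbitMap_eq_zero_iff]
  exact fderiv_chartOne_symm_apply (h.contDiffAt_orbitMap.differentiableAt (by simp)) hγ hd

/-- Linear forms which extend `a` vanish on `[𝔨, 𝔤]`. -/
lemma Extends.lie_stabN_eq_zero (h : Extends b a)
    (hsup : lieSub (E := E) N ⊔ lieSub (stabG a) = ⊤) {W : GroupLieAlgebra 𝓘(ℝ, E) G}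
    (hW : W ∈ lieSub (stabN a)) (Z : GroupLieAlgebra 𝓘(ℝ, E) G) : b ⁅W, Z⁆ = 0 := by
  rw [lieSub_stabN hemb] at hW
  obtain ⟨Y, hY, X, hX, rfl⟩ := Submodule.mem_sup.1 (hsup ▸ Submodule.mem_top : Z ∈ _)
  have h1 : ⁅W, Y + X⁆ = ⁅W, Y⁆ - ⁅X, W⁆ := by
    rw [lie_add, ← lie_skew W X, sub_eq_add_neg]
  have h2 := h.mem_lieSub_stabG.1 hW.2 Y hY
  have h3 := h.mem_lieSub_stabG.1 hX W hW.1
  rw [h1]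
  exact (_root_.map_sub b _ _).trans (by rw [h2, h3, sub_zero])

/-- Near `1`, the elements of `N` which fix `a` fix every linear form `b` which extends `a`: if
`S` is a complement of `𝔨` in `𝔫`, then `N` is locally the product of a patch tangent to `S`,
which meets the stabilizer of `a` only in `1`, and of the stabilizer of `b`. -/
lemma Extends.eventually_mem_stabDual (h : Extends b a)
    (hsup : lieSub (E := E) N ⊔ lieSub (stabG a) = ⊤) :
    ∀ᶠ n : N in 𝓝 1, (n : G) ∈ stabN a → n ∈ stabDual N b := by
  obtain ⟨S, hS⟩ := (stabLieN a F).exists_isCompl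
  have hle : stabLieN a F ≤ lieSub (stabDual N b) := fun Y hY =>
    mem_lieSub_stabDual hemb fun Z => h.lie_stabN_eq_zero hemb hsup hY Z
  obtain ⟨c, T, ψ, χ, hc, hT, hTi, -, hψ, hψ0, -, -, hχ, hfac⟩ :=
    exists_factorization hS.symm (H₁ := ⊤)
      (fun X _ => (exists_isCurve X).imp fun γ h => ⟨h, fun _ => trivial⟩) hle
  let f : (Fin (finrank ℝ S) → ℝ) → _ := fun u => orbitMap a (c u : G)
  have hcG : ContMDiffAt 𝓘(ℝ, Fin (finrank ℝ S) → ℝ) 𝓘(ℝ, E) ∞ (fun u => (c u : G)) 0 :=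
    hemb.contMDiff.contMDiffAt.comp _ hc.smooth
  have hfs : DifferentiableAt ℝ f 0 :=
    (h.contMDiff_orbitMap.contMDiffAt.comp _ hcG).contDiffAt.differentiableAt (by simp)
  have hker : (fderiv ℝ f 0).toLinearMap.ker = ⊥ := by
    rw [LinearMap.ker_eq_bot']
    intro u hu
    have h1 : HasDerivAt (fun t : ℝ => f (t • u)) (fderiv ℝ f 0 u) 0 := by
      have h2 : HasDerivAt (fun t : ℝ => t • u) u 0 := by
        simpa using (hasDerivAt_id (0 : ℝ)).smul_const u
      have h3 : HasFDerivAt f (fderiv ℝ f 0) ((0 : ℝ) • u) := by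
        rw [zero_smul]
        exact hfs.hasFDerivAt
      exact h3.comp_hasDerivAt (0 : ℝ) h2
    have hu' : fderiv ℝ f 0 u = 0 := hu
    rw [hu'] at h1
    have h2 : T u ∈ stabLieN a F := by
      rw [mem_stabLieN, lieSub_stabN hemb]
      exact ⟨inclLie_mem hemb _, h.mem_lieSub_stabG_of_hasDerivAt ((hc.isCurve u).incl hemb) h1⟩
    have h3 : T u ∈ S := hT.le (LinearMap.mem_range_self T u)
    exact hTi ((Submodule.disjoint_def.1 hS.disjoint _ h2 h3).trans (_root_.map_zero T).symm)
  obtain ⟨C, -, hC⟩ := LinearMap.exists_antilipschitzWith _ hker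
  have hne : ∀ᶠ u in 𝓝 (0 : Fin (finrank ℝ S) → ℝ), u ≠ 0 → f u ≠ orbitMap a 1 :=
    eventually_nhdsWithin_iff.1 (hfs.hasFDerivAt.eventually_ne ⟨C, hC⟩)
  have hne' := hψ.continuousAt.eventually (by rw [hψ0]; exact hne)
  filter_upwards [hfac, hne'] with n hn hn' hnK
  have h1 : (c (ψ n) : G) ∈ stabG a := by
    have h2 : (c (ψ n) : G) = n * (χ n : G)⁻¹ :=
      eq_mul_inv_of_mul_eq (congrArg Subtype.val hn)
    rw [h2]
    exact mul_mem hnK.2 (inv_mem (h.mem_stabN_of_mem_stabDual (hχ n)).2)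
  have h3 : ψ n = 0 := by
    by_contra h0
    refine hn' h0 (orbitMap_eq_iff.2 ?_)
    rw [Mackey.mem_stabG.1 h1, _root_.map_one, Module.End.one_apply]
  rw [h3, hc.map_zero, one_mul] at hn
  exact hn ▸ hχ n

/-- The linear forms which extend `a` are fixed by the identity component of `K`. -/
theorem Extends.coadG_of_mem_stabNo (h : Extends b a)
    (hsup : lieSub (E := E) N ⊔ lieSub (stabG a) = ⊤) {k : G} (hk : k ∈ stabNo a) :
    coadG k b = b := by
  have : IsTopologicalGroup G := topologicalGroup_of_lieGroup 𝓘(ℝ, E) ∞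
  obtain ⟨k, hk, rfl⟩ := hk
  let j : stabN a →* N := Subgroup.inclusion inf_le_left
  have hj : Continuous j := continuous_subtype_val.subtype_mk _
  have hopen : IsOpen (((stabDual N b).comap j : Subgroup (stabN a)) : Set (stabN a)) := by
    refine Subgroup.isOpen_of_mem_nhds _ (g := 1) ?_
    have h1 : ContinuousAt j 1 := hj.continuousAt
    rw [ContinuousAt, _root_.map_one] at h1
    filter_upwards [h1.eventually (h.eventually_mem_stabDual hemb hsup)] with x hx
    exact hx x.2
  have hclopen : IsClopen (((stabDual N b).comap j : Subgroup (stabN a)) : Set (stabN a)) :=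
    ⟨Subgroup.isClosed_of_isOpen _ hopen, hopen⟩
  exact hclopen.connectedComponent_subset (one_mem _) hk

end Splitting

/-! ### The derived cocycle and the central extension -/

section CentralExtension

open Function Module

/-- The coboundary of a linear form. -/
def coboundary {q : Type*} [LieRing q] [LieAlgebra ℝ q] (h : Dual ℝ q) : Z2 q :=
  ⟨(LieModule.toEnd ℝ q q : q →ₗ[ℝ] End ℝ q).compr₂ h, by
    refine ⟨fun x => by simp, fun x y z => ?_⟩
    simp only [LinearMap.compr₂_apply, LieHom.coe_toLinearMap, LieModule.toEnd_apply_apply]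
    rw [← map_add, ← map_add, ← lie_skew ⁅x, y⁆ z, ← lie_skew ⁅y, z⁆ x, ← lie_skew ⁅z, x⁆ y,
      ← neg_add, ← neg_add, add_rotate, lie_jacobi, neg_zero, map_zero]⟩

lemma H2.mk_eq_of_sub {q : Type*} [LieRing q] [LieAlgebra ℝ q] {f f' : Z2 q} (h : Dual ℝ q)
    (hf : ∀ x y, f.1 x y - f'.1 x y = h ⁅x, y⁆) : H2.mk f = H2.mk f' :=
  (Submodule.Quotient.eq _).2 ⟨h, hf⟩

/-- A homomorphism of Lie algebras which maps an ideal into an ideal induces a homomorphism of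
the quotients. -/
def lieQuotMap {L L' : Type*} [LieRing L] [LieAlgebra ℝ L] [LieRing L'] [LieAlgebra ℝ L']
    (I : LieIdeal ℝ L) (J : LieIdeal ℝ L') (f : L →ₗ⁅ℝ⁆ L') (h : ∀ x ∈ I, f x ∈ J) :
    (L ⧸ I) →ₗ⁅ℝ⁆ (L' ⧸ J) where
  __ := Submodule.mapQ I.toSubmodule J.toSubmodule (f : L →ₗ[ℝ] L') h
  map_lie' := by
    intro x y
    obtain ⟨x, rfl⟩ := LieSubmodule.Quotient.surjective_mk' I x
    obtain ⟨y, rfl⟩ := LieSubmodule.Quotient.surjective_mk' I y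
    change LieSubmodule.Quotient.mk (f ⁅x, y⁆) = ⁅LieSubmodule.Quotient.mk (f x),
      LieSubmodule.Quotient.mk (f y)⁆
    rw [LieHom.map_lie, LieSubmodule.Quotient.mk_bracket]

variable {g : Type*} [LieRing g] [LieAlgebra ℝ g] {n : LieIdeal ℝ g} {l : LieSubalgebra ℝ g}

lemma exists_linearSection (hsup : n.toSubmodule ⊔ l.toSubmodule = ⊤) :
    ∃ s : (g ⧸ n) →ₗ[ℝ] l, ∀ x, (LieSubmodule.Quotient.mk (s x : g) : g ⧸ n) = x := by
  let π : l →ₗ[ℝ] (g ⧸ n) := n.toSubmodule.mkQ ∘ₗ l.toSubmodule.subtype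
  have hπ : Surjective π := by
    intro x
    obtain ⟨Z, rfl⟩ := LieSubmodule.Quotient.surjective_mk' n x
    obtain ⟨Y, hY, X, hX, rfl⟩ := Submodule.mem_sup.1 (hsup ▸ Submodule.mem_top : Z ∈ _)
    refine ⟨⟨X, hX⟩, ?_⟩
    refine (Submodule.Quotient.eq _).2 ?_
    change X - (Y + X) ∈ n.toSubmodule
    rw [sub_add_cancel_right]
    exact neg_mem hY
  obtain ⟨s, hs⟩ := π.exists_rightInverse_of_surjective (LinearMap.range_eq_top.2 hπ)
  exact ⟨s, fun x => congrArg (fun f => f x) hs⟩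

variable {b : Dual ℝ g}

/-- A linear form on `𝔤 = 𝔫 + 𝔩` which vanishes on `[𝔩, 𝔫]` vanishes on `[𝔫 ∩ 𝔩, 𝔤]`. -/
lemma lie_inf_eq_zero (hsup : n.toSubmodule ⊔ l.toSubmodule = ⊤)
    (hb : ∀ X ∈ l, ∀ Y ∈ n, b ⁅X, Y⁆ = 0) {W : g} (hWn : W ∈ n) (hWl : W ∈ l) (Z : g) :
    b ⁅W, Z⁆ = 0 := by
  obtain ⟨Y, hY, X, hX, rfl⟩ := Submodule.mem_sup.1 (hsup ▸ Submodule.mem_top : Z ∈ _)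
  rw [lie_add, map_add, hb W hWl Y hY, ← lie_skew, map_neg, hb X hX W hWn, neg_zero, add_zero]

/-- The `2`-cocycle of `𝔤/𝔫 = 𝔩/𝔨` given on `𝔩` by `(X, Y) ↦ b([X, Y])`. -/
lemma exists_derivedCocycle (hsup : n.toSubmodule ⊔ l.toSubmodule = ⊤)
    (hb : ∀ X ∈ l, ∀ Y ∈ n, b ⁅X, Y⁆ = 0) :
    ∃ f : Z2 (g ⧸ n), ∀ X ∈ l, ∀ Y : g,
      f.1 (LieSubmodule.Quotient.mk X) (LieSubmodule.Quotient.mk Y) = b ⁅X, Y⁆ := by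
  obtain ⟨s, hs⟩ := exists_linearSection hsup
  let s' : (g ⧸ n) →ₗ[ℝ] g := l.toSubmodule.subtype ∘ₗ s
  have hsl (x) : s' x ∈ l := (s x).2
  let f : (g ⧸ n) →ₗ[ℝ] (g ⧸ n) →ₗ[ℝ] ℝ :=
    ((LieModule.toEnd ℝ g g : g →ₗ[ℝ] End ℝ g).compr₂ b).compl₁₂ s' s'
  have hf (x y) : f x y = b ⁅s' x, s' y⁆ := rfl
  have key {X : g} (hX : X ∈ l) (z) : f (LieSubmodule.Quotient.mk X) z = b ⁅X, s' z⁆ := by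
    have h1 : s' (LieSubmodule.Quotient.mk X) - X ∈ n :=
      (Submodule.Quotient.eq _).1 (hs (LieSubmodule.Quotient.mk X))
    have h2 := lie_inf_eq_zero hsup hb h1 (sub_mem (hsl _) hX) (s' z)
    rwa [sub_lie, map_sub, sub_eq_zero] at h2
  refine ⟨⟨f, fun x => by simp [hf], fun x y z => ?_⟩, fun X hX Y => ?_⟩
  · have hxy (x y) : f ⁅x, y⁆ = f (LieSubmodule.Quotient.mk ⁅s' x, s' y⁆) := by
      rw [LieSubmodule.Quotient.mk_bracket]
      exact congrArg₂ (fun u v => f ⁅u, v⁆) (hs x).symm (hs y).symm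
    rw [hxy, hxy, hxy, key (l.lie_mem (hsl _) (hsl _)), key (l.lie_mem (hsl _) (hsl _)),
      key (l.lie_mem (hsl _) (hsl _))]
    exact (coboundary b).2.2 (s' x) (s' y) (s' z)
  · refine (key hX _).trans ?_
    have h1 : s' (LieSubmodule.Quotient.mk Y) - Y ∈ n :=
      (Submodule.Quotient.eq _).1 (hs (LieSubmodule.Quotient.mk Y))
    have h2 := hb X hX _ h1
    rwa [lie_sub, map_sub, sub_eq_zero] at h2

/-- The class of the cocycle given by `b` depends only on the restriction of `b` to `𝔫`. -/
lemma H2.mk_derivedCocycle_eq {b' : Dual ℝ g} (hsup : n.toSubmodule ⊔ l.toSubmodule = ⊤)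
    (hbb' : ∀ Y ∈ n, b Y = b' Y) {f f' : Z2 (g ⧸ n)}
    (hf : ∀ X ∈ l, ∀ Y : g,
      f.1 (LieSubmodule.Quotient.mk X) (LieSubmodule.Quotient.mk Y) = b ⁅X, Y⁆)
    (hf' : ∀ X ∈ l, ∀ Y : g,
      f'.1 (LieSubmodule.Quotient.mk X) (LieSubmodule.Quotient.mk Y) = b' ⁅X, Y⁆) :
    H2.mk f = H2.mk f' := by
  obtain ⟨s, hs⟩ := exists_linearSection hsup
  refine H2.mk_eq_of_sub (n.toSubmodule.liftQ (b - b') fun Y hY => ?_) fun x y => ?_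
  · exact sub_eq_zero.2 (hbb' Y hY)
  · rw [← hs x, ← hs y, hf _ (s x).2, hf' _ (s x).2, ← LieSubmodule.Quotient.mk_bracket]
    rfl

/-- If `b` does not vanish on `𝔨 = 𝔫 ∩ 𝔩` and `𝔧` is its kernel in `𝔨`, then `𝔩/𝔧` is a central
extension of `𝔩/𝔨 = 𝔤/𝔫`, whose class is that of the cocycle given by `b`. -/
theorem exists_centralExtension (hsup : n.toSubmodule ⊔ l.toSubmodule = ⊤)
    (hb : ∀ X ∈ l, ∀ Y ∈ n, b ⁅X, Y⁆ = 0) {k j : LieIdeal ℝ l}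
    (hk : ∀ X : l, X ∈ k ↔ (X : g) ∈ n) (hj : ∀ X : l, X ∈ j ↔ X ∈ k ∧ b X = 0)
    (hne : ∃ X : l, X ∈ k ∧ b X ≠ 0) {f : Z2 (g ⧸ n)}
    (hf : ∀ X ∈ l, ∀ Y : g,
      f.1 (LieSubmodule.Quotient.mk X) (LieSubmodule.Quotient.mk Y) = b ⁅X, Y⁆) :
    ∃ (e : (l ⧸ k) ≃ₗ⁅ℝ⁆ (g ⧸ n)) (i : (k ⧸ j.comap k.incl) →ₗ⁅ℝ⁆ (l ⧸ j))
      (p : (l ⧸ j) →ₗ⁅ℝ⁆ (l ⧸ k)) (ψ : (k ⧸ j.comap k.incl) ≃ₗ[ℝ] ℝ),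
      (∀ X : l, e (LieSubmodule.Quotient.mk X) = LieSubmodule.Quotient.mk (X : g)) ∧
      (∀ X : k, i (LieSubmodule.Quotient.mk X) = LieSubmodule.Quotient.mk (X : l)) ∧
      (∀ X : l, p (LieSubmodule.Quotient.mk X) = LieSubmodule.Quotient.mk X) ∧
      (∀ X : k, ψ (LieSubmodule.Quotient.mk X) = b (X : l)) ∧
      LieAlgebra.IsExtension i p ∧ (∀ (z : k ⧸ j.comap k.incl) (y : l ⧸ j), ⁅i z, y⁆ = 0) ∧
      IsExtensionClass i (e.toLieHom.comp p) ψ (H2.mk f) := by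
  obtain ⟨s, hs⟩ := exists_linearSection hsup
  let e₀ := lieQuotMap k n l.incl fun X hX => (hk X).1 hX
  have he₀ : Bijective e₀ := by
    constructor
    · refine (injective_iff_map_eq_zero e₀).2 fun x hx => ?_
      obtain ⟨X, rfl⟩ := LieSubmodule.Quotient.surjective_mk' k x
      exact (LieSubmodule.Quotient.mk_eq_zero' ..).2
        ((hk X).2 ((LieSubmodule.Quotient.mk_eq_zero' ..).1 hx))
    · exact fun x => ⟨LieSubmodule.Quotient.mk (s x), hs x⟩
  let i := lieQuotMap (j.comap k.incl) j k.incl fun X hX => hX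
  let p := lieQuotMap j k (1 : l →ₗ⁅ℝ⁆ l) fun X hX => ((hj X).1 hX).1
  let ψ₀ : (k ⧸ j.comap k.incl) →ₗ[ℝ] ℝ := (j.comap k.incl).toSubmodule.liftQ
    (b ∘ₗ l.toSubmodule.subtype ∘ₗ k.toSubmodule.subtype) fun X hX => ((hj X).1 hX).2
  have hψ₀ : Bijective ψ₀ := by
    constructor
    · refine (injective_iff_map_eq_zero ψ₀).2 fun x hx => ?_
      obtain ⟨X, rfl⟩ := LieSubmodule.Quotient.surjective_mk' _ x
      exact (LieSubmodule.Quotient.mk_eq_zero' ..).2 ((hj X).2 ⟨X.2, hx⟩)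
    · obtain ⟨X, hX, hX'⟩ := hne
      intro t
      refine ⟨LieSubmodule.Quotient.mk ((t / b X) • ⟨X, hX⟩), ?_⟩
      change b ((t / b X) • (X : g)) = t
      rw [map_smul, smul_eq_mul, div_mul_cancel₀ _ hX']
  let ψ := LinearEquiv.ofBijective ψ₀ hψ₀
  refine ⟨LieEquiv.ofBijective e₀ he₀, i, p, ψ, fun _ => rfl, fun _ => rfl, fun _ => rfl,
    fun _ => rfl, ?_, ?_, ?_⟩
  · refine ⟨(LieHom.ker_eq_bot i).2 ?_, (LieHom.range_eq_top p).2 ?_,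
      (LieHom.range_eq_ker_iff i p).2 fun x => ?_⟩
    · refine (injective_iff_map_eq_zero i).2 fun x hx => ?_
      obtain ⟨X, rfl⟩ := LieSubmodule.Quotient.surjective_mk' _ x
      have hx' : (LieSubmodule.Quotient.mk (X : l) : l ⧸ j) = 0 := hx
      have hX : (X : l) ∈ j := (LieSubmodule.Quotient.mk_eq_zero' ..).1 hx'
      exact (LieSubmodule.Quotient.mk_eq_zero' ..).2 hX
    · intro x
      obtain ⟨X, rfl⟩ := LieSubmodule.Quotient.surjective_mk' k x
      exact ⟨LieSubmodule.Quotient.mk X, rfl⟩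
    · obtain ⟨X, rfl⟩ := LieSubmodule.Quotient.surjective_mk' j x
      constructor
      · intro hx
        exact ⟨LieSubmodule.Quotient.mk ⟨X, (LieSubmodule.Quotient.mk_eq_zero' ..).1 hx⟩, rfl⟩
      · rintro ⟨z, hz⟩
        obtain ⟨Z, rfl⟩ := LieSubmodule.Quotient.surjective_mk' _ z
        rw [← hz]
        exact (LieSubmodule.Quotient.mk_eq_zero' ..).2 Z.2
  · intro z y
    obtain ⟨Z, rfl⟩ := LieSubmodule.Quotient.surjective_mk' _ z
    obtain ⟨Y, rfl⟩ := LieSubmodule.Quotient.surjective_mk' j y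
    have hmem : ⁅(Z : l), Y⁆ ∈ j := (hj _).2 ⟨lie_mem_left ℝ l k _ _ Z.2,
      lie_inf_eq_zero hsup hb ((hk Z).1 Z.2) (Z : l).2 Y⟩
    exact (LieSubmodule.Quotient.mk_bracket (I := j) (Z : l) Y).symm.trans
      ((LieSubmodule.Quotient.mk_eq_zero' ..).2 hmem)
  · refine ⟨j.toSubmodule.mkQ ∘ₗ s, fun x => hs x,
      f - coboundary (b ∘ₗ l.toSubmodule.subtype ∘ₗ s), fun x y => ?_, ?_⟩
    · have hmem : ⁅s x, s y⁆ - s ⁅x, y⁆ ∈ k := by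
        rw [hk]
        refine (Submodule.Quotient.eq n.toSubmodule).1 ?_
        refine (LieSubmodule.Quotient.mk_bracket (I := n) (s x : g) (s y)).trans ?_
        exact (congrArg₂ (fun u v => ⁅u, v⁆) (hs x) (hs y)).trans (hs _).symm
      have h1 : (f - coboundary (b ∘ₗ l.toSubmodule.subtype ∘ₗ s)).1 x y =
          ψ (LieSubmodule.Quotient.mk ⟨_, hmem⟩) := by
        have h2 : f.1 x y = b ⁅(s x : g), (s y : g)⁆ := by
          rw [← hf _ (s x).2, hs, hs]
        change f.1 x y - b (s ⁅x, y⁆) = b (⁅(s x : g), (s y : g)⁆ - s ⁅x, y⁆)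
        rw [h2, map_sub]
      rw [h1, ψ.symm_apply_apply]
      rfl
    · refine H2.mk_eq_of_sub (-(b ∘ₗ l.toSubmodule.subtype ∘ₗ s)) fun x y => ?_
      change (f.1 x y - _) - f.1 x y = -_
      rw [sub_sub_cancel_left]
      rfl

end CentralExtension

/-! ### The group `G̃/Ñ` -/

section Cohomology

open Function Module groupCohomology

variable {E : Type*} [NormedAddCommGroup E] [NormedSpace ℝ E] [FiniteDimensional ℝ E]
  {G : Type*} [TopologicalSpace G] [ChartedSpace E G] [Group G] [LieGroup 𝓘(ℝ, E) ∞ G]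
  {N : Subgroup G} [N.Normal] {a : Module.Dual ℝ (lieSub (E := E) N)}

lemma CovQuot.exists_mk (q : CovQuot a) : ∃ n l, CovQuot.mk a n l = q := by
  obtain ⟨x, rfl⟩ := QuotientGroup.mk_surjective q
  obtain ⟨⟨n, l⟩, rfl⟩ := QuotientGroup.mk_surjective x
  exact ⟨n, l, rfl⟩

/-- The kernel of the surjection `L → G̃/Ñ` is contained in `K°`. -/
lemma CovQuot.inv_mul_mem_of_mk_eq {n n' : N} {l l' : stabG a}
    (h : CovQuot.mk a n l = CovQuot.mk a n' l') : ((l⁻¹ * l' : stabG a) : G) ∈ stabNo a := by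
  obtain ⟨_, ⟨m, rfl⟩, hm⟩ := QuotientGroup.eq.1 h
  have h1 := (QuotientGroup.eq (s := antidiag a)).1 (hm : (QuotientGroup.mk _ : Cov a) =
    QuotientGroup.mk ((⟨n, l⟩ : SemiNL a)⁻¹ * ⟨n', l'⟩))
  have h2 := h1.2
  simpa using h2

lemma CovQuot.mk_mul_mk (n n' : N) (l l' : stabG a) :
    CovQuot.mk a n l * CovQuot.mk a n' l' =
      CovQuot.mk a (n * MulAut.conjNormal (l : G) n') (l * l') := rfl

lemma covRep_mk (n : N) (l : stabG a) : covRep a (CovQuot.mk a n l) = coadQuot N (l : G) := by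
  change coadQuot N ((n : G) * (l : G)) = _
  rw [map_mul, coadQuot_of_mem N n.2, one_mul]

lemma quot_Ad_of_mem {n : G} (hn : n ∈ N) (X : GroupLieAlgebra 𝓘(ℝ, E) G) :
    (Submodule.Quotient.mk (Ad n X) : GroupLieAlgebra 𝓘(ℝ, E) G ⧸ lieSub (E := E) N) =
      Submodule.Quotient.mk X :=
  (Submodule.Quotient.eq _).2 (Ad_sub_self_mem_lieSub N hn X)

variable {b b' : Dual ℝ (GroupLieAlgebra 𝓘(ℝ, E) G)}

/-- The linear form `b - l(b)`, for `l` in the stabilizer of `a`, which vanishes on `𝔫`. -/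
def Extends.defect (h : Extends b a) (l : stabG a) :
    Dual ℝ (GroupLieAlgebra 𝓘(ℝ, E) G ⧸ lieSub (E := E) N) :=
  (lieSub N).liftQ (b - coadG (l : G) b) fun Y hY => sub_eq_zero.2 (h.mem_stabG.1 l.2 Y hY).symm

lemma Extends.defect_mk (h : Extends b a) (l : stabG a) (X : GroupLieAlgebra 𝓘(ℝ, E) G) :
    h.defect l (Submodule.Quotient.mk X) = b X - b (Ad (l : G)⁻¹ X) := rfl

lemma Extends.defect_mul (h : Extends b a) (l l' : stabG a) :
    h.defect (l * l') = coadQuot N (l : G) (h.defect l') + h.defect l := by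
  refine LinearMap.ext fun x => ?_
  obtain ⟨X, rfl⟩ := Submodule.mkQ_surjective _ x
  change h.defect (l * l') (Submodule.Quotient.mk X) =
    h.defect l' (Submodule.Quotient.mk (Ad (l : G)⁻¹ X)) + h.defect l (Submodule.Quotient.mk X)
  rw [h.defect_mk, h.defect_mk, h.defect_mk, Subgroup.coe_mul, mul_inv_rev, map_mul,
    Module.End.mul_apply]
  ring

lemma Extends.defect_eq_of_inv_mul_mem (h : Extends b a) {l l' : stabG a}
    (hb : coadG ((l⁻¹ * l' : stabG a) : G) b = b) : h.defect l = h.defect l' := by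
  have h1 : h.defect (l⁻¹ * l') = 0 := by
    refine LinearMap.ext fun x => ?_
    obtain ⟨X, rfl⟩ := Submodule.mkQ_surjective _ x
    exact sub_eq_zero.2 (congrArg (fun f => f X) hb).symm
  have h2 := h.defect_mul l (l⁻¹ * l')
  rw [h1, map_zero, zero_add, mul_inv_cancel_left] at h2
  exact h2.symm

end Cohomology

/-! ### The cocycle of an extension of `a` -/

section Class

open Function Module groupCohomology

variable {E : Type} [NormedAddCommGroup E] [NormedSpace ℝ E] [FiniteDimensional ℝ E]
  {G : Type} [TopologicalSpace G] [ChartedSpace E G] [Group G] [LieGroup 𝓘(ℝ, E) ∞ G]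
  {N : Subgroup G} [N.Normal] {a : Module.Dual ℝ (lieSub (E := E) N)}
  {b b' : Dual ℝ (GroupLieAlgebra 𝓘(ℝ, E) G)}

/-- The cocycle `[n, l] ↦ b - l(b)` on `G̃/Ñ`. It is computed with chosen representatives; the
choice does not matter because `b` is fixed by `K°`. -/
def Extends.theta (h : Extends b a) (hb : ∀ k ∈ stabNo a, coadG k b = b) :
    cocycles₁ (Rep.of (covRep a)) :=
  ⟨fun q => h.defect (CovQuot.exists_mk q).choose_spec.choose, by
    have key (n : N) (l : stabG a) :
        h.defect (CovQuot.exists_mk (CovQuot.mk a n l)).choose_spec.choose = h.defect l :=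
      h.defect_eq_of_inv_mul_mem (hb _ (CovQuot.inv_mul_mem_of_mk_eq
        (CovQuot.exists_mk (CovQuot.mk a n l)).choose_spec.choose_spec))
    rw [mem_cocycles₁_iff]
    intro q q'
    obtain ⟨n, l, rfl⟩ := CovQuot.exists_mk q
    obtain ⟨n', l', rfl⟩ := CovQuot.exists_mk q'
    rw [CovQuot.mk_mul_mk, key, key, key, h.defect_mul]
    exact congrArg (fun f => f (h.defect l') + h.defect l) (covRep_mk n l).symm⟩

lemma Extends.theta_mk (h : Extends b a) (hb : ∀ k ∈ stabNo a, coadG k b = b) (n : N)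
    (l : stabG a) : h.theta hb (CovQuot.mk a n l) = h.defect l :=
  h.defect_eq_of_inv_mul_mem (hb _ (CovQuot.inv_mul_mem_of_mk_eq
    (CovQuot.exists_mk (CovQuot.mk a n l)).choose_spec.choose_spec))

/-- The cocycle `theta` measures the failure of `n K° ↦ n(b)` to be equivariant: for
`m = n l n' l⁻¹` one has `m(b) - n l n'(b) = m(b - l(b))`, and `m ∈ N` acts trivially on the
annihilator of `𝔫`. -/
lemma Extends.isNonequivarianceCocycle_theta (h : Extends b a)
    (hb : ∀ k ∈ stabNo a, coadG k b = b) : IsNonequivarianceCocycle a b (h.theta hb) := by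
  refine ⟨fun x => Quotient.liftOn' x (fun n : N => coadG (n : G) b) fun n n' hn => ?_,
    fun n => rfl, fun n l n' X => ?_⟩
  · have h1 : (n : G)⁻¹ * n' ∈ stabNo a := by
      have := QuotientGroup.leftRel_apply.1 hn
      exact this
    have h2 := congrArg (coadG (n : G)) (hb _ h1)
    rw [← Module.End.mul_apply, ← map_mul, mul_inv_cancel_left] at h2
    exact h2.symm
  · let m : N := n * MulAut.conjNormal (l : G) n'
    have hm : (n : G) * (l : G) * n' = m * l := by simp [m, mul_assoc]
    change h.theta hb (CovQuot.mk a n l) (Submodule.Quotient.mk X) =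
      coadG (m : G) b X - coadG ((n : G) * (l : G)) (coadG (n' : G) b) X
    rw [h.theta_mk hb, ← Module.End.mul_apply, ← map_mul, hm, coadG_apply, coadG_apply,
      mul_inv_rev, map_mul, Module.End.mul_apply, ← h.defect_mk,
      quot_Ad_of_mem (inv_mem m.2)]

lemma Extends.sub_comp_mkQ (h : Extends b a)
    (m : Dual ℝ (GroupLieAlgebra 𝓘(ℝ, E) G ⧸ lieSub (E := E) N)) :
    Extends (b - m ∘ₗ (lieSub N).mkQ) a := by
  intro Y
  have h1 : (lieSub N).mkQ (Y : GroupLieAlgebra 𝓘(ℝ, E) G) = 0 :=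
    (Submodule.Quotient.mk_eq_zero _).2 Y.2
  rw [LinearMap.sub_apply, LinearMap.comp_apply, h1, map_zero, sub_zero, h Y]

lemma Extends.defect_sub_comp_mkQ (h : Extends b a)
    (m : Dual ℝ (GroupLieAlgebra 𝓘(ℝ, E) G ⧸ lieSub (E := E) N)) (l : stabG a) :
    (h.sub_comp_mkQ m).defect l = h.defect l + (coadQuot N (l : G) m - m) := by
  refine LinearMap.ext fun x => ?_
  obtain ⟨X, rfl⟩ := Submodule.mkQ_surjective _ x
  change (b X - m (Submodule.Quotient.mk X)) -
    (b (Ad (l : G)⁻¹ X) - m (Submodule.Quotient.mk (Ad (l : G)⁻¹ X))) =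
    (b X - b (Ad (l : G)⁻¹ X)) +
      (m (Submodule.Quotient.mk (Ad (l : G)⁻¹ X)) - m (Submodule.Quotient.mk X))
  ring

lemma Extends.exists_eq_sub_comp_mkQ (h : Extends b a) (h' : Extends b' a) :
    ∃ m : Dual ℝ (GroupLieAlgebra 𝓘(ℝ, E) G ⧸ lieSub (E := E) N),
      b' = b - m ∘ₗ (lieSub N).mkQ := by
  refine ⟨(lieSub N).liftQ (b - b') fun Y hY => sub_eq_zero.2 ((h ⟨Y, hY⟩).trans (h' ⟨Y, hY⟩).symm),
    LinearMap.ext fun X => ?_⟩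
  change b' X = b X - (b X - b' X)
  ring

/-- The cocycles which are cohomologous to `theta` are those given by the other extensions of the
linear form `a` to `𝔤`. -/
lemma Extends.H1π_eq_theta_iff (h : Extends b a) (hb : ∀ k ∈ stabNo a, coadG k b = b)
    (θ : cocycles₁ (Rep.of (covRep a))) : H1π _ θ = H1π _ (h.theta hb) ↔
      ∃ (b' : Dual ℝ (GroupLieAlgebra 𝓘(ℝ, E) G)) (h' : Extends b' a),
        ∀ n l, θ (CovQuot.mk a n l) = h'.defect l := by
  rw [H1π_eq_iff]
  constructor
  · rintro ⟨m, hm⟩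
    refine ⟨_, h.sub_comp_mkQ m, fun n l => ?_⟩
    have h1 := congrFun hm (CovQuot.mk a n l)
    rw [d₀₁_hom_apply] at h1
    rw [h.defect_sub_comp_mkQ, ← h.theta_mk hb n l, ← covRep_mk n l]
    exact (add_eq_of_eq_sub' h1).symm
  · rintro ⟨b', h', hθ⟩
    obtain ⟨m, rfl⟩ := h.exists_eq_sub_comp_mkQ h'
    refine ⟨m, funext fun q => ?_⟩
    obtain ⟨n, l, rfl⟩ := CovQuot.exists_mk q
    rw [d₀₁_hom_apply]
    change _ = θ (CovQuot.mk a n l) - h.theta hb (CovQuot.mk a n l)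
    rw [hθ, h.theta_mk, h.defect_sub_comp_mkQ, ← covRep_mk n l, add_sub_cancel_left]

/-- The class of the cocycles vanishes if and only if some extension of `a` to `𝔤` is fixed by the
stabilizer of `a`. -/
lemma Extends.H1π_theta_eq_zero_iff (h : Extends b a) (hb : ∀ k ∈ stabNo a, coadG k b = b) :
    H1π _ (h.theta hb) = 0 ↔
      ∃ b' : Dual ℝ (GroupLieAlgebra 𝓘(ℝ, E) G), Extends b' a ∧ ∀ l ∈ stabG a, coadG l b' = b' := by
  have h0 : H1π _ (h.theta hb) = 0 ↔ H1π _ (0 : cocycles₁ (Rep.of (covRep a))) =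
      H1π _ (h.theta hb) := by rw [map_zero, eq_comm]
  rw [h0, h.H1π_eq_theta_iff]
  refine exists_congr fun b' => ⟨?_, ?_⟩
  · rintro ⟨h', hl⟩
    refine ⟨h', fun l hl' => LinearMap.ext fun X => ?_⟩
    have h1 := congrArg (fun f => f (Submodule.Quotient.mk X)) (hl 1 ⟨l, hl'⟩)
    exact (sub_eq_zero.1 h1.symm).symm
  · rintro ⟨h', hl⟩
    refine ⟨h', fun n l => LinearMap.ext fun x => ?_⟩
    obtain ⟨X, rfl⟩ := Submodule.mkQ_surjective _ x
    exact (sub_eq_zero.2 (congrArg (fun f => f X) (hl l l.2)).symm).symm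

end Class

/-! ### The derivative of the cocycle -/

section Derivative

open Set Filter Function Module

variable {E : Type*} [NormedAddCommGroup E] [NormedSpace ℝ E] [FiniteDimensional ℝ E]
  {G : Type*} [TopologicalSpace G] [ChartedSpace E G] [Group G] [LieGroup 𝓘(ℝ, E) ∞ G]

/-- The Lie algebra of a subgroup, as a Lie subalgebra. -/
def lieSubalgebra (H : Subgroup G) : LieSubalgebra ℝ (GroupLieAlgebra 𝓘(ℝ, E) G) where
  __ := lieSub H
  lie_mem' := by
    intro X Y hX hY
    refine lie_mem_of_Ad_mem (V := lieSub H) ?_ hX hY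
    rintro h hh Z ⟨γ, hγ, hs⟩
    exact ⟨_, hγ.conj h, fun t => mul_mem (mul_mem hh (hs t)) (inv_mem hh)⟩

/-- The Lie algebra of a normal subgroup, as an ideal. -/
def lieIdeal (N : Subgroup G) [N.Normal] : LieIdeal ℝ (GroupLieAlgebra 𝓘(ℝ, E) G) where
  __ := lieSub N
  lie_mem := lie_mem_lieSub_right N _

variable {N : Subgroup G} [N.Normal] {a : Module.Dual ℝ (lieSub (E := E) N)}
  {F : Type*} [NormedAddCommGroup F] [NormedSpace ℝ F] [FiniteDimensional ℝ F]
  [ChartedSpace F N] [LieGroup 𝓘(ℝ, F) ∞ N]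
  {b : Module.Dual ℝ (GroupLieAlgebra 𝓘(ℝ, E) G)}
  (hemb : Manifold.IsSmoothEmbedding 𝓘(ℝ, F) 𝓘(ℝ, E) ∞ ((↑) : N → G))

lemma eventually_continuousAt_of_contMDiffAt {B : Type*} [NormedAddCommGroup B] [NormedSpace ℝ B]
    {M : Type*} [TopologicalSpace M] [ChartedSpace B M] [IsManifold 𝓘(ℝ, B) ∞ M] {f : G → M} {x : G}
    (h : ContMDiffAt 𝓘(ℝ, E) 𝓘(ℝ, B) ∞ f x) : ∀ᶠ y in 𝓝 x, ContinuousAt f y := by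
  have : IsManifold 𝓘(ℝ, B) 1 M := IsManifold.of_le (n := ∞) (by simp)
  have : IsManifold 𝓘(ℝ, E) ∞ G := inferInstance
  have : IsManifold 𝓘(ℝ, E) 1 G := IsManifold.of_le (n := ∞) (by simp)
  exact ((contMDiffAt_iff_contMDiffAt_nhds (n := 1) (by simp)).1 (h.of_le (by simp))).mono
    fun y hy => hy.continuousAt

include hemb

/-- The derivative at the identity of the cocycle `[n, l] ↦ b - l(b)` is given on `𝔩` by
`(X, Y) ↦ b([X, Y])`. -/
theorem Extends.hasDerivAtIdentity (h : Extends b a) {ν : G → N}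
    (hν : ContMDiffAt 𝓘(ℝ, E) 𝓘(ℝ, F) ∞ ν 1) (hν1 : ν 1 = 1)
    (hνL : ∀ g, (ν g : G)⁻¹ * g ∈ stabG a)
    {θ : CovQuot a → Dual ℝ (GroupLieAlgebra 𝓘(ℝ, E) G ⧸ lieSub N)}
    (hθ : ∀ n l, θ (CovQuot.mk a n l) = h.defect l)
    {f : Z2 (GroupLieAlgebra 𝓘(ℝ, E) G ⧸ lieIdeal N)}
    (hf : ∀ X ∈ lieSubalgebra (stabG a), ∀ Y : GroupLieAlgebra 𝓘(ℝ, E) G,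
      f.1 (LieSubmodule.Quotient.mk X) (LieSubmodule.Quotient.mk Y) = b ⁅X, Y⁆) :
    HasDerivAtIdentity a θ
      (fun X Y => f.1 (LieSubmodule.Quotient.mk X) (LieSubmodule.Quotient.mk Y)) := by
  let l : G → stabG a := fun g => ⟨(ν g : G)⁻¹ * g, hνL g⟩
  have hσ (g) (Y : GroupLieAlgebra 𝓘(ℝ, E) G) :
      θ (QuotientGroup.mk (QuotientGroup.mk (⟨ν g, l g⟩ : SemiNL a) : Cov a))
        (Submodule.Quotient.mk Y) = b Y - b (Ad (l g : G)⁻¹ Y) :=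
    congrArg (fun f => f (Submodule.Quotient.mk Y)) (hθ (ν g) (l g))
  have hνG : ContMDiffAt 𝓘(ℝ, E) 𝓘(ℝ, E) ∞ (fun g => (ν g : G)) 1 :=
    hemb.contMDiff.contMDiffAt.comp (1 : G) hν
  have hl : ContMDiffAt 𝓘(ℝ, E) 𝓘(ℝ, E) ∞ (fun g => (l g : G)) 1 := hνG.inv.mul contMDiffAt_id
  have hd (Y : GroupLieAlgebra 𝓘(ℝ, E) G) : MDifferentiableAt 𝓘(ℝ, E) 𝓘(ℝ, ℝ)
      (fun g => θ (QuotientGroup.mk (QuotientGroup.mk (⟨ν g, l g⟩ : SemiNL a) : Cov a))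
        (Submodule.Quotient.mk Y)) 1 := by
    have h1 : ContMDiffAt 𝓘(ℝ, E) 𝓘(ℝ, ℝ) ∞ (fun g => adCoeff b Y (l g : G)⁻¹) 1 :=
      (contMDiff_adCoeff b Y).contMDiffAt.comp (1 : G) hl.inv
    have h2 : MDifferentiableAt 𝓘(ℝ, E) 𝓘(ℝ, ℝ) (fun g => b Y - adCoeff b Y (l g : G)⁻¹) 1 :=
      mdifferentiableAt_const.sub (h1.mdifferentiableAt (by simp))
    exact h2.congr_of_eventuallyEq (.of_forall fun g => hσ g Y)
  refine ⟨fun g => QuotientGroup.mk (⟨ν g, l g⟩ : SemiNL a), ?_, ?_, fun Y => ⟨hd Y, fun X => ?_⟩⟩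
  · have h1 : (⟨ν 1, l 1⟩ : SemiNL a) = 1 :=
      SemidirectProduct.ext hν1 (Subtype.ext (by simp [l, hν1]))
    exact congrArg (QuotientGroup.mk (s := antidiag a)) h1
  · filter_upwards [eventually_continuousAt_of_contMDiffAt hν] with g hg
    have : IsTopologicalGroup G := topologicalGroup_of_lieGroup 𝓘(ℝ, E) ∞
    refine ⟨?_, mul_inv_cancel_left _ _⟩
    have h1 : Topology.IsInducing fun x : SemiNL a => (x.left, x.right) := ⟨rfl⟩
    have h2 : ContinuousAt (fun g => (⟨ν g, l g⟩ : SemiNL a)) g := by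
      rw [h1.continuousAt_iff]
      refine hg.prodMk ?_
      rw [Topology.IsInducing.subtypeVal.continuousAt_iff]
      exact (continuous_subtype_val.continuousAt.comp hg).inv.mul continuousAt_id
    exact continuous_quot_mk.continuousAt.comp h2
  · obtain ⟨γ, hγ⟩ := exists_isCurve X
    obtain ⟨V, hV⟩ : ∃ V : GroupLieAlgebra 𝓘(ℝ, F) N, IsCurve (fun t => ν (γ t)) V :=
      ⟨_, by rw [hγ.map_zero, hν1], ContMDiffAt.comp (0 : ℝ) (by rw [hγ.map_zero]; exact hν)
        hγ.smooth, rfl⟩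
    have h2 := (hV.incl hemb).inv.mul hγ
    have h3 : -(inclLie V : GroupLieAlgebra 𝓘(ℝ, E) G) + X ∈ lieSub (stabG a) :=
      ⟨_, h2, fun t => hνL (γ t)⟩
    have h4 : (LieSubmodule.Quotient.mk X : GroupLieAlgebra 𝓘(ℝ, E) G ⧸ lieIdeal N) =
        LieSubmodule.Quotient.mk (-(inclLie V : GroupLieAlgebra 𝓘(ℝ, E) G) + X) := by
      refine (Submodule.Quotient.eq _).2 ?_
      have h5 : X - (-(inclLie V : GroupLieAlgebra 𝓘(ℝ, E) G) + X) = inclLie V := by abel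
      rw [h5]
      exact inclLie_mem hemb V
    have h6 := (h2.hasDerivAt_adCoeff_inv b Y).const_sub (b Y)
    rw [neg_neg] at h6
    have h7 : f.1 (LieSubmodule.Quotient.mk X) (LieSubmodule.Quotient.mk Y) = _ :=
      (congrArg (fun z => f.1 z (LieSubmodule.Quotient.mk Y)) h4).trans (hf _ h3 Y)
    exact (mfderiv_apply_of_isCurve (hd Y) hγ
      (h6.congr_of_eventuallyEq (.of_forall fun t => hσ (γ t) Y))).trans h7.symm

end Derivative

/-! ### Moment maps on homogeneous spaces -/

section HomogeneousHamiltonian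

open Set Filter Function Module

variable {E : Type*} [NormedAddCommGroup E] [NormedSpace ℝ E] [FiniteDimensional ℝ E]
  {G : Type*} [TopologicalSpace G] [ChartedSpace E G] [Group G] [LieGroup 𝓘(ℝ, E) ∞ G]
  {B : Type*} [NormedAddCommGroup B] [NormedSpace ℝ B] [FiniteDimensional ℝ B]
  {X : Type*} [TopologicalSpace X] [ChartedSpace B X] [IsManifold 𝓘(ℝ, B) ∞ X]

/-- The infinitesimal action at the point `x`, as a linear map. -/
def infLin (ρ : G →* Equiv.Perm X) (x : X) : GroupLieAlgebra 𝓘(ℝ, E) G →ₗ[ℝ] B :=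
  show E →ₗ[ℝ] B from
    (mfderiv 𝓘(ℝ, E) 𝓘(ℝ, B) (fun g : G => ρ g x) 1 : E →L[ℝ] B).toLinearMap

variable {ρ : G →* Equiv.Perm X}

/-- If the action has a smooth local section at `x`, then the vectors by which `𝔤` acts span the
tangent space at `x`. -/
lemma surjective_infLin {x : X} {κ : X → G} (hκ : ContMDiffAt 𝓘(ℝ, B) 𝓘(ℝ, E) ∞ κ x)
    (hκ1 : κ x = 1) (h : ∀ᶠ y in 𝓝 x, ρ (κ y) x = y)
    (hρ : MDifferentiableAt 𝓘(ℝ, E) 𝓘(ℝ, B) (fun g : G => ρ g x) 1) :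
    Surjective (infLin (B := B) (E := E) ρ x) := by
  intro v
  have h1 := mfderiv_comp_apply_of_eq (I := 𝓘(ℝ, B)) (I' := 𝓘(ℝ, E)) (I'' := 𝓘(ℝ, B))
    (g := fun g : G => ρ g x) (f := κ) (x := x) hρ (hκ.mdifferentiableAt (by simp)) hκ1 v
  have h2 : (fun g : G => ρ g x) ∘ κ =ᶠ[𝓝 x] id := h
  refine ⟨(mfderiv 𝓘(ℝ, B) 𝓘(ℝ, E) κ x : B →L[ℝ] E) v, h1.symm.trans ?_⟩
  exact (congrArg (fun L : B →L[ℝ] B => L v) (h2.mfderiv_eq (I := 𝓘(ℝ, B)) (I' := 𝓘(ℝ, B)))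
      ).trans (congrArg (fun L : B →L[ℝ] B => L v) mfderiv_id)

variable (hρ : ContMDiff (𝓘(ℝ, E).prod 𝓘(ℝ, B)) 𝓘(ℝ, B) ∞ (fun p : G × X => ρ p.1 p.2))

include hρ

lemma contMDiff_orbit_of_action (x : X) :
    ContMDiff 𝓘(ℝ, E) 𝓘(ℝ, B) ∞ (fun g : G => ρ g x) :=
  hρ.comp (contMDiff_id.prodMk contMDiff_const)

lemma contMDiff_of_action (g : G) : ContMDiff 𝓘(ℝ, B) 𝓘(ℝ, B) ∞ (ρ g) :=
  hρ.comp (contMDiff_const.prodMk contMDiff_id)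

/-- The vector fields of the infinitesimal action are permuted by `G` through `Ad`. -/
lemma mfderiv_infLin (g : G) (x : X) (Z : GroupLieAlgebra 𝓘(ℝ, E) G) :
    (mfderiv 𝓘(ℝ, B) 𝓘(ℝ, B) (ρ g) x : B →L[ℝ] B) (infLin (B := B) ρ x Z) =
      infLin (B := B) ρ (ρ g x) (Ad g Z) := by
  have h1 := mfderiv_comp_apply_of_eq (I := 𝓘(ℝ, E)) (I' := 𝓘(ℝ, B)) (I'' := 𝓘(ℝ, B))
    (g := ρ g) (f := fun h : G => ρ h x) (x := (1 : G)) (y := x)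
    ((contMDiff_of_action hρ g).mdifferentiable (by simp) _)
    ((contMDiff_orbit_of_action hρ x).mdifferentiable (by simp) _) (by simp) Z
  have h2 := mfderiv_comp_apply_of_eq (I := 𝓘(ℝ, E)) (I' := 𝓘(ℝ, E)) (I'' := 𝓘(ℝ, B))
    (g := fun h : G => ρ h (ρ g x)) (f := fun h : G => g * h * g⁻¹) (x := (1 : G)) (y := (1 : G))
    ((contMDiff_orbit_of_action hρ (ρ g x)).mdifferentiable (by simp) _)
    ((contMDiff_conj (E := E) g).mdifferentiable (by simp) _) (by simp) Z
  have h3 : (ρ g ∘ fun h : G => ρ h x) =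
      (fun h : G => ρ h (ρ g x)) ∘ fun h : G => g * h * g⁻¹ := by
    ext h
    simp [← Equiv.Perm.mul_apply, ← map_mul]
  have h4 := congrArg (fun f : G → X => (mfderiv 𝓘(ℝ, E) 𝓘(ℝ, B) f 1 : E →L[ℝ] B) Z) h3
  exact h1.symm.trans (h4.trans h2)

variable {Φ : X → Dual ℝ (GroupLieAlgebra 𝓘(ℝ, E) G)}
  (hΦ : ∀ Z, ContMDiff 𝓘(ℝ, B) 𝓘(ℝ, ℝ) ∞ (fun x => Φ x Z))
  (hΦρ : ∀ (g : G) (x : X), Φ (ρ g x) = coadG g (Φ x))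

include hΦ hΦρ

lemma mfderiv_moment_infLin (x : X) (Z Y : GroupLieAlgebra 𝓘(ℝ, E) G) :
    (mfderiv 𝓘(ℝ, B) 𝓘(ℝ, ℝ) (fun y => Φ y Z) x : B →L[ℝ] ℝ) (infLin (B := B) ρ x Y) =
      Φ x ⁅Z, Y⁆ := by
  obtain ⟨γ, hγ⟩ := exists_isCurve Y
  have h1 := mfderiv_comp_apply_of_eq (I := 𝓘(ℝ, E)) (I' := 𝓘(ℝ, B)) (I'' := 𝓘(ℝ, ℝ))
    (g := fun y => Φ y Z) (f := fun h : G => ρ h x) (x := (1 : G)) (y := x)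
    ((hΦ Z).mdifferentiable (by simp) _)
    ((contMDiff_orbit_of_action hρ x).mdifferentiable (by simp) _) (by simp) Y
  refine h1.symm.trans ?_
  have h2 : HasDerivAt (fun t => Φ (ρ (γ t) x) Z) (Φ x ⁅Z, Y⁆) 0 := by
    have h3 := hγ.hasDerivAt_adCoeff_inv (Φ x) Z
    rw [← lie_skew, (Φ x).map_neg]
    exact h3.congr_of_eventuallyEq (.of_forall fun t =>
      congrArg (fun f => f Z) (hΦρ (γ t) x))
  exact mfderiv_apply_of_isCurve (((hΦ Z).comp (contMDiff_orbit_of_action hρ x)).mdifferentiable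
    (by simp) _) hγ h2

/-- On a homogeneous space, every smooth equivariant map `Φ` to `𝔤*` is a moment map for the
form `w` with `w(Z(x), Y(x)) = ⟨Φ(x), [Y, Z]⟩`. It is well defined because `⟨Φ(x), [Z, Y]⟩` is the
derivative of `⟨Φ, Z⟩` in the direction `Y(x)`, and so depends only on the vectors `Y(x)` and
`Z(x)`. -/
theorem exists_isHamiltonian (hsurj : ∀ x, Surjective (infLin (B := B) (E := E) ρ x)) :
    ∃ w : ∀ x : X, TangentSpace 𝓘(ℝ, B) x →L[ℝ] TangentSpace 𝓘(ℝ, B) x →L[ℝ] ℝ,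
      (∀ x (Z Y : GroupLieAlgebra 𝓘(ℝ, E) G),
        w x (infAction ρ Z x) (infAction ρ Y x) = Φ x ⁅Y, Z⁆) ∧ IsHamiltonian w ρ Φ := by
  choose R hR using fun x => (infLin (B := B) (E := E) ρ x).exists_rightInverse_of_surjective
    (LinearMap.range_eq_top.2 (hsurj x))
  -- `w` is computed with a linear choice of Lie algebra elements inducing given tangent vectors
  let β (x : X) : B →ₗ[ℝ] B →ₗ[ℝ] ℝ :=
    -((LieModule.toEnd ℝ (GroupLieAlgebra 𝓘(ℝ, E) G) (GroupLieAlgebra 𝓘(ℝ, E) G) :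
      GroupLieAlgebra 𝓘(ℝ, E) G →ₗ[ℝ] End ℝ (GroupLieAlgebra 𝓘(ℝ, E) G)).compr₂
        (Φ x)).compl₁₂ (R x) (R x)
  let w (x : X) : B →L[ℝ] B →L[ℝ] ℝ :=
    (LinearMap.toContinuousLinearMap.toLinearMap ∘ₗ β x).toContinuousLinearMap
  have hw (x) (u v : B) : w x u v = -Φ x ⁅R x u, R x v⁆ := rfl
  have hRinf (x) (Y : GroupLieAlgebra 𝓘(ℝ, E) G) :
      infLin ρ x (R x (infLin ρ x Y)) = (infLin ρ x Y : B) :=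
    congrArg (fun f => f (infLin ρ x Y)) (hR x)
  -- changing an element of the Lie algebra without changing the induced vector does not matter
  have hR1 (x) (Z Y : GroupLieAlgebra 𝓘(ℝ, E) G) :
      Φ x ⁅Z, R x (infLin ρ x Y)⁆ = Φ x ⁅Z, Y⁆ := by
    rw [← mfderiv_moment_infLin hρ hΦ hΦρ, hRinf, mfderiv_moment_infLin hρ hΦ hΦρ]
  have hw' (x) (Z Y : GroupLieAlgebra 𝓘(ℝ, E) G) :
      w x (infLin ρ x Z) (infLin ρ x Y) = Φ x ⁅Y, Z⁆ := by
    rw [hw, hR1, ← lie_skew, (Φ x).map_neg, hR1, neg_neg]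
  refine ⟨w, hw', hρ, ?_, hΦ, ?_, hΦρ⟩
  · intro g x u v
    obtain ⟨Z, rfl⟩ := hsurj x u
    obtain ⟨Y, rfl⟩ := hsurj x v
    have h1 := mfderiv_infLin hρ g x Z
    have h2 := mfderiv_infLin hρ g x Y
    refine (congrArg₂ (fun u v : B => w (ρ g x) u v) h1 h2).trans ((hw' _ _ _).trans ?_)
    rw [hΦρ, coadG_apply, ← Ad_lie, (Ad (E := E)).inv_self_apply]
    exact (hw' _ _ _).symm
  · intro Z x v
    obtain ⟨Y, rfl⟩ := hsurj x v
    refine (mfderiv_moment_infLin hρ hΦ hΦρ x Z Y).trans ?_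
    refine Eq.trans ?_ (congrArg Neg.neg (hw' x Z Y)).symm
    rw [← lie_skew, (Φ x).map_neg]

end HomogeneousHamiltonian

/-! ### Hamiltonian structures on the orbit -/

section HamiltonianOrbit

open Set Filter Function Module

variable {E : Type*} [NormedAddCommGroup E] [NormedSpace ℝ E] [FiniteDimensional ℝ E]
  {G : Type*} [TopologicalSpace G] [ChartedSpace E G] [Group G] [LieGroup 𝓘(ℝ, E) ∞ G]
  {N : Subgroup G} [N.Normal] {a : Module.Dual ℝ (lieSub (E := E) N)}
  {b : Dual ℝ (GroupLieAlgebra 𝓘(ℝ, E) G)}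

lemma Extends.coadG_coadN (h : Extends b a) (n : N) :
    Extends (coadG (n : G) b) (coadN N (n : G) a) :=
  fun Y => (h.coadN_apply (n : G) Y).symm

/-- The point `n(a)` of the orbit `N(a)` is determined by the linear form `n(b)` on `𝔤`. -/
lemma Extends.mk_eq_mk_of_coadG_eq (h : Extends b a) {n n' : N}
    (hn : coadG (n : G) b = coadG (n' : G) b) :
    (QuotientGroup.mk n : Orbit a) = QuotientGroup.mk n' := by
  rw [QuotientGroup.eq, Subgroup.mem_subgroupOf]
  refine ⟨(n⁻¹ * n').2, inv_mul_mem_stabG (LinearMap.ext fun Y => ?_)⟩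
  rw [← h.coadG_coadN n Y, ← h.coadG_coadN n' Y, hn]

/-- If `a` has an extension `b` to `𝔤` which is fixed by the stabilizer of `a`, then `G` acts on
the orbit `N(a)`, and `n(a) ↦ n(b)` is well defined and equivariant. -/
lemma Extends.exists_action (h : Extends b a) (hL : ∀ l ∈ stabG a, coadG l b = b)
    (hG : ∀ g : G, ∃ n : N, (n : G)⁻¹ * g ∈ stabG a) :
    ∃ (ρ : G →* Equiv.Perm (Orbit a)) (Φ : Orbit a → Dual ℝ (GroupLieAlgebra 𝓘(ℝ, E) G)),
      (∀ n : N, Φ (QuotientGroup.mk n) = coadG (n : G) b) ∧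
      (∀ (g : G) (x : Orbit a), Φ (ρ g x) = coadG g (Φ x)) ∧
      ∀ (g : G) (n n' : N), (n' : G)⁻¹ * (g * n) ∈ stabG a →
        ρ g (QuotientGroup.mk n) = QuotientGroup.mk n' := by
  have hmul {n n' : G} (hn : n⁻¹ * n' ∈ stabG a) : coadG n' b = coadG n b := by
    have h2 := congrArg (coadG n) (hL _ hn)
    rwa [← Module.End.mul_apply, ← map_mul, mul_inv_cancel_left] at h2
  let Φ : Orbit a → Dual ℝ (GroupLieAlgebra 𝓘(ℝ, E) G) := fun x =>
    Quotient.liftOn' x (fun n : N => coadG (n : G) b) fun n n' hn => by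
      have h1 := QuotientGroup.leftRel_apply.1 hn
      exact (hmul (Subgroup.mem_subgroupOf.1 h1).2).symm
  have hΦ (n : N) : Φ (QuotientGroup.mk n) = coadG (n : G) b := rfl
  have hinj : Injective Φ := by
    intro x y hxy
    obtain ⟨n, rfl⟩ := QuotientGroup.mk_surjective x
    obtain ⟨n', rfl⟩ := QuotientGroup.mk_surjective y
    exact h.mk_eq_mk_of_coadG_eq hxy
  have hex (g : G) (x : Orbit a) : ∃ y, Φ y = coadG g (Φ x) := by
    obtain ⟨n, rfl⟩ := QuotientGroup.mk_surjective x
    obtain ⟨n', hn'⟩ := hG (g * n)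
    refine ⟨QuotientGroup.mk n', ?_⟩
    rw [hΦ, hΦ, ← Module.End.mul_apply, ← map_mul]
    exact (hmul hn').symm
  choose r hr using hex
  have hmulr (g g' : G) (x) : r (g * g') x = r g (r g' x) := hinj (by
    rw [hr, hr, hr, map_mul, Module.End.mul_apply])
  have honer (x) : r 1 x = x := hinj (by rw [hr, map_one, Module.End.one_apply])
  let ρ : G →* Equiv.Perm (Orbit a) :=
    { toFun g := ⟨r g, r g⁻¹, fun x => by rw [← hmulr, inv_mul_cancel, honer],
        fun x => by rw [← hmulr, mul_inv_cancel, honer]⟩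
      map_one' := Equiv.ext honer
      map_mul' g g' := Equiv.ext (hmulr g g') }
  refine ⟨ρ, Φ, hΦ, hr, fun g n n' hn => hinj ((hr g _).trans ?_)⟩
  rw [hΦ, hΦ, ← Module.End.mul_apply, ← map_mul]
  exact hmul hn

variable {F : Type*} [NormedAddCommGroup F] [NormedSpace ℝ F] [FiniteDimensional ℝ F]
  [ChartedSpace F N] [LieGroup 𝓘(ℝ, F) ∞ N]
  {B : Type*} [NormedAddCommGroup B] [NormedSpace ℝ B] [FiniteDimensional ℝ B]
  [ChartedSpace B (Orbit a)] [IsManifold 𝓘(ℝ, B) ∞ (Orbit a)]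

/-- The value at `1 K` of an equivariant moment map is an extension of `a` to `𝔤` which is fixed
by the stabilizer of `a`. -/
lemma OrbitIsHamiltonian.exists_extends (H : OrbitIsHamiltonian (F := F) (B := B) a) :
    ∃ b : Dual ℝ (GroupLieAlgebra 𝓘(ℝ, E) G), Extends b a ∧ ∀ l ∈ stabG a, coadG l b = b := by
  obtain ⟨w, ρ, Φ, -, hΦ, -, hres⟩ := H
  have h : Extends (Φ (QuotientGroup.mk 1)) a := by
    intro Y
    rw [hres 1 Y, Subgroup.coe_one, map_one, Module.End.one_apply]
  refine ⟨_, h, fun l hl => ?_⟩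
  rw [← hΦ.equivariant]
  obtain ⟨n, hn⟩ := QuotientGroup.mk_surjective (ρ l (QuotientGroup.mk 1))
  rw [← hn]
  have hna : coadN N (n : G) a = a := by
    refine LinearMap.ext fun Y => ?_
    rw [← hres n Y, hn, hΦ.equivariant, coadG_apply]
    exact (h.mem_stabG.1 hl Y Y.2).trans (h Y)
  have h1 : (QuotientGroup.mk n : Orbit a) = QuotientGroup.mk 1 := by
    rw [eq_comm, QuotientGroup.eq, Subgroup.mem_subgroupOf, inv_one, one_mul]
    exact ⟨n.2, hna⟩
  rw [h1]

variable (hemb : Manifold.IsSmoothEmbedding 𝓘(ℝ, F) 𝓘(ℝ, E) ∞ ((↑) : N → G))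
  (hsub : Manifold.IsSubmersion 𝓘(ℝ, F) 𝓘(ℝ, B) ∞ (QuotientGroup.mk : N → Orbit a))

include hsub

lemma exists_section_orbit (n : N) :
    ∃ s : Orbit a → N, ContMDiffAt 𝓘(ℝ, B) 𝓘(ℝ, F) ∞ s (QuotientGroup.mk n) ∧
      s (QuotientGroup.mk n) = n ∧
      ∀ᶠ y in 𝓝 (QuotientGroup.mk n : Orbit a), QuotientGroup.mk (s y) = y :=
  exists_section_of_isSubmersionAt (hsub.isSubmersionAt n)

include hemb

/-- The action of `G` on `N(a) = N/K` is smooth if `G = N L` locally splits smoothly. -/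
lemma contMDiff_action_orbit {ρ : G →* Equiv.Perm (Orbit a)}
    (hρ : ∀ (g : G) (n n' : N), (n' : G)⁻¹ * (g * n) ∈ stabG a →
        ρ g (QuotientGroup.mk n) = QuotientGroup.mk n') {ν : G → N}
    (hν : ContMDiffAt 𝓘(ℝ, E) 𝓘(ℝ, F) ∞ ν 1)
    (hνL : ∀ g, (ν g : G)⁻¹ * g ∈ stabG a) :
    ContMDiff (𝓘(ℝ, E).prod 𝓘(ℝ, B)) 𝓘(ℝ, B) ∞ (fun p : G × Orbit a => ρ p.1 p.2) := by
  rintro ⟨g₀, x₀⟩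
  obtain ⟨m₀, rfl⟩ := QuotientGroup.mk_surjective x₀
  obtain ⟨s, hs, hs0, hs'⟩ := exists_section_orbit hsub m₀
  -- `g₀ m₀ = n₀ l₀` with `l₀` in the stabilizer; near `(g₀, m₀ K)`, the element `g s(x)` of `G` is
  -- `n₀ h l₀` with `h` near `1`, and `h` is split by `ν`
  set n₀ := ν (g₀ * m₀)
  set l₀ : G := (n₀ : G)⁻¹ * (g₀ * m₀) with hl₀
  let κ : G × Orbit a → G := fun p => (n₀ : G)⁻¹ * (p.1 * s p.2) * l₀⁻¹
  have hκ1 : κ (g₀, QuotientGroup.mk m₀) = 1 := by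
    simp only [κ, hs0]
    exact mul_inv_cancel l₀
  have hsp : ContMDiffAt (𝓘(ℝ, E).prod 𝓘(ℝ, B)) 𝓘(ℝ, E) ∞
      (fun p : G × Orbit a => (s p.2 : G)) (g₀, QuotientGroup.mk m₀) :=
    hemb.contMDiff.contMDiffAt.comp (g₀, (QuotientGroup.mk m₀ : Orbit a))
      (ContMDiffAt.comp (I' := 𝓘(ℝ, B)) (g₀, (QuotientGroup.mk m₀ : Orbit a)) (g := s)
        (f := Prod.snd) hs contMDiffAt_snd)
  have hκ : ContMDiffAt (𝓘(ℝ, E).prod 𝓘(ℝ, B)) 𝓘(ℝ, E) ∞ κ (g₀, QuotientGroup.mk m₀) :=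
    (contMDiffAt_const.mul (contMDiffAt_fst.mul hsp)).mul contMDiffAt_const
  have hνκ : ContMDiffAt (𝓘(ℝ, E).prod 𝓘(ℝ, B)) 𝓘(ℝ, F) ∞ (fun p => n₀ * ν (κ p))
      (g₀, QuotientGroup.mk m₀) :=
    contMDiffAt_const.mul (ContMDiffAt.comp (I' := 𝓘(ℝ, E)) (g₀, (QuotientGroup.mk m₀ : Orbit a))
      (g := ν) (f := κ) (by rw [hκ1]; exact hν) hκ)
  refine (hsub.contMDiff.contMDiffAt.comp (g₀, (QuotientGroup.mk m₀ : Orbit a)) hνκ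
    ).congr_of_eventuallyEq ?_
  have h0 : Tendsto (Prod.snd : G × Orbit a → Orbit a) (𝓝 (g₀, QuotientGroup.mk m₀))
      (𝓝 (QuotientGroup.mk m₀)) := continuousAt_snd
  have h1 := h0.eventually hs'
  filter_upwards [h1] with p hp
  conv_lhs => rw [← hp]
  refine hρ _ _ _ ?_
  have h2 : ((n₀ * ν (κ p) : N) : G)⁻¹ * (p.1 * s p.2) = ((ν (κ p) : G)⁻¹ * κ p) * l₀ := by
    simp [κ, mul_assoc]
  rw [h2]
  exact mul_mem (hνL _) (hνL _)

/-- If `a` has an extension `b` to `𝔤` which is fixed by the stabilizer of `a`, then `n(a) ↦ n(b)`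
is the moment map of an action of `G` on the orbit `N(a)`. -/
theorem Extends.orbitIsHamiltonian (h : Extends b a) (hL : ∀ l ∈ stabG a, coadG l b = b) {ν : G → N}
    (hν : ContMDiffAt 𝓘(ℝ, E) 𝓘(ℝ, F) ∞ ν 1)
    (hνL : ∀ g, (ν g : G)⁻¹ * g ∈ stabG a) : OrbitIsHamiltonian (F := F) (B := B) a := by
  obtain ⟨ρ, Φ, hΦ, hΦρ, hρ⟩ := h.exists_action hL fun g => ⟨ν g, hνL g⟩
  have hsmooth := contMDiff_action_orbit hemb hsub hρ hν hνL
  have hN (n : N) (x : Orbit a) : ρ (n : G) x = n • x := by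
    obtain ⟨m, rfl⟩ := QuotientGroup.mk_surjective x
    refine hρ _ _ (n * m) ?_
    simp
  have hmoment (Z : GroupLieAlgebra 𝓘(ℝ, E) G) :
      ContMDiff 𝓘(ℝ, B) 𝓘(ℝ, ℝ) ∞ (fun x => Φ x Z) := by
    intro x
    obtain ⟨n, rfl⟩ := QuotientGroup.mk_surjective x
    obtain ⟨s, hs, hs0, hs'⟩ := exists_section_orbit hsub n
    have h1 : ContMDiffAt 𝓘(ℝ, B) 𝓘(ℝ, ℝ) ∞ (fun x => adCoeff b Z (s x : G)⁻¹)
        (QuotientGroup.mk n : Orbit a) :=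
      (contMDiff_adCoeff b Z).contMDiffAt.comp (QuotientGroup.mk n : Orbit a)
        (hemb.contMDiff.contMDiffAt.comp (QuotientGroup.mk n : Orbit a) hs).inv
    refine h1.congr_of_eventuallyEq ?_
    filter_upwards [hs'] with y hy
    conv_lhs => rw [← hy, hΦ]
    rfl
  have horbit (x : Orbit a) : MDifferentiableAt 𝓘(ℝ, E) 𝓘(ℝ, B) (fun g : G => ρ g x) 1 :=
    (contMDiff_orbit_of_action hsmooth x).mdifferentiable (by simp) _
  have hsurj (x : Orbit a) : Surjective (infLin (B := B) (E := E) ρ x) := by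
    obtain ⟨n, rfl⟩ := QuotientGroup.mk_surjective x
    obtain ⟨s, hs, hs0, hs'⟩ := exists_section_orbit hsub n
    refine surjective_infLin (κ := fun y => (s y : G) * (n : G)⁻¹)
      ((hemb.contMDiff.contMDiffAt.comp (QuotientGroup.mk n : Orbit a) hs).mul contMDiffAt_const)
      (by rw [hs0, mul_inv_cancel]) ?_ (horbit _)
    filter_upwards [hs'] with y hy
    refine (hρ _ _ (s y) ?_).trans hy
    simp
  obtain ⟨w, hw, hH⟩ := exists_isHamiltonian hsmooth hmoment hΦρ hsurj
  have hinf (Y : GroupLieAlgebra 𝓘(ℝ, F) N) (x : Orbit a) :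
      (infAction (MulAction.toPermHom N (Orbit a)) Y x : TangentSpace 𝓘(ℝ, B) x) =
        infAction ρ (inclLie Y : GroupLieAlgebra 𝓘(ℝ, E) G) x := by
    have h1 := mfderiv_comp_apply_of_eq (I := 𝓘(ℝ, F)) (I' := 𝓘(ℝ, E)) (I'' := 𝓘(ℝ, B))
      (g := fun g : G => ρ g x) (f := ((↑) : N → G)) (x := (1 : N)) (y := (1 : G)) (horbit x)
      (hemb.contMDiff.mdifferentiable (by simp) _) rfl Y
    have h2 : (fun n : N => MulAction.toPermHom N (Orbit a) n x) =
        (fun g : G => ρ g x) ∘ ((↑) : N → G) := funext fun n => (hN n x).symm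
    exact (congrArg (fun f : N → Orbit a => (mfderiv 𝓘(ℝ, F) 𝓘(ℝ, B) f 1 : F →L[ℝ] B) Y) h2
      ).trans h1
  refine ⟨w, ρ, Φ, fun n X Y W hW => ?_, hH, hN, fun n Y => ?_⟩
  · rw [hinf, hinf, hw, ← inclLie_lie hemb, ← hW, hΦ]
    exact h.coadG_coadN n W
  · rw [hΦ]
    exact h.coadG_coadN n Y

end HamiltonianOrbit

/-! ### Linear forms which vanish on the Lie algebra of `K` -/

section VanishingOnStabilizer

open Set Filter Function Module

variable {E : Type*} [NormedAddCommGroup E] [NormedSpace ℝ E] [FiniteDimensional ℝ E]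
  {G : Type*} [TopologicalSpace G] [ChartedSpace E G] [Group G] [LieGroup 𝓘(ℝ, E) ∞ G]
  {N : Subgroup G} [N.Normal] {a : Module.Dual ℝ (lieSub (E := E) N)}
  {F : Type*} [NormedAddCommGroup F] [NormedSpace ℝ F] [FiniteDimensional ℝ F]
  [ChartedSpace F N] [LieGroup 𝓘(ℝ, F) ∞ N]

/-- If `a` vanishes on `𝔨`, then the form on `𝔤 = 𝔫 + 𝔩` which is `a` on `𝔫` and `0` on `𝔩` is
fixed by the stabilizer of `a`. -/
lemma exists_extends_fixed (hemb : Manifold.IsSmoothEmbedding 𝓘(ℝ, F) 𝓘(ℝ, E) ∞ ((↑) : N → G))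
    (hsup : lieSub (E := E) N ⊔ lieSub (stabG a) = ⊤)
    (ha : ∀ X : lieSub (E := E) N,
      (X : GroupLieAlgebra 𝓘(ℝ, E) G) ∈ lieSub (stabN a) → a X = 0) :
    ∃ b : Dual ℝ (GroupLieAlgebra 𝓘(ℝ, E) G), Extends b a ∧ ∀ l ∈ stabG a, coadG l b = b := by
  -- `a` descends to the image of `𝔫` in `𝔤/𝔩`, which is everything
  let π : lieSub (E := E) N →ₗ[ℝ] GroupLieAlgebra 𝓘(ℝ, E) G ⧸ lieSub (E := E) (stabG a) :=
    (lieSub (stabG a)).mkQ ∘ₗ (lieSub N).subtype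
  have hπ : a ∈ π.dualMap.range := by
    rw [LinearMap.range_dualMap_eq_dualAnnihilator_ker, Submodule.mem_dualAnnihilator]
    intro Y hY
    refine ha Y ?_
    rw [lieSub_stabN hemb]
    exact ⟨Y.2, (Submodule.Quotient.mk_eq_zero _).1 hY⟩
  obtain ⟨c, hc⟩ := hπ
  let b : Dual ℝ (GroupLieAlgebra 𝓘(ℝ, E) G) := c ∘ₗ (lieSub (stabG a)).mkQ
  have h : Extends b a := fun Y => congrArg (fun f => f Y) hc
  have hb {X : GroupLieAlgebra 𝓘(ℝ, E) G} (hX : X ∈ lieSub (stabG a)) : b X = 0 :=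
    (congrArg c ((Submodule.Quotient.mk_eq_zero _).2 hX)).trans (map_zero c)
  refine ⟨b, h, fun l hl => LinearMap.ext fun Z => ?_⟩
  obtain ⟨Y, hY, X, ⟨γ, hγ, hs⟩, rfl⟩ := Submodule.mem_sup.1 (hsup ▸ Submodule.mem_top : Z ∈ _)
  have h1 : Ad l⁻¹ X ∈ lieSub (stabG a) :=
    ⟨_, hγ.conj l⁻¹, fun t => mul_mem (mul_mem (inv_mem hl) (hs t)) (inv_mem (inv_mem hl))⟩
  have h2 : X ∈ lieSub (stabG a) := ⟨γ, hγ, hs⟩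
  rw [coadG_apply, (Ad l⁻¹).map_add, b.map_add, b.map_add, hb h1, hb h2, h.mem_stabG.1 hl Y hY]

end VanishingOnStabilizer
end Mackey

end

theorem mainTheorem5
    {E : Type} [NormedAddCommGroup E] [NormedSpace ℝ E] [FiniteDimensional ℝ E]
    {G : Type} [TopologicalSpace G] [ChartedSpace E G] [Group G] [LieGroup 𝓘(ℝ, E) ∞ G]
    [T2Space G] [SecondCountableTopology G]
    (N : Subgroup G) [N.Normal] (hN : IsClosed (N : Set G))
    {F : Type*} [NormedAddCommGroup F] [NormedSpace ℝ F] [FiniteDimensional ℝ F]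
    [ChartedSpace F N] [LieGroup 𝓘(ℝ, F) ∞ N]
    (hemb : Manifold.IsSmoothEmbedding 𝓘(ℝ, F) 𝓘(ℝ, E) ∞ ((↑) : N → G))
    (a : Module.Dual ℝ (Mackey.lieSub (E := E) N))
    (hU : ∀ (g : G) (n : N), ∃ n' : N,
      Mackey.coadN N g (Mackey.coadN N (n : G) a) = Mackey.coadN N (n' : G) a) :
    ∃ Θ : groupCohomology.H1 (Rep.of (Mackey.covRep a)),
      -- `Θ` is the class of the cocycle defined by any extension of `a` to `𝔤`
      (∀ â : Module.Dual ℝ (GroupLieAlgebra 𝓘(ℝ, E) G),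
        (∀ X : Mackey.lieSub (E := E) N, â X = a X) →
        ∃ θ : groupCohomology.cocycles₁ (Rep.of (Mackey.covRep a)),
          Mackey.IsNonequivarianceCocycle a â θ ∧ groupCohomology.H1π _ θ = Θ) ∧
      -- it is the obstruction to making `U = N(a)` a hamiltonian `G`-space
      (∀ (m : ℕ) [ChartedSpace (EuclideanSpace ℝ (Fin m)) (Mackey.Orbit a)]
        [IsManifold 𝓘(ℝ, EuclideanSpace ℝ (Fin m)) ∞ (Mackey.Orbit a)],
        Manifold.IsSubmersion 𝓘(ℝ, F) 𝓘(ℝ, EuclideanSpace ℝ (Fin m)) ∞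
          (QuotientGroup.mk : N → Mackey.Orbit a) →
        (Θ = 0 ↔ Mackey.OrbitIsHamiltonian (F := F) (B := EuclideanSpace ℝ (Fin m)) a)) ∧
      -- it vanishes if `a` vanishes on `𝔨`
      ((∀ X : Mackey.lieSub (E := E) N,
        (X : GroupLieAlgebra 𝓘(ℝ, E) G) ∈ Mackey.lieSub (Mackey.stabN a) → a X = 0) → Θ = 0) ∧
      -- the Lie algebras of `N`, `L` and `K`, and the kernel of `a` on `𝔨`
      ∃ (𝔫 : LieIdeal ℝ (GroupLieAlgebra 𝓘(ℝ, E) G))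
        (𝔩 : LieSubalgebra ℝ (GroupLieAlgebra 𝓘(ℝ, E) G)) (𝔨 𝔧 : LieIdeal ℝ 𝔩),
        (∀ X, X ∈ 𝔫 ↔ X ∈ Mackey.lieSub N) ∧
        (∀ X, X ∈ 𝔩 ↔ X ∈ Mackey.lieSub (Mackey.stabG a)) ∧
        (∀ X : 𝔩, X ∈ 𝔨 ↔ (X : GroupLieAlgebra 𝓘(ℝ, E) G) ∈ Mackey.lieSub (Mackey.stabN a)) ∧
        (∀ X : 𝔩, X ∈ 𝔧 ↔ X ∈ 𝔨 ∧ ∀ Y : Mackey.lieSub (E := E) N,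
          (Y : GroupLieAlgebra 𝓘(ℝ, E) G) = X → a Y = 0) ∧
        -- `δ` is the derived class of `Θ`
        ∃ δ : Mackey.H2 (GroupLieAlgebra 𝓘(ℝ, E) G ⧸ 𝔫),
          (∀ θ : groupCohomology.cocycles₁ (Rep.of (Mackey.covRep a)),
            groupCohomology.H1π _ θ = Θ →
            ∃ f : Mackey.Z2 (GroupLieAlgebra 𝓘(ℝ, E) G ⧸ 𝔫),
              Mackey.HasDerivAtIdentity a θ
                (fun X Y => f.1 (LieSubmodule.Quotient.mk X) (LieSubmodule.Quotient.mk Y)) ∧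
              Mackey.H2.mk f = δ) ∧
          -- if `a` does not vanish on `𝔨`, it is the class of the central extension
          ((∃ X : Mackey.lieSub (E := E) N,
            (X : GroupLieAlgebra 𝓘(ℝ, E) G) ∈ Mackey.lieSub (Mackey.stabN a) ∧ a X ≠ 0) →
            ∃ (e : (𝔩 ⧸ 𝔨) ≃ₗ⁅ℝ⁆ (GroupLieAlgebra 𝓘(ℝ, E) G ⧸ 𝔫))
              (i : (𝔨 ⧸ 𝔧.comap 𝔨.incl) →ₗ⁅ℝ⁆ (𝔩 ⧸ 𝔧)) (p : (𝔩 ⧸ 𝔧) →ₗ⁅ℝ⁆ (𝔩 ⧸ 𝔨))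
              (ψ : (𝔨 ⧸ 𝔧.comap 𝔨.incl) ≃ₗ[ℝ] ℝ),
              (∀ X : 𝔩, e (LieSubmodule.Quotient.mk X) =
                LieSubmodule.Quotient.mk (X : GroupLieAlgebra 𝓘(ℝ, E) G)) ∧
              (∀ X : 𝔨, i (LieSubmodule.Quotient.mk X) = LieSubmodule.Quotient.mk (X : 𝔩)) ∧
              (∀ X : 𝔩, p (LieSubmodule.Quotient.mk X) = LieSubmodule.Quotient.mk X) ∧
              (∀ (X : 𝔨) (Y : Mackey.lieSub (E := E) N),
                (Y : GroupLieAlgebra 𝓘(ℝ, E) G) = (X : 𝔩) →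
                ψ (LieSubmodule.Quotient.mk X) = a Y) ∧
              LieAlgebra.IsExtension i p ∧ (∀ (z : 𝔨 ⧸ 𝔧.comap 𝔨.incl) (y : 𝔩 ⧸ 𝔧), ⁅i z, y⁆ = 0) ∧
              Mackey.IsExtensionClass i (e.toLieHom.comp p) ψ δ) := by
  have hU' : ∀ g : G, ∃ n : N, Mackey.coadN N g a = Mackey.coadN N (n : G) a := fun g => by
    simpa using hU g 1
  obtain ⟨ν, hν, hν1, hνL⟩ := Mackey.exists_splitting hemb hU'
  have hsup := Mackey.lieSub_sup_stabG hemb hU'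
  obtain ⟨b₀, h₀⟩ := Mackey.exists_extends a
  have hfix {b : Module.Dual ℝ (GroupLieAlgebra 𝓘(ℝ, E) G)} (h : Mackey.Extends b a) :
      ∀ k ∈ Mackey.stabNo a, Mackey.coadG k b = b := fun k hk =>
    h.coadG_of_mem_stabNo hemb hsup hk
  have hΘ := h₀.H1π_theta_eq_zero_iff (hfix h₀)
  refine ⟨groupCohomology.H1π _ (h₀.theta (hfix h₀)), fun b hb => ?_, fun m _ _ hsub => ?_,
    fun hk => ?_, ?_⟩
  · exact ⟨Mackey.Extends.theta hb (hfix hb),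
      Mackey.Extends.isNonequivarianceCocycle_theta hb (hfix hb),
      (h₀.H1π_eq_theta_iff (hfix h₀) _).2 ⟨b, hb, Mackey.Extends.theta_mk hb (hfix hb)⟩⟩
  · rw [hΘ]
    exact ⟨fun ⟨b, hb, hL⟩ => hb.orbitIsHamiltonian hemb hsub hL hν hνL, fun H => H.exists_extends⟩
  · exact hΘ.2 (Mackey.exists_extends_fixed hemb hsup hk)
  -- `𝔧` is the kernel on `𝔨` of any linear form on `𝔤` which extends `a`, such as `b₀`
  let 𝔫 : LieIdeal ℝ (GroupLieAlgebra 𝓘(ℝ, E) G) := Mackey.lieIdeal N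
  let 𝔩 : LieSubalgebra ℝ (GroupLieAlgebra 𝓘(ℝ, E) G) := Mackey.lieSubalgebra (Mackey.stabG a)
  have hsup' : 𝔫.toSubmodule ⊔ 𝔩.toSubmodule = ⊤ := hsup
  have hb {b : Module.Dual ℝ (GroupLieAlgebra 𝓘(ℝ, E) G)} (h : Mackey.Extends b a) :
      ∀ X ∈ 𝔩, ∀ Y ∈ 𝔫, b ⁅X, Y⁆ = 0 := fun X hX => h.mem_lieSub_stabG.1 hX
  let 𝔨 : LieIdeal ℝ 𝔩 := 𝔫.comap 𝔩.incl
  let 𝔧 : LieIdeal ℝ 𝔩 :=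
    { __ := 𝔨.toSubmodule ⊓ (b₀ ∘ₗ 𝔩.toSubmodule.subtype).ker
      lie_mem := fun {X Y} hY => ⟨𝔨.lie_mem hY.1, hb h₀ X X.2 Y hY.1⟩ }
  have h𝔨 (X : 𝔩) : X ∈ 𝔨 ↔ (X : GroupLieAlgebra 𝓘(ℝ, E) G) ∈ 𝔫 := Iff.rfl
  have h𝔧 (X : 𝔩) : X ∈ 𝔧 ↔ X ∈ 𝔨 ∧ b₀ X = 0 := Iff.rfl
  have h𝔨' (X : 𝔩) : X ∈ 𝔨 ↔
      (X : GroupLieAlgebra 𝓘(ℝ, E) G) ∈ Mackey.lieSub (Mackey.stabN a) := by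
    rw [Mackey.lieSub_stabN hemb]
    exact ⟨fun hX => ⟨hX, X.2⟩, fun hX => hX.1⟩
  obtain ⟨f, hf⟩ := Mackey.exists_derivedCocycle (n := 𝔫) (l := 𝔩) hsup' (hb h₀)
  refine ⟨𝔫, 𝔩, 𝔨, 𝔧, fun _ => Iff.rfl, fun _ => Iff.rfl, h𝔨', fun X => ?_, Mackey.H2.mk f,
    fun θ hθ => ?_, fun ⟨X, hX, hX'⟩ => ?_⟩
  · rw [h𝔧]
    refine and_congr_right fun hX => ⟨fun h Y hY => ?_, fun h => ?_⟩
    · rw [← h₀ Y, hY, h]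
    · exact (h₀ ⟨X, hX⟩).trans (h ⟨X, hX⟩ rfl)
  · obtain ⟨b, h, hθ'⟩ := (h₀.H1π_eq_theta_iff (hfix h₀) θ).1 hθ
    obtain ⟨f', hf'⟩ := Mackey.exists_derivedCocycle (n := 𝔫) (l := 𝔩) hsup' (hb h)
    exact ⟨f', h.hasDerivAtIdentity hemb hν hν1 hνL hθ' hf',
      Mackey.H2.mk_derivedCocycle_eq (n := 𝔫) (l := 𝔩) hsup'
        (fun Y hY => (h ⟨Y, hY⟩).trans (h₀ ⟨Y, hY⟩).symm) hf' hf⟩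
  · rw [Mackey.lieSub_stabN hemb] at hX
    obtain ⟨e, i, p, ψ, he, hi, hp, hψ, hext, hcentral, hclass⟩ :=
      Mackey.exists_centralExtension (n := 𝔫) (l := 𝔩) hsup' (hb h₀) h𝔨 h𝔧
        ⟨⟨X, hX.2⟩, hX.1, by rwa [← h₀ X] at hX'⟩ hf
    refine ⟨e, i, p, ψ, he, hi, hp, fun X Y hXY => ?_, hext, hcentral, hclass⟩
    rw [hψ, ← h₀ Y, hXY]
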